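/- Let $\beta,h\in\mathbb R$, let $N\ge 1$, and let $J_{ij}$, $1\le i<j\le N$, be independent standard Gaussian random variables. Put $$H_N(\sigma,h,J)=-\frac1{\sqrt N}\sum_{1\le i<j\le N}J_{ij}\sigma_i\sigma_j-h\sum_{i=1}^N\sigma_i,\qquad Z_N(\beta,h,J)=\sum_{\sigma\in\{-1,1\}^N}e^{-\beta H_N(\sigma,h,J)} .$$ Let $\mathcal X$ be the set of functional order parameters, i.e. of all nondecreasing functions $x:[0,1]\to[0,1]$. For $x\in\mathcal X$ let $f(q,y;x,\beta)$, $q\in[0,1]$, $y\in\mathbb R$, be the solution of $$\partial_q f+\tfrac12\,\partial_y^2 f+\tfrac12\,x(q)\,(\partial_y f)^2=0,\qquad f(1,y)=\log\cosh(\beta y),$$ where a solution means a function $f$ such that $f,\partial_yf,\partial_y^2f$ are continuous on $[0,1]\times\mathbb R$, $\partial_yf$ is bounded, and the equation holds at every $(q,y)$ with $q\in(0,1)$ a continuity point of $x$. For each $x\in\mathcal X$ there is exactly one such solution. Moreover $\log Z_N(\beta,h,J)$ is integrable, and for every $x\in\mathcal X$ $$N^{-1}\,E\log Z_N(\beta,h,J)\;\le\;\log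 2+f(0,h;x,\beta)-\frac{\beta^2}{2}\int_0^1 q\,x(q)\,dq .$$ The right-hand side does not depend on $N$: the bound is uniform in $N$. Consequently, for every $N\ge1$, $$N^{-1}\,E\log Z_N(\beta,h,J)\;\le\;\inf_{x\in\mathcal X}\Bigl(\log 2+f(0,h;x,\beta)-\frac{\beta^2}{2}\int_0^1 q\,x(q)\,dq\Bigr).$$ -/

import Mathlib

open MeasureTheory ProbabilityTheory Set

noncomputable section

namespace SpinGlass

/-- The couples of distinct sites `(i, j)`, each couple being counted once (`i < j`). -/
abbrev Couple (N : ℕ) : Type := {p : Fin N × Fin N // p.1 < p.2}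

/-- Configurations of `N` Ising spins, `σ i = ± 1`. -/
abbrev Config (N : ℕ) : Type := Fin N → ℤˣ

/-- The value `± 1` of the spin at the site `i`, as a real number. -/
def spin {N : ℕ} (σ : Config N) (i : Fin N) : ℝ := ((σ i : ℤ) : ℝ)

/-- The Hamiltonian
`H_N(σ, h, J) = - N^{-1/2} ∑_{(i,j)} J_{ij} σ_i σ_j - h ∑_i σ_i`. -/
def hamiltonian {N : ℕ} (h : ℝ) (J : Couple N → ℝ) (σ : Config N) : ℝ :=
  -(1 / √(N : ℝ)) * ∑ p : Couple N, J p * spin σ p.1.1 * spin σ p.1.2 - h * ∑ i, spin σ i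

/-- The partition function `Z_N(β, h, J) = ∑_σ exp (- β H_N(σ, h, J))`. -/
def partitionFunction {N : ℕ} (β h : ℝ) (J : Couple N → ℝ) : ℝ :=
  ∑ σ : Config N, Real.exp (-β * hamiltonian h J σ)

/-- The functional order parameters: nondecreasing functions `[0,1] → [0,1]`.
(They are represented by functions on `ℝ`; values outside `[0,1]` play no role.) -/
def OrderParameter : Set (ℝ → ℝ) :=
  {x | MonotoneOn x (Icc 0 1) ∧ MapsTo x (Icc 0 1) (Icc 0 1)}

/-- `f = f(q, y)` solves, on `[0,1] × ℝ`, the antiparabolic equation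
`∂_q f + (1/2) ∂_y² f + (1/2) x(q) (∂_y f)² = 0` with final condition `f(1, y) = log cosh (β y)`.

A nondecreasing `x` may have (countably many) jumps. The equation is required at every point
`(q, y)` such that `q ∈ (0,1)` is a continuity point of `x`; across the jumps, and up to `q = 0`
and `q = 1`, the functions `f`, `∂_y f`, `∂_y² f` are continuous.
Boundedness of `∂_y f` is the usual growth condition, without which not even the heat equation
(`x = 0`) has only one solution. -/
structure IsParisiSolution (β : ℝ) (x : ℝ → ℝ) (f : ℝ → ℝ → ℝ) : Prop where
  contDiff : ∀ q ∈ Icc (0 : ℝ) 1, ContDiff ℝ 2 (f q)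
  continuousOn : ContinuousOn (fun p : ℝ × ℝ => f p.1 p.2) (Icc 0 1 ×ˢ univ)
  continuousOn_deriv :
    ContinuousOn (fun p : ℝ × ℝ => deriv (f p.1) p.2) (Icc 0 1 ×ˢ univ)
  continuousOn_deriv_deriv :
    ContinuousOn (fun p : ℝ × ℝ => deriv (deriv (f p.1)) p.2) (Icc 0 1 ×ˢ univ)
  bounded_deriv : ∃ C : ℝ, ∀ q ∈ Icc (0 : ℝ) 1, ∀ y : ℝ, |deriv (f q) y| ≤ C
  differentiableAt : ∀ q ∈ Ioo (0 : ℝ) 1, ContinuousAt x q → ∀ y : ℝ,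
    DifferentiableAt ℝ (fun s => f s y) q
  equation : ∀ q ∈ Ioo (0 : ℝ) 1, ContinuousAt x q → ∀ y : ℝ,
    deriv (fun s => f s y) q + 1 / 2 * deriv (deriv (f q)) y
      + 1 / 2 * x q * (deriv (f q) y) ^ 2 = 0
  final : ∀ y : ℝ, f 1 y = Real.log (Real.cosh (β * y))

open Classical in
/-- The solution `f(q, y; x, β)` of the antiparabolic equation. -/
def parisiF (β : ℝ) (x : ℝ → ℝ) : ℝ → ℝ → ℝ :=
  if hf : ∃ f, IsParisiSolution β x f then hf.choose else 0

/-- The trial function `log 2 + f(0, h; x, β) - (β² / 2) ∫_0^1 q x(q) dq`. -/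
def trial (β h : ℝ) (x : ℝ → ℝ) : ℝ :=
  Real.log 2 + parisiF β x 0 h - β ^ 2 / 2 * ∫ q in (0 : ℝ)..1, q * x q

end SpinGlass

end

/-!
The upper bound is proved by Gaussian interpolation between the `N`-body system and `N` independent
copies of the one-site recursion; the antiparabolic equation is solved by the Hopf–Cole
transformation.

**The equation.** On an interval where `x` has the constant value `m > 0` the equation is linear for
`exp (m f)`, so `f (q, y)` is `m⁻¹ log E exp (m f (b, y + √(b - q) z))` with `z` a standard Gaussian
variable (`MildSolution.extend`, from the heat equation `dirDeriv_param_gavg`). This solves the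
equation for step functions. The expressions `∂²f + m (∂f)²` and `∂³f + 3m ∂f ∂²f + m² (∂f)³` are
averages under such a step, which bounds three space derivatives independently of the number of
steps (`DerivBounds`). A maximum principle (`MildSolution.sub_le`) bounds the difference of two
solutions by `∫ |x - x'|`: this is uniqueness, and it makes the solutions for step functions tending
to `x` a Cauchy sequence, whose limit is the solution (`exists_limit_solution`). All of this is done
for the integrated equation `MildSolution`, which is indifferent to the jumps of `x`.

**The interpolation.** For a step function with the values `m_j` the same recursion is run on
functions of the energies `g : Config N → ℝ`, starting from `log ∑ exp g`. The local fields are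
displaced with variance proportional to `cos² θ`, and at the end, with the smallest `m`, the
couplings with variance `sin² θ` (`siteFun`, `interp`). At `θ = 0` the sites decouple and the one-site
recursion appears (`interp_zero`). At `θ = π / 2` only the couplings are left, and by Jensen's
inequality the result is at least `E log Z` (`integral_le_coleList`). The derivative in `θ` is
controlled by carrying an upper bound for the operator `gen` through the recursion: a Hopf–Cole step
is an average for it (`gen_cole_le`), and whenever `m` decreases the change is a quadratic form in the
gradient. The gradient is a probability vector (`IsGibbs.exists_prob`), so for two independent
configurations with overlap `R` this quadratic form is the average of `(R - q)² - q²` up to a positive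
factor and a constant, and the square has the good sign (`neg_le_sum_dirs`). What is left of `-q²`
adds up to the integral of `q x(q)` (`interp_pi_div_two_le`, `levelSum_eq`). Refining the grid gives
the bound for every order parameter.
-/

noncomputable section

set_option linter.unusedSectionVars false

namespace SpinGlass

open Filter Topology

/-! ### Functions whose derivatives grow at most exponentially -/

section ExpGrowth

variable {F F' H H₁ H₂ H₃ : Type}
  [NormedAddCommGroup F] [NormedSpace ℝ F] [NormedAddCommGroup F'] [NormedSpace ℝ F']
  [NormedAddCommGroup H] [NormedSpace ℝ H] [NormedAddCommGroup H₁] [NormedSpace ℝ H₁]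
  [NormedAddCommGroup H₂] [NormedSpace ℝ H₂] [NormedAddCommGroup H₃] [NormedSpace ℝ H₃]

/-- At most exponential growth in the norm of the variable. -/
def ExpBdd (u : F → H) : Prop :=
  ∃ A B : ℝ, 0 ≤ A ∧ 0 ≤ B ∧ ∀ p, ‖u p‖ ≤ A * Real.exp (B * ‖p‖)

/-- At most linear growth in the norm of the variable. -/
def LinBdd (u : F → H) : Prop := ∃ C : ℝ, 0 ≤ C ∧ ∀ p, ‖u p‖ ≤ C * (1 + ‖p‖)

/-- `n` times continuously differentiable, all derivatives up to order `n` growing at most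
exponentially. The recursion through `fderiv` makes closure properties one-line inductions. -/
def ExpSmooth : ℕ → ∀ {H : Type} [NormedAddCommGroup H] [NormedSpace ℝ H], (F → H) → Prop
  | 0, _, _, _, u => Continuous u ∧ ExpBdd u
  | n + 1, _, _, _, u => ExpBdd u ∧ Differentiable ℝ u ∧ ExpSmooth n (fderiv ℝ u)

theorem ExpBdd.add {u v : F → H} (hu : ExpBdd u) (hv : ExpBdd v) :
    ExpBdd (fun p => u p + v p) := by
  obtain ⟨A, B, hA, hB, h⟩ := hu
  obtain ⟨A', B', hA', hB', h'⟩ := hv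
  refine ⟨A + A', B + B', by positivity, by positivity, fun p => ?_⟩
  have h1 : Real.exp (B * ‖p‖) ≤ Real.exp ((B + B') * ‖p‖) := by gcongr; linarith
  have h2 : Real.exp (B' * ‖p‖) ≤ Real.exp ((B + B') * ‖p‖) := by gcongr; linarith
  calc ‖u p + v p‖ ≤ ‖u p‖ + ‖v p‖ := norm_add_le _ _
    _ ≤ A * Real.exp (B * ‖p‖) + A' * Real.exp (B' * ‖p‖) := add_le_add (h p) (h' p)
    _ ≤ A * Real.exp ((B + B') * ‖p‖) + A' * Real.exp ((B + B') * ‖p‖) := by gcongr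
    _ = _ := by ring

theorem ExpBdd.bilin (L : H₁ →L[ℝ] H₂ →L[ℝ] H₃) {u : F → H₁} {v : F → H₂}
    (hu : ExpBdd u) (hv : ExpBdd v) : ExpBdd (fun p => L (u p) (v p)) := by
  obtain ⟨A, B, hA, hB, h⟩ := hu
  obtain ⟨A', B', hA', hB', h'⟩ := hv
  refine ⟨‖L‖ * A * A', B + B', by positivity, by positivity, fun p => ?_⟩
  calc ‖L (u p) (v p)‖ ≤ ‖L‖ * ‖u p‖ * ‖v p‖ := L.le_opNorm₂ _ _
    _ ≤ ‖L‖ * (A * Real.exp (B * ‖p‖)) * (A' * Real.exp (B' * ‖p‖)) := by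
        gcongr
        · exact h p
        · exact h' p
    _ = _ := by rw [add_mul, Real.exp_add]; ring

theorem ExpBdd.clm (L : H₁ →L[ℝ] H₂) {u : F → H₁} (hu : ExpBdd u) :
    ExpBdd (fun p => L (u p)) := by
  obtain ⟨A, B, hA, hB, h⟩ := hu
  refine ⟨‖L‖ * A, B, by positivity, hB, fun p => ?_⟩
  calc ‖L (u p)‖ ≤ ‖L‖ * ‖u p‖ := L.le_opNorm _
    _ ≤ ‖L‖ * (A * Real.exp (B * ‖p‖)) := by gcongr; exact h p
    _ = _ := by ring

theorem LinBdd.expBdd {u : F → H} (hu : LinBdd u) : ExpBdd u := by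
  obtain ⟨C, hC, h⟩ := hu
  refine ⟨C, 1, hC, zero_le_one, fun p => (h p).trans ?_⟩
  have := Real.add_one_le_exp ‖p‖
  gcongr
  rw [one_mul]; linarith

theorem ExpBdd.comp {u : F' → H} {A : F → F'} (hu : ExpBdd u) (hA : LinBdd A) :
    ExpBdd (fun p => u (A p)) := by
  obtain ⟨K, B, hK, hB, h⟩ := hu
  obtain ⟨C, hC, h'⟩ := hA
  refine ⟨K * Real.exp (B * C), B * C, by positivity, by positivity, fun p => (h _).trans ?_⟩
  rw [mul_assoc, ← Real.exp_add]
  gcongr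
  nlinarith [mul_le_mul_of_nonneg_left (h' p) hB]

theorem expBdd_const (c : H) : ExpBdd (fun _ : F => c) :=
  ⟨‖c‖, 0, norm_nonneg _, le_rfl, fun p => by simp⟩

theorem linBdd_clm (L : F →L[ℝ] H) : LinBdd L :=
  ⟨‖L‖, norm_nonneg _, fun p => (L.le_opNorm p).trans (by gcongr; linarith)⟩

theorem LinBdd.add {u v : F → H} (hu : LinBdd u) (hv : LinBdd v) :
    LinBdd (fun p => u p + v p) := by
  obtain ⟨C, hC, h⟩ := hu
  obtain ⟨C', hC', h'⟩ := hv
  refine ⟨C + C', by positivity, fun p => (norm_add_le _ _).trans ?_⟩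
  linarith [h p, h' p]

theorem ExpSmooth.expBdd : ∀ {n : ℕ} {u : F → H}, ExpSmooth n u → ExpBdd u
  | 0, _, h => h.2
  | _ + 1, _, h => h.1

theorem ExpSmooth.continuous : ∀ {n : ℕ} {u : F → H}, ExpSmooth n u → Continuous u
  | 0, _, h => h.1
  | _ + 1, _, h => h.2.1.continuous

theorem ExpSmooth.pred {n : ℕ} : ∀ {H : Type} [NormedAddCommGroup H] [NormedSpace ℝ H]
    {u : F → H}, ExpSmooth (n + 1) u → ExpSmooth n u := by
  induction n with
  | zero => intro H _ _ u h; exact ⟨h.continuous, h.expBdd⟩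
  | succ n ih => intro H _ _ u h; exact ⟨h.1, h.2.1, ih h.2.2⟩

theorem ExpSmooth.differentiable {n : ℕ} {u : F → H} (h : ExpSmooth (n + 1) u) :
    Differentiable ℝ u := h.2.1

theorem ExpSmooth.hasFDerivAt {n : ℕ} {u : F → H} (h : ExpSmooth (n + 1) u) (p : F) :
    HasFDerivAt u (fderiv ℝ u p) p := (h.2.1 p).hasFDerivAt

theorem ExpSmooth.fderiv {n : ℕ} {u : F → H} (h : ExpSmooth (n + 1) u) :
    ExpSmooth n (fderiv ℝ u) := h.2.2

theorem ExpSmooth.of_hasFDerivAt {n : ℕ} {u : F → H} {u' : F → F →L[ℝ] H} (h0 : ExpBdd u)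
    (h1 : ∀ p, HasFDerivAt u (u' p) p) (h2 : ExpSmooth n u') : ExpSmooth (n + 1) u := by
  refine ⟨h0, fun p => (h1 p).differentiableAt, ?_⟩
  rwa [show _root_.fderiv ℝ u = u' from funext fun p => (h1 p).fderiv]

theorem expSmooth_const (n : ℕ) : ∀ {H : Type} [NormedAddCommGroup H] [NormedSpace ℝ H] (c : H),
    ExpSmooth n (fun _ : F => c) := by
  induction n with
  | zero => intro H _ _ c; exact ⟨continuous_const, expBdd_const c⟩
  | succ n ih =>
    intro H _ _ c
    exact .of_hasFDerivAt (expBdd_const c) (fun p => hasFDerivAt_const c p) (ih _)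

theorem expSmooth_clm (n : ℕ) (L : F →L[ℝ] H) : ExpSmooth n L := by
  cases n with
  | zero => exact ⟨L.continuous, (linBdd_clm L).expBdd⟩
  | succ n =>
    exact .of_hasFDerivAt (linBdd_clm L).expBdd (fun p => L.hasFDerivAt) (expSmooth_const n L)

theorem ExpSmooth.add {n : ℕ} : ∀ {H : Type} [NormedAddCommGroup H] [NormedSpace ℝ H]
    {u v : F → H}, ExpSmooth n u → ExpSmooth n v → ExpSmooth n (fun p => u p + v p) := by
  induction n with
  | zero => intro H _ _ u v hu hv; exact ⟨hu.1.add hv.1, hu.2.add hv.2⟩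
  | succ n ih =>
    intro H _ _ u v hu hv
    exact .of_hasFDerivAt (hu.expBdd.add hv.expBdd)
      (fun p => (hu.hasFDerivAt p).add (hv.hasFDerivAt p)) (ih hu.fderiv hv.fderiv)

theorem ExpSmooth.clm {n : ℕ} : ∀ {H₁ H₂ : Type} [NormedAddCommGroup H₁] [NormedSpace ℝ H₁]
    [NormedAddCommGroup H₂] [NormedSpace ℝ H₂] (L : H₁ →L[ℝ] H₂) {u : F → H₁},
    ExpSmooth n u → ExpSmooth n (fun p => L (u p)) := by
  induction n with
  | zero => intro H₁ H₂ _ _ _ _ L u hu; exact ⟨L.continuous.comp hu.1, hu.2.clm L⟩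
  | succ n ih =>
    intro H₁ H₂ _ _ _ _ L u hu
    exact .of_hasFDerivAt (hu.expBdd.clm L)
      (fun p => L.hasFDerivAt.comp p (hu.hasFDerivAt p))
      (ih (ContinuousLinearMap.compL ℝ F H₁ H₂ L) hu.fderiv)

theorem ExpSmooth.bilin {n : ℕ} : ∀ {H₁ H₂ H₃ : Type} [NormedAddCommGroup H₁] [NormedSpace ℝ H₁]
    [NormedAddCommGroup H₂] [NormedSpace ℝ H₂] [NormedAddCommGroup H₃] [NormedSpace ℝ H₃]
    (L : H₁ →L[ℝ] H₂ →L[ℝ] H₃) {u : F → H₁} {v : F → H₂},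
    ExpSmooth n u → ExpSmooth n v → ExpSmooth n (fun p => L (u p) (v p)) := by
  induction n with
  | zero =>
    intro H₁ H₂ H₃ _ _ _ _ _ _ L u v hu hv
    exact ⟨L.continuous₂.comp (hu.1.prodMk hv.1), hu.2.bilin L hv.2⟩
  | succ n ih =>
    intro H₁ H₂ H₃ _ _ _ _ _ _ L u v hu hv
    exact .of_hasFDerivAt (hu.expBdd.bilin L hv.expBdd)
      (fun p => L.hasFDerivAt_of_bilinear (hu.hasFDerivAt p) (hv.hasFDerivAt p))
      ((ih (L.precompR F) hu.pred hv.fderiv).add (ih (L.precompL F) hu.fderiv hv.pred))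

theorem ExpSmooth.mul {n : ℕ} {u v : F → ℝ} (hu : ExpSmooth n u) (hv : ExpSmooth n v) :
    ExpSmooth n (fun p => u p * v p) :=
  ExpSmooth.bilin (ContinuousLinearMap.mul ℝ ℝ) hu hv

theorem ExpSmooth.smul {n : ℕ} {u : F → ℝ} {v : F → H} (hu : ExpSmooth n u)
    (hv : ExpSmooth n v) : ExpSmooth n (fun p => u p • v p) :=
  ExpSmooth.bilin (ContinuousLinearMap.lsmul ℝ ℝ) hu hv

theorem ExpSmooth.const_mul {n : ℕ} {u : F → ℝ} (c : ℝ) (hu : ExpSmooth n u) :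
    ExpSmooth n (fun p => c * u p) := (expSmooth_const n c).mul hu

theorem ExpSmooth.comp {n : ℕ} {A : F → F'} (hA : LinBdd A) (hA' : ExpSmooth n A) :
    ∀ {H : Type} [NormedAddCommGroup H] [NormedSpace ℝ H] {u : F' → H},
    ExpSmooth n u → ExpSmooth n (fun p => u (A p)) := by
  induction n with
  | zero => intro H _ _ u hu; exact ⟨hu.1.comp hA'.1, hu.2.comp hA⟩
  | succ n ih =>
    intro H _ _ u hu
    exact .of_hasFDerivAt (hu.expBdd.comp hA)
      (fun p => (hu.hasFDerivAt (A p)).comp p (hA'.hasFDerivAt p))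
      ((ih hA'.pred hu.fderiv).bilin (ContinuousLinearMap.compL ℝ F F' H) hA'.fderiv)

theorem ExpSmooth.exp {n : ℕ} {φ : F → ℝ} (hφ : ExpSmooth n φ) (hl : LinBdd φ) :
    ExpSmooth n (fun p => Real.exp (φ p)) := by
  have h0 : ExpBdd (fun p => Real.exp (φ p)) := by
    obtain ⟨C, hC, h⟩ := hl
    refine ⟨Real.exp C, C, by positivity, hC, fun p => ?_⟩
    rw [Real.norm_of_nonneg (by positivity), ← Real.exp_add]
    exact Real.exp_le_exp.2 (by linarith [h p, Real.le_norm_self (φ p)])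
  induction n with
  | zero => exact ⟨Real.continuous_exp.comp hφ.1, h0⟩
  | succ n ih =>
    exact .of_hasFDerivAt h0 (fun p => (hφ.hasFDerivAt p).exp) ((ih hφ.pred).smul hφ.fderiv)

/-- The lower bound makes the derivatives of the inverse grow at most exponentially. -/
theorem ExpSmooth.inv {n : ℕ} {U : F → ℝ} (hU : ExpSmooth n U) {A B : ℝ} (hA : 0 < A) (hB : 0 ≤ B)
    (hl : ∀ p, A * Real.exp (-(B * ‖p‖)) ≤ U p) : ExpSmooth n (fun p => (U p)⁻¹) := by
  have hpos : ∀ p, 0 < U p := fun p => lt_of_lt_of_le (by positivity) (hl p)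
  have h0 : ExpBdd (fun p => (U p)⁻¹) := by
    refine ⟨A⁻¹, B, by positivity, hB, fun p => ?_⟩
    have := hpos p
    rw [Real.norm_of_nonneg (by positivity)]
    refine (inv_anti₀ (by positivity) (hl p)).trans (le_of_eq ?_)
    rw [mul_inv, Real.exp_neg, inv_inv]
  induction n with
  | zero => exact ⟨hU.1.inv₀ fun p => (hpos p).ne', h0⟩
  | succ n ih =>
    refine .of_hasFDerivAt (u' := fun p => (-1 * ((U p)⁻¹ * (U p)⁻¹)) • _root_.fderiv ℝ U p) h0
      (fun p => ?_) ((ExpSmooth.const_mul (-1) ((ih hU.pred).mul (ih hU.pred))).smul hU.fderiv)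
    have := (hasDerivAt_inv (hpos p).ne').comp_hasFDerivAt p (hU.hasFDerivAt p)
    refine this.congr_fderiv ?_
    congr 1
    rw [pow_two, mul_inv]; ring

theorem ExpSmooth.log {n : ℕ} {U : F → ℝ} (hU : ExpSmooth n U) {A B : ℝ} (hA : 0 < A) (hB : 0 ≤ B)
    (hl : ∀ p, A * Real.exp (-(B * ‖p‖)) ≤ U p) (hlog : LinBdd (fun p => Real.log (U p))) :
    ExpSmooth n (fun p => Real.log (U p)) := by
  have hpos : ∀ p, 0 < U p := fun p => lt_of_lt_of_le (by positivity) (hl p)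
  cases n with
  | zero => exact ⟨hU.1.log fun p => (hpos p).ne', hlog.expBdd⟩
  | succ n =>
    exact .of_hasFDerivAt hlog.expBdd (fun p => (hU.hasFDerivAt p).log (hpos p).ne')
      ((hU.pred.inv hA hB hl).smul hU.fderiv)

/-- The standard Gaussian measure on the line. -/
abbrev gauss : Measure ℝ := gaussianReal 0 1

theorem integrable_exp_mul_abs_gauss (B : ℝ) :
    Integrable (fun z : ℝ => Real.exp (B * |z|)) gauss :=
  integrable_exp_mul_abs (X := fun z => z) (integrable_exp_mul_gaussianReal B)
    (integrable_exp_mul_gaussianReal (-B))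

theorem integrable_gauss_of_expBdd {u : ℝ → H} (hc : Continuous u) (hu : ExpBdd u) :
    Integrable u gauss := by
  obtain ⟨A, B, hA, hB, h⟩ := hu
  exact ((integrable_exp_mul_abs_gauss B).const_mul A).mono' hc.aestronglyMeasurable
    (.of_forall fun z => h z)

theorem norm_prod_le_add (p : F) (z : ℝ) : ‖(p, z)‖ ≤ ‖p‖ + |z| := by
  rw [Prod.norm_def]
  exact max_le (by simp) (by simp)

theorem ExpBdd.integrable_gauss {u : F × ℝ → H} (hc : Continuous u) (hu : ExpBdd u) (p : F) :
    Integrable (fun z => u (p, z)) gauss := by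
  obtain ⟨A, B, hA, hB, h⟩ := hu
  refine integrable_gauss_of_expBdd (by fun_prop)
    ⟨A * Real.exp (B * ‖p‖), B, by positivity, hB, fun z => (h _).trans ?_⟩
  rw [mul_assoc, ← Real.exp_add, ← mul_add]
  gcongr
  exact norm_prod_le_add p z

theorem ExpBdd.integral_gauss {u : F × ℝ → H} (hu : ExpBdd u) :
    ExpBdd (fun p => ∫ z, u (p, z) ∂gauss) := by
  obtain ⟨A, B, hA, hB, h⟩ := hu
  refine ⟨A * ∫ z, Real.exp (B * |z|) ∂gauss, B, by positivity, hB, fun p => ?_⟩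
  refine (norm_integral_le_of_norm_le (((integrable_exp_mul_abs_gauss B).const_mul
    (A * Real.exp (B * ‖p‖)))) (.of_forall fun z => (h _).trans ?_)).trans (le_of_eq ?_)
  · rw [mul_assoc, ← Real.exp_add, ← mul_add]
    gcongr
    exact norm_prod_le_add p z
  · rw [integral_const_mul]; ring

theorem ExpSmooth.hasFDerivAt_integral_gauss {u : F × ℝ → H} (hu : ExpSmooth 1 u) (p : F) :
    HasFDerivAt (fun p => ∫ z, u (p, z) ∂gauss)
      (∫ z, (_root_.fderiv ℝ u (p, z)).comp (.inl ℝ F ℝ) ∂gauss) p := by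
  have hu' : ExpSmooth 0 (fun q => (_root_.fderiv ℝ u q).comp (.inl ℝ F ℝ)) :=
    ExpSmooth.clm ((ContinuousLinearMap.compL ℝ F (F × ℝ) H).flip (.inl ℝ F ℝ)) hu.fderiv
  obtain ⟨A, B, hA, hB, h⟩ := hu'.expBdd
  have hc := hu.continuous
  refine hasFDerivAt_integral_of_dominated_of_fderiv_le (s := Metric.ball p 1)
    (F' := fun p z => (_root_.fderiv ℝ u (p, z)).comp (.inl ℝ F ℝ))
    (bound := fun z => A * Real.exp (B * (‖p‖ + 1)) * Real.exp (B * |z|))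
    (Metric.ball_mem_nhds p one_pos) (.of_forall fun q => ?_) (hu.expBdd.integrable_gauss hc p) ?_
    (.of_forall fun z q hq => (h _).trans ?_) ((integrable_exp_mul_abs_gauss B).const_mul _)
    (.of_forall fun z q _ => ?_)
  · exact Continuous.aestronglyMeasurable (by fun_prop)
  · exact (hu'.expBdd.integrable_gauss hu'.continuous p).aestronglyMeasurable
  · rw [mul_assoc, ← Real.exp_add, ← mul_add]
    have : ‖q‖ ≤ ‖p‖ + 1 := by
      have h1 := norm_sub_norm_le q p
      rw [Metric.mem_ball, dist_eq_norm] at hq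
      linarith
    have := norm_prod_le_add q z
    gcongr
    linarith
  · exact (hu.hasFDerivAt (q, z)).comp q (hasFDerivAt_prodMk_left q z)

theorem ExpSmooth.integral_gauss {n : ℕ} : ∀ {H : Type} [NormedAddCommGroup H] [NormedSpace ℝ H]
    {u : F × ℝ → H}, ExpSmooth n u → ExpSmooth n (fun p => ∫ z, u (p, z) ∂gauss) := by
  induction n with
  | zero =>
    intro H _ _ u hu
    refine ⟨?_, hu.2.integral_gauss⟩
    obtain ⟨A, B, hA, hB, h⟩ := hu.2
    have hc := hu.1
    refine continuous_iff_continuousAt.2 fun p => ?_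
    refine continuousAt_of_dominated
      (bound := fun z => A * Real.exp (B * (‖p‖ + 1)) * Real.exp (B * |z|))
      (.of_forall fun q => Continuous.aestronglyMeasurable (by fun_prop))
      ?_ ((integrable_exp_mul_abs_gauss B).const_mul _)
      (.of_forall fun z => by fun_prop)
    filter_upwards [Metric.ball_mem_nhds p one_pos] with q hq
    refine .of_forall fun z => (h _).trans ?_
    rw [mul_assoc, ← Real.exp_add, ← mul_add]
    have : ‖q‖ ≤ ‖p‖ + 1 := by
      have h1 := norm_sub_norm_le q p
      rw [Metric.mem_ball, dist_eq_norm] at hq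
      linarith
    have := norm_prod_le_add q z
    gcongr
    linarith
  | succ n ih =>
    intro H _ _ u hu
    have hu1 : ExpSmooth 1 u := ⟨hu.1, hu.2.1, hu.fderiv.continuous, hu.fderiv.expBdd⟩
    exact .of_hasFDerivAt hu.expBdd.integral_gauss (fun p => hu1.hasFDerivAt_integral_gauss p)
      (ih (ExpSmooth.clm ((ContinuousLinearMap.compL ℝ F (F × ℝ) H).flip (.inl ℝ F ℝ)) hu.fderiv))

end ExpGrowth

/-! ### Gaussian averages along a direction, and the heat equation -/

/-- Gaussian integration by parts. -/
theorem integral_mul_gauss {h h' : ℝ → ℝ} (hd : ∀ z, HasDerivAt h (h' z) z)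
    (hb : ExpBdd h) (hc' : Continuous h') (hb' : ExpBdd h') :
    ∫ z, z * h z ∂gauss = ∫ z, h' z ∂gauss := by
  have hc : Continuous h := continuous_iff_continuousAt.2 fun z => (hd z).continuousAt
  have hid : ExpBdd (fun z : ℝ => z) := (linBdd_clm (ContinuousLinearMap.id ℝ ℝ)).expBdd
  have hzb : ExpBdd (fun z => z * h z) := hid.bilin (ContinuousLinearMap.mul ℝ ℝ) hb
  have hpdf : ∀ z, HasDerivAt (gaussianPDFReal 0 1) (-z * gaussianPDFReal 0 1 z) z := by
    intro z
    have h1 : HasDerivAt (fun x : ℝ => -(x - 0) ^ 2 / (2 * ((1 : NNReal) : ℝ))) (-z) z := by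
      have := (((hasDerivAt_id z).sub_const 0).pow 2).neg.div_const (2 * ((1 : NNReal) : ℝ))
      refine this.congr_deriv ?_
      simp
      ring
    have h2 := (h1.exp).const_mul (√(2 * Real.pi * ((1 : NNReal) : ℝ)))⁻¹
    rw [gaussianPDFReal_def]
    refine h2.congr_deriv ?_
    ring
  have key : ∀ {k : ℝ → ℝ}, Integrable k gauss →
      Integrable (fun z => gaussianPDFReal 0 1 z * k z) := by
    intro k hk
    rw [gauss, gaussianReal_of_var_ne_zero _ one_ne_zero,
      integrable_withDensity_iff_integrable_smul' (measurable_gaussianPDF 0 1)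
        (.of_forall fun x => gaussianPDF_lt_top)] at hk
    simpa [toReal_gaussianPDF] using hk
  have i1 := key (integrable_gauss_of_expBdd hc hb)
  have i2 := key (integrable_gauss_of_expBdd hc' hb')
  have i3 := key (k := fun z => z * h z) (integrable_gauss_of_expBdd (continuous_id.mul hc) hzb)
  have i4 : Integrable (fun z => -z * gaussianPDFReal 0 1 z * h z + gaussianPDFReal 0 1 z * h' z) := by
    refine (i2.sub i3).congr (.of_forall fun z => ?_)
    simp only [Pi.sub_apply]; ring
  have := integral_eq_zero_of_hasDerivAt_of_integrable (fun z => (hpdf z).mul (hd z)) i4 i1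
  rw [integral_gaussianReal_eq_integral_smul one_ne_zero,
    integral_gaussianReal_eq_integral_smul one_ne_zero]
  simp only [smul_eq_mul]
  have h5 : (∫ z, gaussianPDFReal 0 1 z * h' z) - ∫ z, gaussianPDFReal 0 1 z * (z * h z) = 0 := by
    rw [← integral_sub i2 i3]
    refine Eq.trans ?_ this
    refine integral_congr_ae (.of_forall fun z => ?_)
    simp only []
    ring
  linarith

section Avg

variable {E H : Type} [NormedAddCommGroup E] [NormedSpace ℝ E] [NormedAddCommGroup H]
  [NormedSpace ℝ H]

/-- Smooth bounded amplitudes of a Gaussian displacement, as functions of the interpolation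
parameter. -/
def Amplitude (n : ℕ) (a : ℝ → ℝ) : Prop := ExpSmooth n a ∧ ∃ C, ∀ t, |a t| ≤ C

theorem expSmooth_sin_cos (n : ℕ) : ExpSmooth n Real.sin ∧ ExpSmooth n Real.cos := by
  have hs : ExpBdd Real.sin := ⟨1, 0, by simp, by simp, fun t => by simpa using Real.abs_sin_le_one t⟩
  have hc : ExpBdd Real.cos := ⟨1, 0, by simp, by simp, fun t => by simpa using Real.abs_cos_le_one t⟩
  induction n with
  | zero => exact ⟨⟨Real.continuous_sin, hs⟩, ⟨Real.continuous_cos, hc⟩⟩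
  | succ n ih =>
    refine ⟨.of_hasFDerivAt hs (fun t => (Real.hasDerivAt_sin t).hasFDerivAt) ?_,
      .of_hasFDerivAt hc (fun t => (Real.hasDerivAt_cos t).hasFDerivAt) ?_⟩
    · exact ExpSmooth.clm (ContinuousLinearMap.toSpanSingletonCLE (𝕜 := ℝ) (E := ℝ)).toContinuousLinearMap ih.2
    · exact ExpSmooth.clm (ContinuousLinearMap.toSpanSingletonCLE (𝕜 := ℝ) (E := ℝ)).toContinuousLinearMap
        (ih.1.const_mul (-1) |> fun h => by simpa using h)

theorem amplitude_cos (n : ℕ) (c : ℝ) : Amplitude n (fun t => c * Real.cos t) :=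
  ⟨(expSmooth_sin_cos n).2.const_mul c, |c|, fun t => by
    rw [abs_mul]; exact mul_le_of_le_one_right (abs_nonneg c) (Real.abs_cos_le_one t)⟩

/-- The displacement of the space variable by `z * a θ` along `v`. -/
def shift (a : ℝ → ℝ) (v : E) (q : (ℝ × E) × ℝ) : ℝ × E := (q.1.1, q.1.2 + (q.2 * a q.1.1) • v)

theorem shift_eq (a : ℝ → ℝ) (v : E) : shift a v = fun q =>
    ContinuousLinearMap.fst ℝ (ℝ × E) ℝ q + ContinuousLinearMap.inr ℝ ℝ E
      ((q.2 * a q.1.1) • v) := by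
  funext q; ext <;> simp [shift]

theorem expSmooth_shift {n : ℕ} {a : ℝ → ℝ} (ha : Amplitude n a) (v : E) :
    ExpSmooth n (shift a v) := by
  rw [shift_eq]
  refine (expSmooth_clm n _).add (ExpSmooth.clm _ (ExpSmooth.smul (ExpSmooth.mul ?_ ?_)
    (expSmooth_const n v)))
  · exact expSmooth_clm n (ContinuousLinearMap.snd ℝ (ℝ × E) ℝ)
  · exact ExpSmooth.comp (linBdd_clm _)
      (expSmooth_clm n ((ContinuousLinearMap.fst ℝ ℝ E).comp (ContinuousLinearMap.fst ℝ (ℝ × E) ℝ)))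
      ha.1

theorem linBdd_shift {n : ℕ} {a : ℝ → ℝ} (ha : Amplitude n a) (v : E) : LinBdd (shift a v) := by
  rw [shift_eq]
  refine (linBdd_clm _).add ?_
  obtain ⟨C, hC⟩ := ha.2
  have hC0 : 0 ≤ C := (abs_nonneg _).trans (hC 0)
  refine ⟨C * ‖v‖, by positivity, fun q => ?_⟩
  have h1 : ‖((0 : ℝ), (q.2 * a q.1.1) • v)‖ = |q.2| * |a q.1.1| * ‖v‖ := by
    rw [Prod.norm_def]
    simp [norm_smul]
    positivity
  have h2 : |q.2| ≤ ‖q‖ := norm_snd_le q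
  change ‖((0 : ℝ), (q.2 * a q.1.1) • v)‖ ≤ _
  rw [h1]
  calc |q.2| * |a q.1.1| * ‖v‖ ≤ (1 + ‖q‖) * C * ‖v‖ := by
        gcongr
        · linarith
        · exact hC _
    _ = _ := by ring

/-- The Gaussian average of `u` along the direction `v` with amplitude `a θ`. -/
def gavg (a : ℝ → ℝ) (v : E) (u : ℝ × E → ℝ) (p : ℝ × E) : ℝ := ∫ z, u (shift a v (p, z)) ∂gauss

/-- The derivative of `u` along the vector `w`. -/
def dirDeriv (w : E) (u : E → ℝ) (p : E) : ℝ := fderiv ℝ u p w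

theorem ExpSmooth.dirDeriv {n : ℕ} {u : E → ℝ} (hu : ExpSmooth (n + 1) u) (w : E) :
    ExpSmooth n (dirDeriv w u) := ExpSmooth.clm (ContinuousLinearMap.apply ℝ ℝ w) hu.fderiv

theorem ExpSmooth.comp_shift {n : ℕ} {a : ℝ → ℝ} (ha : Amplitude n a) (v : E) {u : ℝ × E → H}
    (hu : ExpSmooth n u) : ExpSmooth n (fun q => u (shift a v q)) :=
  ExpSmooth.comp (linBdd_shift ha v) (expSmooth_shift ha v) hu

theorem ExpSmooth.gavg {n : ℕ} {a : ℝ → ℝ} (ha : Amplitude n a) (v : E) {u : ℝ × E → ℝ}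
    (hu : ExpSmooth n u) : ExpSmooth n (gavg a v u) := (hu.comp_shift ha v).integral_gauss

theorem Amplitude.pred {n : ℕ} {a : ℝ → ℝ} (ha : Amplitude (n + 1) a) : Amplitude n a :=
  ⟨ha.1.pred, ha.2⟩

theorem Amplitude.zero {n : ℕ} {a : ℝ → ℝ} (ha : Amplitude n a) : Amplitude 0 a :=
  ⟨⟨ha.1.continuous, ha.1.expBdd⟩, ha.2⟩

theorem integrable_shift {a : ℝ → ℝ} (ha : Amplitude 0 a) (v : E) {u : ℝ × E → ℝ}
    (hu : ExpSmooth 0 u) (p : ℝ × E) : Integrable (fun z => u (shift a v (p, z))) gauss :=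
  (hu.comp_shift ha v).expBdd.integrable_gauss (hu.comp_shift ha v).continuous p

theorem hasFDerivAt_shift_left {a : ℝ → ℝ} (ha : Amplitude 1 a) (v : E) (p : ℝ × E) (z : ℝ) :
    HasFDerivAt (fun p => shift a v (p, z))
      (ContinuousLinearMap.id ℝ (ℝ × E) + (ContinuousLinearMap.inr ℝ ℝ E).comp
        ((z * deriv a p.1) • (ContinuousLinearMap.fst ℝ ℝ E).smulRight v)) p := by
  have h1 : HasDerivAt a (deriv a p.1) p.1 := (ha.1.differentiable p.1).hasDerivAt
  have h2 : HasFDerivAt (fun p : ℝ × E => a p.1)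
      (deriv a p.1 • ContinuousLinearMap.fst ℝ ℝ E) p := h1.comp_hasFDerivAt p hasFDerivAt_fst
  have h3 := ((h2.const_mul z).smul_const v)
  have h4 := (hasFDerivAt_id p).add ((ContinuousLinearMap.inr ℝ ℝ E).hasFDerivAt.comp p h3)
  refine (h4.congr_fderiv ?_).congr_of_eventuallyEq (.of_forall fun q => ?_)
  · ext <;> simp [smul_smul]
  · ext <;> simp [shift]

theorem dirDeriv_gavg {a : ℝ → ℝ} (ha : Amplitude 1 a) (v : E) {u : ℝ × E → ℝ}
    (hu : ExpSmooth 1 u) (p w : ℝ × E) :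
    dirDeriv w (gavg a v u) p = ∫ z, fderiv ℝ u (shift a v (p, z))
      (w + (0, (z * deriv a p.1 * w.1) • v)) ∂gauss := by
  have hs := hu.comp_shift ha v
  have h := hs.hasFDerivAt_integral_gauss p
  have hu' : ExpSmooth 0 (fun q => (fderiv ℝ (fun q => u (shift a v q)) q).comp (.inl ℝ (ℝ × E) ℝ)) :=
    ExpSmooth.clm ((ContinuousLinearMap.compL ℝ (ℝ × E) ((ℝ × E) × ℝ) ℝ).flip (.inl ℝ (ℝ × E) ℝ))
      hs.fderiv
  rw [dirDeriv, show gavg a v u = fun p => ∫ z, u (shift a v (p, z)) ∂gauss from rfl, h.fderiv,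
    ContinuousLinearMap.integral_apply (hu'.expBdd.integrable_gauss hu'.continuous p)]
  refine integral_congr_ae (.of_forall fun z => ?_)
  have e1 : (fderiv ℝ (fun q => u (shift a v q)) (p, z)).comp (.inl ℝ (ℝ × E) ℝ)
      = fderiv ℝ (fun p => u (shift a v (p, z))) p :=
    (HasFDerivAt.comp (g := fun q => u (shift a v q)) p (hs.hasFDerivAt (p, z))
      (hasFDerivAt_prodMk_left p z)).fderiv.symm
  have e2 := ((hu.hasFDerivAt (shift a v (p, z))).comp p (hasFDerivAt_shift_left ha v p z)).fderiv
  simp only [Function.comp_def] at e2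
  simp only [e1, e2, ContinuousLinearMap.comp_apply]
  congr 1
  ext <;> simp [smul_smul]

theorem dirDeriv_space_gavg {a : ℝ → ℝ} (ha : Amplitude 1 a) (v : E) {u : ℝ × E → ℝ}
    (hu : ExpSmooth 1 u) (w : E) :
    dirDeriv (0, w) (gavg a v u) = gavg a v (dirDeriv (0, w) u) := by
  funext p
  rw [dirDeriv_gavg ha v hu]
  simp [gavg, dirDeriv]

/-- The heat equation: the Gaussian average depends on the parameter through its amplitude, and
Gaussian integration by parts turns this dependence into a second derivative along `v`. -/
theorem dirDeriv_param_gavg {a : ℝ → ℝ} (ha : Amplitude 1 a) (v : E) {u : ℝ × E → ℝ}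
    (hu : ExpSmooth 2 u) (p : ℝ × E) :
    dirDeriv (1, 0) (gavg a v u) p = gavg a v (dirDeriv (1, 0) u) p
      + a p.1 * deriv a p.1 * gavg a v (dirDeriv (0, v) (dirDeriv (0, v) u)) p := by
  rw [dirDeriv_gavg ha v hu.pred]
  have hD := hu.dirDeriv (0, v)
  have hDD := hD.dirDeriv (0, v)
  have hDs := hD.pred.comp_shift ha.zero v
  have hDDs := hDD.comp_shift ha.zero v
  have hpz : LinBdd (fun z : ℝ => (p, z)) :=
    ⟨‖p‖ + 1, by positivity, fun z => (norm_prod_le_add p z).trans (by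
      rw [Real.norm_eq_abs]; nlinarith [norm_nonneg p, abs_nonneg z])⟩
  have hcz : ExpSmooth 0 (fun z : ℝ => (p, z)) := ⟨by fun_prop, hpz.expBdd⟩
  have f1 : ExpSmooth 0 (fun z => dirDeriv (0, v) u (shift a v (p, z))) :=
    ExpSmooth.comp (u := fun q => dirDeriv (0, v) u (shift a v q)) hpz hcz hDs
  have f2 : ExpSmooth 0 (fun z => dirDeriv (0, v) (dirDeriv (0, v) u) (shift a v (p, z))) :=
    ExpSmooth.comp (u := fun q => dirDeriv (0, v) (dirDeriv (0, v) u) (shift a v q)) hpz hcz hDDs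
  have hst := integral_mul_gauss (h := fun z => dirDeriv (0, v) u (shift a v (p, z)))
    (h' := fun z => a p.1 * dirDeriv (0, v) (dirDeriv (0, v) u) (shift a v (p, z)))
    (fun z => by
      have h1 : HasDerivAt (fun z => shift a v (p, z)) (0, a p.1 • v) z := by
        have h3 : HasDerivAt (fun z : ℝ => p.2 + (z * a p.1) • v) (a p.1 • v) z := by
          simpa using (((hasDerivAt_id z).mul_const (a p.1)).smul_const v).const_add p.2
        exact (hasDerivAt_const z p.1).prodMk h3
      have h2 := (hD.hasFDerivAt (shift a v (p, z))).comp_hasDerivAt z h1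
      refine h2.congr_deriv ?_
      rw [show ((0 : ℝ), a p.1 • v) = a p.1 • ((0 : ℝ), v) by simp, map_smul]
      rfl) f1.expBdd (f2.continuous.const_smul (a p.1)) (f2.const_mul (a p.1)).expBdd
  have i1 := integrable_shift ha.zero v (hu.pred.dirDeriv (1, 0)) p
  have i2 : Integrable (fun z => z * dirDeriv (0, v) u (shift a v (p, z))) gauss :=
    integrable_gauss_of_expBdd (continuous_id.mul f1.continuous)
      ((linBdd_clm (ContinuousLinearMap.id ℝ ℝ)).expBdd.bilin (ContinuousLinearMap.mul ℝ ℝ) f1.expBdd)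
  rw [integral_const_mul] at hst
  calc ∫ z, fderiv ℝ u (shift a v (p, z)) ((1, 0) + (0, (z * deriv a p.1 * 1) • v)) ∂gauss
      = ∫ z, (dirDeriv (1, 0) u (shift a v (p, z))
          + deriv a p.1 * (z * dirDeriv (0, v) u (shift a v (p, z)))) ∂gauss := by
        refine integral_congr_ae (.of_forall fun z => ?_)
        simp only [map_add, dirDeriv]
        rw [show ((0 : ℝ), (z * deriv a p.1 * 1) • v) = (z * deriv a p.1) • ((0 : ℝ), v) by simp,
          map_smul, smul_eq_mul]
        ring
    _ = _ := by
        rw [integral_add i1 (i2.const_mul _), integral_const_mul, hst]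
        simp only [gavg]
        ring

end Avg

/-! ### The Hopf–Cole operator -/

section Cole

variable {F E : Type} [NormedAddCommGroup F] [NormedSpace ℝ F] [NormedAddCommGroup E]
  [NormedSpace ℝ E]

theorem gavg_mono {a : ℝ → ℝ} (ha : Amplitude 0 a) (v : E) {u w : ℝ × E → ℝ}
    (hu : ExpSmooth 0 u) (hw : ExpSmooth 0 w) {θ : ℝ} (h : ∀ g, u (θ, g) ≤ w (θ, g)) (g : E) :
    gavg a v u (θ, g) ≤ gavg a v w (θ, g) :=
  integral_mono (integrable_shift ha v hu _) (integrable_shift ha v hw _) fun _ => h _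

theorem gavg_add {a : ℝ → ℝ} (ha : Amplitude 0 a) (v : E) {u w : ℝ × E → ℝ}
    (hu : ExpSmooth 0 u) (hw : ExpSmooth 0 w) (p : ℝ × E) :
    gavg a v (fun q => u q + w q) p = gavg a v u p + gavg a v w p :=
  integral_add (integrable_shift ha v hu _) (integrable_shift ha v hw _)

theorem gavg_const_mul (a : ℝ → ℝ) (v : E) (c : ℝ) (u : ℝ × E → ℝ) (p : ℝ × E) :
    gavg a v (fun q => c * u q) p = c * gavg a v u p := integral_const_mul _ _

theorem gavg_sum {ι : Type} {a : ℝ → ℝ} (ha : Amplitude 0 a) (v : E) (s : Finset ι)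
    {u : ι → ℝ × E → ℝ} (hu : ∀ i, ExpSmooth 0 (u i)) (p : ℝ × E) :
    gavg a v (fun q => ∑ i ∈ s, u i q) p = ∑ i ∈ s, gavg a v (u i) p :=
  integral_finsetSum _ fun i _ => integrable_shift ha v (hu i) p

theorem abs_gavg_le {a : ℝ → ℝ} (ha : Amplitude 0 a) (v : E) {u w : ℝ × E → ℝ}
    (hu : ExpSmooth 0 u) (hw : ExpSmooth 0 w) {θ K : ℝ} (h : ∀ g, |w (θ, g)| ≤ K * u (θ, g))
    (g : E) : |gavg a v w (θ, g)| ≤ K * gavg a v u (θ, g) := by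
  have hu' : ExpSmooth 0 (fun q => K * u q) := hu.const_mul K
  have hu'' : ExpSmooth 0 (fun q => -K * u q) := hu.const_mul (-K)
  rw [abs_le]
  constructor
  · have := gavg_mono ha v hu'' hw (fun g => by have := (abs_le.1 (h g)).1; linarith) g
    rw [gavg_const_mul] at this
    linarith
  · have := gavg_mono ha v hw hu' (fun g => (abs_le.1 (h g)).2) g
    rwa [gavg_const_mul] at this

theorem expSmooth_sum {ι : Type} (n : ℕ) (s : Finset ι) {u : ι → F → ℝ}
    (hu : ∀ i, ExpSmooth n (u i)) : ExpSmooth n (fun q => ∑ i ∈ s, u i q) := by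
  classical
  induction s using Finset.induction_on with
  | empty => simpa using expSmooth_const (F := F) n (0 : ℝ)
  | insert i s hi ih => simp only [Finset.sum_insert hi]; exact (hu i).add ih

/-- Smooth functions with derivatives of at most exponential growth and with at most linear
growth: the class preserved by the Hopf–Cole operators. -/
def Regular (n : ℕ) (φ : F → ℝ) : Prop := ExpSmooth n φ ∧ LinBdd φ

theorem Regular.pred {n : ℕ} {φ : F → ℝ} (h : Regular (n + 1) φ) : Regular n φ := ⟨h.1.pred, h.2⟩

theorem Regular.exp {n : ℕ} {φ : F → ℝ} (h : Regular n φ) (m : ℝ) :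
    ExpSmooth n (fun p => Real.exp (m * φ p)) := by
  refine (h.1.const_mul m).exp ?_
  obtain ⟨C, hC, h⟩ := h.2
  refine ⟨|m| * C, by positivity, fun p => ?_⟩
  rw [norm_mul, Real.norm_eq_abs, mul_assoc]
  gcongr
  exact h p

/-- One step of the Hopf–Cole recursion, `m⁻¹ log E exp (m φ)`, the Gaussian displacement being
along `v` with amplitude `a θ`. -/
def cole (m : ℝ) (a : ℝ → ℝ) (v : E) (φ : ℝ × E → ℝ) (p : ℝ × E) : ℝ :=
  m⁻¹ * Real.log (gavg a v (fun q => Real.exp (m * φ q)) p)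

/-- Exponential upper and lower bounds for `E exp (m φ)`, which make its logarithm regular again. -/
theorem gavg_exp_bounds {n : ℕ} {m : ℝ} (hm : 0 < m) {a : ℝ → ℝ} (ha : Amplitude n a) (v : E)
    {φ : ℝ × E → ℝ} (hφ : Regular n φ) : ∃ A B C : ℝ, 0 < A ∧ 0 ≤ B ∧ 0 < C ∧ ∀ p,
      A * Real.exp (-(B * ‖p‖)) ≤ gavg a v (fun q => Real.exp (m * φ q)) p ∧
      gavg a v (fun q => Real.exp (m * φ q)) p ≤ C * Real.exp (B * ‖p‖) := by
  obtain ⟨C₁, hC₁, h₁⟩ := hφ.2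
  obtain ⟨C₂, hC₂, h₂⟩ := linBdd_shift ha v
  set B := m * C₁ * (1 + C₂) with hB
  have hB0 : 0 ≤ B := by positivity
  have key : ∀ p z, |m * φ (shift a v (p, z))| ≤ B + B * ‖p‖ + B * |z| := by
    intro p z
    rw [abs_mul, abs_of_pos hm]
    have e1 := h₁ (shift a v (p, z))
    have e2 := h₂ (p, z)
    have e3 := norm_prod_le_add p z
    rw [Real.norm_eq_abs] at e1
    calc m * |φ (shift a v (p, z))| ≤ m * (C₁ * (1 + C₂ * (1 + (‖p‖ + |z|)))) := by
          gcongr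
          refine e1.trans ?_
          gcongr
          exact e2.trans (by gcongr)
      _ ≤ m * (C₁ * ((1 + C₂) * (1 + (‖p‖ + |z|)))) := by
          gcongr
          nlinarith [norm_nonneg p, abs_nonneg z]
      _ = _ := by rw [hB]; ring
  have hint : ∀ p, Integrable (fun z => Real.exp (m * φ (shift a v (p, z)))) gauss := fun p =>
    integrable_shift ha.zero v (u := fun q => Real.exp (m * φ q))
      ⟨(hφ.exp m).continuous, (hφ.exp m).expBdd⟩ p
  have hi := integrable_exp_mul_abs_gauss
  refine ⟨Real.exp (-B) * ∫ z, Real.exp (-B * |z|) ∂gauss, B,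
    Real.exp B * ∫ z, Real.exp (B * |z|) ∂gauss,
    mul_pos (Real.exp_pos _) (integral_exp_pos (hi _)), hB0,
    mul_pos (Real.exp_pos _) (integral_exp_pos (hi _)), fun p => ⟨?_, ?_⟩⟩
  · have : ∫ z, (Real.exp (-B) * Real.exp (-(B * ‖p‖))) * Real.exp (-B * |z|) ∂gauss
        ≤ ∫ z, Real.exp (m * φ (shift a v (p, z))) ∂gauss := by
      refine integral_mono ((hi _).const_mul _) (hint p) fun z => ?_
      simp only []
      rw [← Real.exp_add, ← Real.exp_add]
      exact Real.exp_le_exp.2 (by linarith [(abs_le.1 (key p z)).1])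
    rw [integral_const_mul] at this
    unfold gavg
    linarith
  · have : ∫ z, Real.exp (m * φ (shift a v (p, z))) ∂gauss ≤
        ∫ z, (Real.exp B * Real.exp (B * ‖p‖)) * Real.exp (B * |z|) ∂gauss := by
      refine integral_mono (hint p) ((hi _).const_mul _) fun z => ?_
      simp only []
      rw [← Real.exp_add, ← Real.exp_add]
      exact Real.exp_le_exp.2 (by linarith [(abs_le.1 (key p z)).2])
    rw [integral_const_mul] at this
    unfold gavg
    linarith

theorem gavg_exp_pos {n : ℕ} {m : ℝ} (hm : 0 < m) {a : ℝ → ℝ} (ha : Amplitude n a) (v : E)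
    {φ : ℝ × E → ℝ} (hφ : Regular n φ) (p : ℝ × E) :
    0 < gavg a v (fun q => Real.exp (m * φ q)) p := by
  obtain ⟨A, B, C, hA, hB, hC, h⟩ := gavg_exp_bounds hm ha v hφ
  exact lt_of_lt_of_le (by positivity) (h p).1

theorem exp_cole {n : ℕ} {m : ℝ} (hm : 0 < m) {a : ℝ → ℝ} (ha : Amplitude n a) (v : E)
    {φ : ℝ × E → ℝ} (hφ : Regular n φ) :
    (fun p => Real.exp (m * cole m a v φ p)) = gavg a v (fun q => Real.exp (m * φ q)) := by
  funext p
  rw [cole, mul_inv_cancel_left₀ hm.ne', Real.exp_log (gavg_exp_pos hm ha v hφ p)]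

theorem Regular.cole {n : ℕ} {m : ℝ} (hm : 0 < m) {a : ℝ → ℝ} (ha : Amplitude n a) (v : E)
    {φ : ℝ × E → ℝ} (hφ : Regular n φ) : Regular n (cole m a v φ) := by
  obtain ⟨A, B, C, hA, hB, hC, h⟩ := gavg_exp_bounds hm ha v hφ
  have hlog : LinBdd (fun p => Real.log (gavg a v (fun q => Real.exp (m * φ q)) p)) := by
    refine ⟨|Real.log A| + |Real.log C| + B, by positivity, fun p => ?_⟩
    have h1 := Real.log_le_log (by positivity) (h p).1
    have h2 := Real.log_le_log (gavg_exp_pos hm ha v hφ p) (h p).2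
    rw [Real.log_mul (by positivity) (by positivity), Real.log_exp] at h1 h2
    rw [Real.norm_eq_abs, abs_le]
    have e1 := neg_abs_le (Real.log A)
    have e2 := le_abs_self (Real.log C)
    have e3 := abs_nonneg (Real.log A)
    have e4 := abs_nonneg (Real.log C)
    have e5 := norm_nonneg p
    constructor <;> nlinarith
  refine ⟨(((hφ.exp m).gavg ha v).log hA hB (fun p => (h p).1) hlog).const_mul _, ?_⟩
  obtain ⟨K, hK, h'⟩ := hlog
  refine ⟨|m⁻¹| * K, by positivity, fun p => ?_⟩
  rw [SpinGlass.cole, norm_mul, Real.norm_eq_abs, mul_assoc]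
  gcongr
  exact h' p

theorem dirDeriv_exp {φ : F → ℝ} (hφ : ExpSmooth 1 φ) (m : ℝ) (w p : F) :
    dirDeriv w (fun p => Real.exp (m * φ p)) p = m * Real.exp (m * φ p) * dirDeriv w φ p := by
  rw [dirDeriv, (((hφ.hasFDerivAt p).const_mul m).exp).fderiv]
  simp [dirDeriv]; ring

theorem dirDeriv_mul {φ χ : F → ℝ} (hφ : ExpSmooth 1 φ) (hχ : ExpSmooth 1 χ) (w p : F) :
    dirDeriv w (fun p => φ p * χ p) p = φ p * dirDeriv w χ p + dirDeriv w φ p * χ p := by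
  rw [dirDeriv, ((hφ.hasFDerivAt p).fun_mul (hχ.hasFDerivAt p)).fderiv]
  simp [dirDeriv]; ring

theorem dirDeriv_add {φ χ : F → ℝ} (hφ : ExpSmooth 1 φ) (hχ : ExpSmooth 1 χ) (w p : F) :
    dirDeriv w (fun p => φ p + χ p) p = dirDeriv w φ p + dirDeriv w χ p := by
  rw [dirDeriv, ((hφ.hasFDerivAt p).fun_add (hχ.hasFDerivAt p)).fderiv]
  simp [dirDeriv]

theorem dirDeriv_const_mul {φ : F → ℝ} (hφ : ExpSmooth 1 φ) (c : ℝ) (w p : F) :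
    dirDeriv w (fun p => c * φ p) p = c * dirDeriv w φ p := by
  rw [dirDeriv, ((hφ.hasFDerivAt p).const_mul c).fderiv]
  simp [dirDeriv]

/-- The quantity `∂²φ + m (∂φ)²` in the direction `w`: it is `∂²u / (m u)` for `u = exp (m φ)`, so
that a Hopf–Cole step acts on it as a weighted average. -/
def quad (m : ℝ) (w : F) (φ : F → ℝ) (p : F) : ℝ :=
  dirDeriv w (dirDeriv w φ) p + m * dirDeriv w φ p ^ 2

/-- The third order analogue `∂³φ + 3m ∂φ ∂²φ + m² (∂φ)³` of `quad`. -/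
def cubic (m : ℝ) (w : F) (φ : F → ℝ) (p : F) : ℝ :=
  dirDeriv w (dirDeriv w (dirDeriv w φ)) p
    + 3 * m * dirDeriv w φ p * dirDeriv w (dirDeriv w φ) p + m ^ 2 * dirDeriv w φ p ^ 3

theorem dirDeriv₂_exp {φ : F → ℝ} (hφ : Regular 2 φ) (m : ℝ) (w p : F) :
    dirDeriv w (dirDeriv w (fun p => Real.exp (m * φ p))) p
      = m * Real.exp (m * φ p) * quad m w φ p := by
  have e : dirDeriv w (fun p => Real.exp (m * φ p)) =
      fun p => (m * Real.exp (m * φ p)) * dirDeriv w φ p :=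
    funext fun p => dirDeriv_exp hφ.1.pred m w p
  have h1 : ExpSmooth 1 (fun p => Real.exp (m * φ p)) := hφ.pred.exp m
  rw [e, dirDeriv_mul (h1.const_mul m) (hφ.1.dirDeriv w), dirDeriv_const_mul h1,
    dirDeriv_exp hφ.1.pred, quad]
  ring

theorem dirDeriv₃_exp {φ : F → ℝ} (hφ : Regular 3 φ) (m : ℝ) (w p : F) :
    dirDeriv w (dirDeriv w (dirDeriv w (fun p => Real.exp (m * φ p)))) p
      = m * Real.exp (m * φ p) * cubic m w φ p := by
  have h1 : ExpSmooth 1 (fun p => Real.exp (m * φ p)) := hφ.pred.pred.exp m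
  have d1 : ExpSmooth 1 (dirDeriv w φ) := (hφ.1.dirDeriv w).pred
  have d2 : ExpSmooth 1 (dirDeriv w (dirDeriv w φ)) := (hφ.1.dirDeriv w).dirDeriv w
  have e : dirDeriv w (dirDeriv w (fun p => Real.exp (m * φ p))) =
      fun p => (m * Real.exp (m * φ p)) *
        (dirDeriv w (dirDeriv w φ) p + m * (dirDeriv w φ p * dirDeriv w φ p)) := by
    funext p
    rw [dirDeriv₂_exp hφ.pred, quad, pow_two]
  rw [e, dirDeriv_mul (h1.const_mul m) (d2.add ((d1.mul d1).const_mul m)), dirDeriv_const_mul h1,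
    dirDeriv_exp hφ.1.pred.pred, dirDeriv_add d2 ((d1.mul d1).const_mul m),
    dirDeriv_const_mul (d1.mul d1), dirDeriv_mul d1 d1, cubic]
  ring

/-- The gradient of a Hopf–Cole step is an average of the gradient before it, with the weight
`exp (m φ)`. -/
theorem abs_dirDeriv_cole_le {m : ℝ} (hm : 0 < m) {a : ℝ → ℝ} (ha : Amplitude 1 a) (v w : E)
    {φ : ℝ × E → ℝ} (hφ : Regular 1 φ) {θ K : ℝ} (h : ∀ g, |dirDeriv (0, w) φ (θ, g)| ≤ K) (g : E) :
    |dirDeriv (0, w) (cole m a v φ) (θ, g)| ≤ K := by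
  have hU := gavg_exp_pos hm ha v hφ (θ, g)
  have e1 := dirDeriv_exp (hφ.cole hm ha v).1 m (0, w) (θ, g)
  have e2 := congrFun (exp_cole hm ha v hφ) (θ, g)
  rw [exp_cole hm ha v hφ, dirDeriv_space_gavg ha v (hφ.exp m)] at e1
  rw [e2] at e1
  have e3 := abs_gavg_le ha.zero v (hφ.exp m).pred ((hφ.exp m).dirDeriv (0, w)) (θ := θ)
    (K := m * K) (fun g => by
      rw [dirDeriv_exp hφ.1, abs_mul, abs_of_pos (by positivity : 0 < m * Real.exp (m * φ (θ, g)))]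
      have := mul_le_mul_of_nonneg_left (h g)
        (by positivity : 0 ≤ m * Real.exp (m * φ (θ, g)))
      linarith) g
  rw [e1, abs_mul, abs_of_pos (by positivity)] at e3
  exact le_of_mul_le_mul_left (a := m * gavg a v (fun q => Real.exp (m * φ q)) (θ, g))
    (by linarith) (by positivity)

/-- A Hopf–Cole step averages `quad m` with the weight `exp (m φ)`. -/
theorem abs_quad_cole_le {m : ℝ} (hm : 0 < m) {a : ℝ → ℝ} (ha : Amplitude 2 a) (v w : E)
    {φ : ℝ × E → ℝ} (hφ : Regular 2 φ) {θ K : ℝ} (h : ∀ g, |quad m (0, w) φ (θ, g)| ≤ K) (g : E) :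
    |quad m (0, w) (cole m a v φ) (θ, g)| ≤ K := by
  have hU := gavg_exp_pos hm ha v hφ (θ, g)
  have e1 := dirDeriv₂_exp (hφ.cole hm ha v) m (0, w) (θ, g)
  have e2 := congrFun (exp_cole hm ha v hφ) (θ, g)
  rw [exp_cole hm ha v hφ, dirDeriv_space_gavg ha.pred v (hφ.exp m).pred,
    dirDeriv_space_gavg ha.pred v ((hφ.exp m).dirDeriv _)] at e1
  rw [e2] at e1
  have e3 := abs_gavg_le ha.zero v (hφ.exp m).pred.pred
    (((hφ.exp m).dirDeriv (0, w)).dirDeriv (0, w)) (θ := θ)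
    (K := m * K) (fun g => by
      rw [dirDeriv₂_exp hφ, abs_mul, abs_of_pos (by positivity : 0 < m * Real.exp (m * φ (θ, g)))]
      have := mul_le_mul_of_nonneg_left (h g)
        (by positivity : 0 ≤ m * Real.exp (m * φ (θ, g)))
      linarith) g
  rw [e1, abs_mul, abs_of_pos (by positivity)] at e3
  exact le_of_mul_le_mul_left (a := m * gavg a v (fun q => Real.exp (m * φ q)) (θ, g))
    (by linarith) (by positivity)

/-- A Hopf–Cole step averages `cubic m` with the weight `exp (m φ)`. -/
theorem abs_cubic_cole_le {m : ℝ} (hm : 0 < m) {a : ℝ → ℝ} (ha : Amplitude 3 a) (v w : E)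
    {φ : ℝ × E → ℝ} (hφ : Regular 3 φ) {θ K : ℝ} (h : ∀ g, |cubic m (0, w) φ (θ, g)| ≤ K) (g : E) :
    |cubic m (0, w) (cole m a v φ) (θ, g)| ≤ K := by
  have hU := gavg_exp_pos hm ha v hφ (θ, g)
  have e1 := dirDeriv₃_exp (hφ.cole hm ha v) m (0, w) (θ, g)
  have e2 := congrFun (exp_cole hm ha v hφ) (θ, g)
  rw [exp_cole hm ha v hφ, dirDeriv_space_gavg ha.pred.pred v (hφ.exp m).pred.pred,
    dirDeriv_space_gavg ha.pred.pred v ((hφ.exp m).dirDeriv _).pred,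
    dirDeriv_space_gavg ha.pred.pred v (((hφ.exp m).dirDeriv _).dirDeriv _)] at e1
  rw [e2] at e1
  have e3 := abs_gavg_le ha.zero v (hφ.exp m).pred.pred.pred
    ((((hφ.exp m).dirDeriv (0, w)).dirDeriv (0, w)).dirDeriv (0, w)) (θ := θ)
    (K := m * K) (fun g => by
      rw [dirDeriv₃_exp hφ, abs_mul, abs_of_pos (by positivity : 0 < m * Real.exp (m * φ (θ, g)))]
      have := mul_le_mul_of_nonneg_left (h g)
        (by positivity : 0 ≤ m * Real.exp (m * φ (θ, g)))
      linarith) g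
  rw [e1, abs_mul, abs_of_pos (by positivity)] at e3
  exact le_of_mul_le_mul_left (a := m * gavg a v (fun q => Real.exp (m * φ q)) (θ, g))
    (by linarith) (by positivity)

/-- The heat equation for the Gaussian average becomes the equation
`∂_θ ψ = a a' (∂²ψ + m (∂ψ)²)` for a Hopf–Cole step applied to a function of space only. -/
theorem dirDeriv_param_cole {m : ℝ} (hm : 0 < m) {a : ℝ → ℝ} (ha : Amplitude 2 a) (v : E)
    {φ : ℝ × E → ℝ} (hφ : Regular 2 φ) (h0 : dirDeriv (1, 0) φ = fun _ => 0) (p : ℝ × E) :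
    dirDeriv (1, 0) (cole m a v φ) p = a p.1 * deriv a p.1 * quad m (0, v) (cole m a v φ) p := by
  have hψ := hφ.cole hm ha v
  have e0 := dirDeriv_param_gavg ha.pred v (hφ.exp m) p
  have e1 : gavg a v (dirDeriv (1, 0) (fun q => Real.exp (m * φ q))) p = 0 := by
    have : dirDeriv (1, 0) (fun q => Real.exp (m * φ q)) = fun _ => 0 := by
      funext q; rw [dirDeriv_exp hφ.1.pred, h0]; simp
    rw [this]; simp [gavg]
  rw [e1, ← dirDeriv_space_gavg ha.pred v ((hφ.exp m).dirDeriv _),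
    ← dirDeriv_space_gavg ha.pred v (hφ.exp m).pred, ← exp_cole hm ha v hφ,
    dirDeriv_exp hψ.1.pred, dirDeriv₂_exp hψ] at e0
  have : 0 < m * Real.exp (m * cole m a v φ p) := by positivity
  refine mul_left_cancel₀ this.ne' (e0.trans ?_)
  ring

/-- The operator `∂_θ + ½ ∑ c_j (∂_j² + m (∂_j)²)`. With `c` the derivatives in `θ` of the variances
of the Gaussian displacements still to come, it controls the total derivative in `θ` of the
recursion. -/
def gen {ι : Type} [Fintype ι] (m : ℝ) (c : ι → ℝ) (v : ι → E) (φ : ℝ × E → ℝ) (p : ℝ × E) : ℝ :=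
  dirDeriv (1, 0) φ p + 1 / 2 * ∑ j, c j * quad m (0, v j) φ p

/-- A Hopf–Cole step along `v j` of variance `a²` transfers an upper bound for `gen`, the
coefficient of the direction `v j` being diminished by `(a²)' = 2 a a'`. -/
theorem gen_cole_le {ι : Type} [Fintype ι] [DecidableEq ι] {m : ℝ} (hm : 0 < m) {a : ℝ → ℝ}
    (ha : Amplitude 2 a) (c : ι → ℝ) (v : ι → E) (j : ι) {φ : ℝ × E → ℝ} (hφ : Regular 2 φ)
    {θ K : ℝ} (h : ∀ g, gen m (c + Pi.single j (2 * (a θ * deriv a θ))) v φ (θ, g) ≤ K) (g : E) :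
    gen m c v (cole m a (v j) φ) (θ, g) ≤ K := by
  have hψ := hφ.cole hm ha (v j)
  have hU := gavg_exp_pos hm ha (v j) hφ (θ, g)
  have hu := hφ.exp m
  have hd : ∀ i, ExpSmooth 0
      (dirDeriv (0, v i) (dirDeriv (0, v i) (fun q => Real.exp (m * φ q)))) :=
    fun i => (hu.dirDeriv _).dirDeriv _
  have key : ∀ {c : ι → ℝ} {χ : ℝ × E → ℝ} (_ : Regular 2 χ) (p : ℝ × E),
      m * Real.exp (m * χ p) * gen m c v χ p = dirDeriv (1, 0) (fun q => Real.exp (m * χ q)) p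
        + 1 / 2 * ∑ i, c i * dirDeriv (0, v i) (dirDeriv (0, v i)
            (fun q => Real.exp (m * χ q))) p := by
    intro c χ hχ p
    simp only [dirDeriv₂_exp hχ, dirDeriv_exp hχ.1.pred, gen, mul_add, Finset.mul_sum]
    congr 1
    refine Finset.sum_congr rfl fun i _ => ?_
    ring
  have e1 := key (c := c) hψ (θ, g)
  rw [exp_cole hm ha (v j) hφ, dirDeriv_param_gavg ha.pred (v j) hu] at e1
  simp only [dirDeriv_space_gavg ha.pred (v j) hu.pred,
    dirDeriv_space_gavg ha.pred (v j) (hu.dirDeriv _)] at e1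
  rw [congrFun (exp_cole hm ha (v j) hφ) (θ, g)] at e1
  have e2 : gavg a (v j) (fun q => dirDeriv (1, 0) (fun q => Real.exp (m * φ q)) q
        + 1 / 2 * ∑ i, (c + Pi.single j (2 * (a θ * deriv a θ)) : ι → ℝ) i * dirDeriv (0, v i)
          (dirDeriv (0, v i) (fun q => Real.exp (m * φ q))) q) (θ, g)
      ≤ gavg a (v j) (fun q => (m * K) * Real.exp (m * φ q)) (θ, g) := by
    refine gavg_mono ha.zero (v j) ((hu.pred.dirDeriv _).add
      ((expSmooth_sum 0 _ fun i => (hd i).const_mul _).const_mul _)) (hu.pred.pred.const_mul _)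
      (fun g => ?_) g
    rw [← key hφ (θ, g)]
    have := mul_le_mul_of_nonneg_left (h g) (by positivity : 0 ≤ m * Real.exp (m * φ (θ, g)))
    linarith
  rw [gavg_add ha.zero _ (hu.pred.dirDeriv _)
      ((expSmooth_sum 0 _ fun i => (hd i).const_mul _).const_mul _), gavg_const_mul, gavg_const_mul,
    gavg_sum ha.zero _ _ fun i => (hd i).const_mul _] at e2
  simp only [gavg_const_mul] at e2
  simp only [Pi.add_apply, add_mul, Finset.sum_add_distrib, Pi.single_apply,
    ite_mul, zero_mul, Finset.sum_ite_eq', Finset.mem_univ, if_true] at e2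
  refine le_of_mul_le_mul_left
    (a := m * gavg a (v j) (fun q => Real.exp (m * φ q)) (θ, g)) ?_ (by positivity)
  rw [e1]
  linarith

end Cole

/-! ### Integral form of the antiparabolic equation and the comparison principle -/

/-- Nondecreasing functions on the whole line with values in `[0, 1]`. -/
structure UnitMonotone (x : ℝ → ℝ) : Prop where
  mono : Monotone x
  mem : ∀ q, x q ∈ Icc (0 : ℝ) 1

/-- The integrated equation on `[a, 1]`: the functions `f₁` and `f₂` are the first two space
derivatives of `f`, and the time derivative is replaced by an integral over `[q, 1]`. Unlike the
differential equation it makes sense at the jumps of `x` and passes to limits. -/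
structure MildSolution (β : ℝ) (x : ℝ → ℝ) (a : ℝ) (f f₁ f₂ : ℝ → ℝ → ℝ) : Prop where
  hasDerivAt : ∀ q ∈ Icc a 1, ∀ y, HasDerivAt (f q) (f₁ q y) y
  hasDerivAt₁ : ∀ q ∈ Icc a 1, ∀ y, HasDerivAt (f₁ q) (f₂ q y) y
  cont : ContinuousOn (fun p : ℝ × ℝ => f p.1 p.2) (Icc a 1 ×ˢ univ)
  cont₁ : ContinuousOn (fun p : ℝ × ℝ => f₁ p.1 p.2) (Icc a 1 ×ˢ univ)
  cont₂ : ContinuousOn (fun p : ℝ × ℝ => f₂ p.1 p.2) (Icc a 1 ×ˢ univ)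
  bounded : ∃ C, ∀ q ∈ Icc a 1, ∀ y, |f₁ q y| ≤ C
  eq : ∀ q ∈ Icc a 1, ∀ y, f q y = Real.log (Real.cosh (β * y))
    + 1 / 2 * ∫ s in q..1, (f₂ s y + x s * f₁ s y ^ 2)

theorem continuousOn_slice {a : ℝ} {f : ℝ → ℝ → ℝ}
    (h : ContinuousOn (fun p : ℝ × ℝ => f p.1 p.2) (Icc a 1 ×ˢ univ)) (y : ℝ) :
    ContinuousOn (fun s => f s y) (Icc a 1) :=
  h.comp (f := fun s => (s, y)) (by fun_prop) fun s hs => ⟨hs, mem_univ _⟩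

theorem intervalIntegrable_rhs {x : ℝ → ℝ} (hx : Monotone x) {a : ℝ} {f₁ f₂ : ℝ → ℝ → ℝ}
    (h1 : ContinuousOn (fun p : ℝ × ℝ => f₁ p.1 p.2) (Icc a 1 ×ˢ univ))
    (h2 : ContinuousOn (fun p : ℝ × ℝ => f₂ p.1 p.2) (Icc a 1 ×ˢ univ)) (y : ℝ) {p q : ℝ}
    (hp : p ∈ Icc a 1) (hq : q ∈ Icc a 1) :
    IntervalIntegrable (fun s => f₂ s y + x s * f₁ s y ^ 2) volume p q := by
  have hsub : uIcc p q ⊆ Icc a 1 := uIcc_subset_Icc hp hq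
  refine (((continuousOn_slice h2 y).mono hsub).intervalIntegrable).add ?_
  exact (hx.intervalIntegrable).mul_continuousOn (((continuousOn_slice h1 y).mono hsub).pow 2)

/-- The equation holds everywhere for the right derivative in `q` and the right limit of `x`. -/
theorem MildSolution.hasDerivWithinAt_right {β : ℝ} {x : ℝ → ℝ} {a : ℝ} {f f₁ f₂ : ℝ → ℝ → ℝ}
    (h : MildSolution β x a f f₁ f₂) (hx : Monotone x) {q : ℝ} (hq : q ∈ Ico a 1) (y : ℝ) :
    HasDerivWithinAt (fun s => f s y)
      (-(1 / 2 * (f₂ q y + Function.rightLim x q * f₁ q y ^ 2))) (Ici q) q := by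
  have hq' : q ∈ Icc a 1 := ⟨hq.1, hq.2.le⟩
  have h1 : (1 : ℝ) ∈ Icc a 1 := ⟨hq'.1.trans hq'.2, le_rfl⟩
  have hint := intervalIntegrable_rhs hx h.cont₁ h.cont₂ y hq' h1
  have hnhds : Icc q 1 ∈ 𝓝[>] q := mem_of_superset (Ioo_mem_nhdsGT hq.2) Ioo_subset_Icc_self
  have hmeas : StronglyMeasurableAtFilter (fun s => f₂ s y + x s * f₁ s y ^ 2) (𝓝[>] q) := by
    refine ⟨Ioc q 1, mem_of_superset (Ioo_mem_nhdsGT hq.2) Ioo_subset_Ioc_self, ?_⟩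
    exact hint.1.aestronglyMeasurable
  have hle : 𝓝[>] q ≤ 𝓝[Icc a 1] q :=
    nhdsWithin_le_of_mem (mem_of_superset hnhds (Icc_subset_Icc_left hq.1))
  have t1 : Tendsto (fun s => f₁ s y) (𝓝[>] q) (𝓝 (f₁ q y)) :=
    ((continuousOn_slice h.cont₁ y) q hq').tendsto.mono_left hle
  have t2 : Tendsto (fun s => f₂ s y) (𝓝[>] q) (𝓝 (f₂ q y)) :=
    ((continuousOn_slice h.cont₂ y) q hq').tendsto.mono_left hle
  have t3 := t2.add ((hx.tendsto_rightLim q).mul (t1.pow 2))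
  have hd := intervalIntegral.integral_hasDerivWithinAt_of_tendsto_ae_left hint
    (s := Ici q) (t := Ioi q) hmeas (t3.mono_left inf_le_left)
  have hd2 := (hd.const_mul (1 / 2)).const_add (Real.log (Real.cosh (β * y)))
  refine (hd2.congr_of_eventuallyEq ?_ (h.eq q hq' y)).congr_deriv (by ring)
  filter_upwards [Icc_mem_nhdsGE hq.2] with s hs
  exact h.eq s ⟨hq.1.trans hs.1, hs.2⟩ y

theorem second_deriv_nonpos_of_isLocalMax {w w₁ : ℝ → ℝ} {w₂ y : ℝ}
    (h1 : ∀ z, HasDerivAt w (w₁ z) z) (h2 : HasDerivAt w₁ w₂ y) (hm : IsLocalMax w y) :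
    w₂ ≤ 0 := by
  by_contra! hpos
  have e1 : deriv w = w₁ := funext fun z => (h1 z).deriv
  have hmin : IsLocalMin w y := by
    refine isLocalMin_of_deriv_deriv_pos ?_ hm.deriv_eq_zero (h1 y).continuousAt
    rwa [e1, h2.deriv]
  have hconst : w =ᶠ[𝓝 y] fun _ => w y := by
    filter_upwards [hm, hmin] with z hz hz' using le_antisymm hz hz'
  have := hconst.deriv.deriv_eq
  rw [e1, h2.deriv] at this
  simp at this
  linarith

/-- The right derivative at a maximum over `[q, b]` is nonpositive. -/
theorem deriv_nonpos_of_max_right {d : ℝ → ℝ} {d' q b : ℝ} (hb : q < b)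
    (h : HasDerivWithinAt d d' (Ici q) q) (hm : ∀ s ∈ Icc q b, d s ≤ d q) : d' ≤ 0 := by
  have h' := (hasDerivWithinAt_iff_tendsto_slope' self_notMem_Ioi).1 (hasDerivWithinAt_Ioi_iff_Ici.2 h)
  refine le_of_tendsto h' ?_
  filter_upwards [Ioo_mem_nhdsGT hb] with s hs
  rw [slope_def_field]
  exact div_nonpos_of_nonpos_of_nonneg (by linarith [hm s ⟨hs.1.le, hs.2.le⟩]) (by linarith [hs.1])

theorem MildSolution.linear_growth {β : ℝ} {x : ℝ → ℝ} {f f₁ f₂ : ℝ → ℝ → ℝ}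
    (h : MildSolution β x 0 f f₁ f₂) {C : ℝ} (hC : ∀ q ∈ Icc (0 : ℝ) 1, ∀ y, |f₁ q y| ≤ C) :
    ∃ M, ∀ q ∈ Icc (0 : ℝ) 1, ∀ y, |f q y| ≤ M + C * |y| := by
  obtain ⟨M, hM⟩ := isCompact_Icc.exists_bound_of_continuousOn (continuousOn_slice h.cont 0)
  refine ⟨M, fun q hq y => ?_⟩
  have h1 := Convex.norm_image_sub_le_of_norm_hasDerivWithin_le (f := f q) (s := univ)
    (fun z _ => (h.hasDerivAt q hq z).hasDerivWithinAt) (fun z _ => hC q hq z) convex_univ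
    (mem_univ 0) (mem_univ y)
  have h2 := hM q hq
  simp only [Real.norm_eq_abs, sub_zero] at h1 h2
  have h3 := abs_sub_abs_le_abs_sub (f q y) (f q 0)
  linarith

theorem intervalIntegrable_abs_sub {x x' : ℝ → ℝ} (hx : Monotone x) (hx' : Monotone x') (p q : ℝ) :
    IntervalIntegrable (fun s => |x s - x' s|) volume p q :=
  (hx.intervalIntegrable.sub hx'.intervalIntegrable).abs

theorem hasDerivWithinAt_integral_abs_sub {x x' : ℝ → ℝ} (hx : Monotone x) (hx' : Monotone x')
    (q b : ℝ) :
    HasDerivWithinAt (fun q => ∫ s in q..b, |x s - x' s|)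
      (-|Function.rightLim x q - Function.rightLim x' q|) (Ici q) q := by
  refine intervalIntegral.integral_hasDerivWithinAt_of_tendsto_ae_left
    (intervalIntegrable_abs_sub hx hx' q b) (s := Ici q) (t := Ioi q) ?_ ?_
  · exact ((hx.measurable.sub hx'.measurable).abs.stronglyMeasurable).stronglyMeasurableAtFilter
  · exact (((hx.tendsto_rightLim q).sub (hx'.tendsto_rightLim q)).abs).mono_left inf_le_left

theorem rightLim_mem {x : ℝ → ℝ} (hx : UnitMonotone x) (q : ℝ) :
    Function.rightLim x q ∈ Icc (0 : ℝ) 1 :=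
  isClosed_Icc.mem_of_tendsto (hx.mono.tendsto_rightLim q) (.of_forall hx.mem)

/-- The comparison principle. A maximum principle with the barrier `ε (1 + y²) exp (K (1 - q))`
bounds the difference of two solutions by the distance of their order parameters. As `f` has a
right derivative in `q` everywhere, the jumps of the order parameters do no harm. -/
theorem MildSolution.sub_le {β : ℝ} {x x' : ℝ → ℝ} (hx : UnitMonotone x) (hx' : UnitMonotone x')
    {f f₁ f₂ g g₁ g₂ : ℝ → ℝ → ℝ} (hf : MildSolution β x 0 f f₁ f₂)
    (hg : MildSolution β x' 0 g g₁ g₂) {C : ℝ} (hC : 0 ≤ C)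
    (hCf : ∀ q ∈ Icc (0 : ℝ) 1, ∀ y, |f₁ q y| ≤ C) (hCg : ∀ q ∈ Icc (0 : ℝ) 1, ∀ y, |g₁ q y| ≤ C)
    {q : ℝ} (hq : q ∈ Icc (0 : ℝ) 1) (y : ℝ) :
    f q y - g q y ≤ C ^ 2 / 2 * ∫ s in q..1, |x s - x' s| := by
  set A : ℝ → ℝ := fun q => C ^ 2 / 2 * ∫ s in q..1, |x s - x' s| with hA
  -- at a maximum the transport term costs at most `C` and the second derivative of the barrier at
  -- most `1`; the decay rate `K` of the barrier has to exceed their sum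
  set K := C + 2 with hK
  set e : ℝ → ℝ := fun q => Real.exp (K * (1 - q)) with he
  have hA0 : ∀ q ∈ Icc (0 : ℝ) 1, 0 ≤ A q := fun q hq =>
    mul_nonneg (by positivity) (intervalIntegral.integral_nonneg hq.2 fun s _ => abs_nonneg _)
  have hAd : ∀ q, HasDerivWithinAt A
      (C ^ 2 / 2 * -|Function.rightLim x q - Function.rightLim x' q|) (Ici q) q := fun q =>
    (hasDerivWithinAt_integral_abs_sub hx.mono hx'.mono q 1).const_mul _
  have hed : ∀ q, HasDerivAt e (-(K * e q)) q := by
    intro q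
    have := (((hasDerivAt_id q).const_sub 1).const_mul K).exp
    exact this.congr_deriv (by simp [he]; ring)
  have hAc : ContinuousOn A (Icc 0 1) := by
    have h1 : ContinuousOn (fun q => ∫ s in q..1, |x s - x' s|) (uIcc 0 1) :=
      intervalIntegral.continuousOn_primitive_interval_left
        (by
          rw [uIcc_of_le zero_le_one]
          exact (intervalIntegrable_iff_integrableOn_Icc_of_le zero_le_one).1
            (intervalIntegrable_abs_sub hx.mono hx'.mono 0 1))
    rw [uIcc_of_le zero_le_one] at h1
    exact continuousOn_const.mul h1
  obtain ⟨M, hM⟩ := hf.linear_growth hCf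
  obtain ⟨M', hM'⟩ := hg.linear_growth hCg
  suffices H : ∀ ε > 0, f q y - g q y - A q ≤ ε * ((1 + y ^ 2) * e q) by
    have h0 : Tendsto (fun ε : ℝ => ε * ((1 + y ^ 2) * e q)) (𝓝[>] 0) (𝓝 (0 * ((1 + y ^ 2) * e q))) :=
      (tendsto_id.mul_const _).mono_left nhdsWithin_le_nhds
    rw [zero_mul] at h0
    have := ge_of_tendsto h0 (b := f q y - g q y - A q)
      (by filter_upwards [self_mem_nhdsWithin] with ε hε using H ε hε)
    exact sub_nonpos.1 this
  intro ε hε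
  set D : ℝ × ℝ → ℝ := fun p => f p.1 p.2 - g p.1 p.2 - A p.1 - ε * ((1 + p.2 ^ 2) * e p.1) with hD
  by_contra! hcon
  have hDpos : 0 < D (q, y) := by simp only [hD]; linarith
  have he1 : ∀ q ∈ Icc (0 : ℝ) 1, 1 ≤ e q := fun q hq =>
    Real.one_le_exp (mul_nonneg (by positivity) (by linarith [hq.2]))
  -- outside a large ball the barrier dominates
  obtain ⟨R, hR0, hR⟩ : ∃ R : ℝ, 0 < R ∧ ∀ q ∈ Icc (0 : ℝ) 1, ∀ y, R ≤ |y| → D (q, y) < 0 := by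
    refine ⟨(|M + M'| + 2 * C + 1) / ε + 1, by positivity, fun q hq y hy => ?_⟩
    have b1 := abs_le.1 (hM q hq y)
    have b2 := abs_le.1 (hM' q hq y)
    have b3 : ε * (1 + y ^ 2) ≤ ε * ((1 + y ^ 2) * e q) := by
      have := he1 q hq
      gcongr
      exact le_mul_of_one_le_right (by positivity) this
    have b4 : 1 ≤ |y| := le_trans (by rw [le_add_iff_nonneg_left]; positivity) hy
    have b5 : |M + M'| + 2 * C + 1 ≤ ε * |y| := by
      have : (|M + M'| + 2 * C + 1) / ε ≤ |y| := by linarith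
      rw [div_le_iff₀ hε] at this
      linarith
    have b6 : (|M + M'| + 2 * C + 1) * |y| ≤ ε * y ^ 2 := by
      rw [← sq_abs y, pow_two, ← mul_assoc]; gcongr
    have b7 := le_abs_self (M + M')
    have b8 : |M + M'| ≤ |M + M'| * |y| := le_mul_of_one_le_right (abs_nonneg _) b4
    simp only [hD]
    linarith [hA0 q hq]
  have hDc : ContinuousOn D (Icc 0 1 ×ˢ univ) := by
    refine ((hf.cont.sub hg.cont).sub (hAc.comp continuousOn_fst fun p hp => hp.1)).sub ?_
    exact Continuous.continuousOn (by fun_prop)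
  have hyR : y ∈ Icc (-R) R := by
    by_contra hy
    have : R ≤ |y| := by
      by_contra! h
      exact hy ⟨(abs_lt.1 h).1.le, (abs_lt.1 h).2.le⟩
    linarith [hR q hq y this]
  obtain ⟨⟨q₀, y₀⟩, ⟨hq₀, hy₀⟩, hmax⟩ := (isCompact_Icc.prod isCompact_Icc).exists_isMaxOn
    (s := Icc (0 : ℝ) 1 ×ˢ Icc (-R) R) ⟨(q, y), hq, hyR⟩
    (hDc.mono (prod_mono le_rfl (subset_univ _)))
  simp only at hq₀ hy₀
  have hpos : 0 < D (q₀, y₀) := hDpos.trans_le (hmax ⟨hq, hyR⟩)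
  have hmax' : ∀ s ∈ Icc (0 : ℝ) 1, ∀ z, D (s, z) ≤ D (q₀, y₀) := by
    intro s hs z
    by_cases hz : R ≤ |z|
    · exact (hR s hs z hz).le.trans hpos.le
    · have := abs_le.1 (not_le.1 hz).le
      exact hmax ⟨hs, this⟩
  -- at `q = 1` both solutions have the same final value, so the maximum lies before
  have hq1 : q₀ < 1 := by
    refine lt_of_le_of_ne hq₀.2 fun h => ?_
    subst h
    have h1 : D (1, y₀) = -(ε * ((1 + y₀ ^ 2) * e 1)) := by
      have i1 := hf.eq 1 hq₀ y₀
      have i2 := hg.eq 1 hq₀ y₀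
      simp only [intervalIntegral.integral_same, mul_zero, add_zero] at i1 i2
      simp [hD, hA, i1, i2]
    have : 0 < ε * ((1 + y₀ ^ 2) * e 1) := by positivity
    linarith
  have hex : 0 < e q₀ := Real.exp_pos _
  -- space derivatives at the maximum
  have s1 : ∀ z, HasDerivAt (fun z => D (q₀, z)) (f₁ q₀ z - g₁ q₀ z - ε * (2 * z * e q₀)) z := by
    intro z
    have := (((hf.hasDerivAt q₀ hq₀ z).sub (hg.hasDerivAt q₀ hq₀ z)).sub_const (A q₀)).sub
      (((((hasDerivAt_id z).pow 2).const_add 1).mul_const (e q₀)).const_mul ε)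
    exact this.congr_deriv (by simp)
  have s2 : HasDerivAt (fun z => f₁ q₀ z - g₁ q₀ z - ε * (2 * z * e q₀))
      (f₂ q₀ y₀ - g₂ q₀ y₀ - ε * (2 * e q₀)) y₀ := by
    have := ((hf.hasDerivAt₁ q₀ hq₀ y₀).sub (hg.hasDerivAt₁ q₀ hq₀ y₀)).sub
      ((((hasDerivAt_id y₀).const_mul 2).mul_const (e q₀)).const_mul ε)
    exact this.congr_deriv (by simp)
  have hloc : IsLocalMax (fun z => D (q₀, z)) y₀ := .of_forall fun z => hmax' q₀ hq₀ z
  have d1 : f₁ q₀ y₀ - g₁ q₀ y₀ - ε * (2 * y₀ * e q₀) = 0 := hloc.hasDerivAt_eq_zero (s1 y₀)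
  have d2 := second_deriv_nonpos_of_isLocalMax s1 s2 hloc
  -- the time derivative at the maximum
  have d3 := deriv_nonpos_of_max_right (d := fun s => D (s, y₀)) hq1
    ((((hf.hasDerivWithinAt_right hx.mono ⟨hq₀.1, hq1⟩ y₀).sub
      (hg.hasDerivWithinAt_right hx'.mono ⟨hq₀.1, hq1⟩ y₀)).sub (hAd q₀)).sub
      ((((hed q₀).hasDerivWithinAt).const_mul (1 + y₀ ^ 2)).const_mul ε))
    (fun s hs => hmax' s ⟨hq₀.1.trans hs.1, hs.2⟩ y₀)
  have hX := rightLim_mem hx q₀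
  have hX' := rightLim_mem hx' q₀
  have hp := hCf q₀ hq₀ y₀
  have hr := hCg q₀ hq₀ y₀
  generalize Function.rightLim x q₀ = X at *
  generalize Function.rightLim x' q₀ = X' at *
  generalize f₁ q₀ y₀ = P at *
  generalize g₁ q₀ y₀ = r at *
  generalize f₂ q₀ y₀ = P₂ at *
  generalize g₂ q₀ y₀ = r₂ at *
  generalize e q₀ = E at *
  have a1 : (X - X') * r ^ 2 ≤ |X - X'| * C ^ 2 := by
    have : r ^ 2 ≤ C ^ 2 := sq_le_sq.2 (hr.trans (le_abs_self C))
    exact mul_le_mul (le_abs_self _) this (sq_nonneg _) (abs_nonneg _)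
  have a2 : X * ((P - r) * (P + r)) ≤ ε * E * C * (2 * (1 + y₀ ^ 2)) := by
    have hP : P - r = ε * (2 * y₀ * E) := by linarith
    have e1 : |P + r| ≤ 2 * C := (abs_add_le _ _).trans (by linarith)
    have e2 : |X * ((P - r) * (P + r))| ≤ 1 * ((ε * (2 * |y₀| * E)) * (2 * C)) := by
      rw [abs_mul, abs_mul]
      have : |P - r| = ε * (2 * |y₀| * E) := by
        rw [hP, abs_mul, abs_mul, abs_mul, abs_of_pos hε, abs_of_pos hex, abs_two]
      rw [this, abs_of_nonneg hX.1]
      gcongr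
      exact hX.2
    have e3 : 2 * |y₀| ≤ 1 + y₀ ^ 2 := by nlinarith [sq_nonneg (|y₀| - 1), sq_abs y₀]
    have e4 : (ε * E * (2 * C)) * (2 * |y₀|) ≤ (ε * E * (2 * C)) * (1 + y₀ ^ 2) := by gcongr
    have := le_abs_self (X * ((P - r) * (P + r)))
    nlinarith
  have a3 : 0 < ε * E * (1 + 2 * y₀ ^ 2) := by positivity
  rw [hK] at d3
  nlinarith

/-! ### Solutions for step functions -/

section Slice

variable {E : Type} [NormedAddCommGroup E] [NormedSpace ℝ E]

theorem LinBdd.comp {F F' H : Type} [NormedAddCommGroup F] [NormedAddCommGroup F']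
    [NormedAddCommGroup H] {u : F' → H} {A : F → F'} (hu : LinBdd u) (hA : LinBdd A) :
    LinBdd (fun p => u (A p)) := by
  obtain ⟨C, hC, h⟩ := hu
  obtain ⟨C', hC', h'⟩ := hA
  refine ⟨C * (1 + C'), by positivity, fun p => (h _).trans ?_⟩
  rw [mul_assoc]
  gcongr
  nlinarith [h' p, norm_nonneg p]

theorem Regular.comp {F F' : Type} [NormedAddCommGroup F] [NormedSpace ℝ F]
    [NormedAddCommGroup F'] [NormedSpace ℝ F'] {n : ℕ} {A : F → F'} (hA : LinBdd A)
    (hA' : ExpSmooth n A) {u : F' → ℝ} (hu : Regular n u) : Regular n (fun p => u (A p)) :=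
  ⟨ExpSmooth.comp hA hA' hu.1, hu.2.comp hA⟩

theorem Regular.comp_snd {n : ℕ} {u : E → ℝ} (hu : Regular n u) :
    Regular n (fun p : ℝ × E => u p.2) :=
  hu.comp (linBdd_clm (ContinuousLinearMap.snd ℝ ℝ E)) (expSmooth_clm n _)

theorem Regular.slice {n : ℕ} {u : ℝ × E → ℝ} (hu : Regular n u) (θ : ℝ) :
    Regular n (fun g => u (θ, g)) := by
  have e : (fun g : E => (θ, g)) = fun g => ContinuousLinearMap.inr ℝ ℝ E g + (θ, 0) := by
    funext g; simp
  refine hu.comp (A := fun g : E => (θ, g)) ?_ ?_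
  · rw [e]
    refine (linBdd_clm _).add ⟨‖((θ, 0) : ℝ × E)‖, norm_nonneg _, fun p => ?_⟩
    exact le_mul_of_one_le_right (norm_nonneg _) (by linarith [norm_nonneg p])
  · rw [e]
    exact (expSmooth_clm n _).add (expSmooth_const n _)

theorem dirDeriv_comp_snd {u : E → ℝ} (hu : Differentiable ℝ u) (w : ℝ × E) :
    dirDeriv w (fun p : ℝ × E => u p.2) = fun p => dirDeriv w.2 u p.2 := by
  funext p
  have h : HasFDerivAt (fun p : ℝ × E => u p.2)
      ((fderiv ℝ u p.2).comp (ContinuousLinearMap.snd ℝ ℝ E)) p :=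
    HasFDerivAt.comp (g := u) p (hu p.2).hasFDerivAt hasFDerivAt_snd
  rw [dirDeriv, h.fderiv]
  simp [dirDeriv]

theorem dirDeriv_slice {u : ℝ × E → ℝ} (hu : Differentiable ℝ u) (w : E) (θ : ℝ) :
    dirDeriv w (fun g => u (θ, g)) = fun g => dirDeriv (0, w) u (θ, g) := by
  funext g
  have h : HasFDerivAt (fun g => u (θ, g))
      ((fderiv ℝ u (θ, g)).comp (ContinuousLinearMap.inr ℝ ℝ E)) g :=
    HasFDerivAt.comp (g := u) g (hu (θ, g)).hasFDerivAt (hasFDerivAt_prodMk_right θ g)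
  rw [dirDeriv, h.fderiv]
  simp [dirDeriv]

theorem quad_comp_snd {u : E → ℝ} (hu : Regular 2 u) (m : ℝ) (w : E) (p : ℝ × E) :
    quad m (0, w) (fun p : ℝ × E => u p.2) p = quad m w u p.2 := by
  rw [quad, quad, dirDeriv_comp_snd hu.1.differentiable,
    dirDeriv_comp_snd (hu.1.dirDeriv w).differentiable]

theorem cubic_comp_snd {u : E → ℝ} (hu : Regular 3 u) (m : ℝ) (w : E) (p : ℝ × E) :
    cubic m (0, w) (fun p : ℝ × E => u p.2) p = cubic m w u p.2 := by
  rw [cubic, cubic, dirDeriv_comp_snd hu.1.differentiable,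
    dirDeriv_comp_snd (hu.1.dirDeriv w).differentiable,
    dirDeriv_comp_snd ((hu.1.dirDeriv w).dirDeriv w).differentiable]

theorem quad_slice {u : ℝ × E → ℝ} (hu : Regular 2 u) (m : ℝ) (w : E) (θ : ℝ) (g : E) :
    quad m w (fun g => u (θ, g)) g = quad m (0, w) u (θ, g) := by
  rw [quad, quad, dirDeriv_slice hu.1.differentiable,
    dirDeriv_slice (hu.1.dirDeriv _).differentiable]

theorem cubic_slice {u : ℝ × E → ℝ} (hu : Regular 3 u) (m : ℝ) (w : E) (θ : ℝ) (g : E) :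
    cubic m w (fun g => u (θ, g)) g = cubic m (0, w) u (θ, g) := by
  rw [cubic, cubic, dirDeriv_slice hu.1.differentiable,
    dirDeriv_slice (hu.1.dirDeriv _).differentiable,
    dirDeriv_slice ((hu.1.dirDeriv _).dirDeriv _).differentiable]

end Slice

theorem ExpSmooth.hasDerivAt_dirDeriv {n : ℕ} {F : ℝ → ℝ} (hF : ExpSmooth (n + 1) F) (y : ℝ) :
    HasDerivAt F (SpinGlass.dirDeriv 1 F y) y := by
  have := (hF.hasFDerivAt y).hasDerivAt
  exact this

theorem amplitude_sin_one (n : ℕ) : Amplitude n Real.sin :=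
  ⟨(expSmooth_sin_cos n).1, 1, Real.abs_sin_le_one⟩

/-- The Hopf–Cole evolution `m⁻¹ log E exp (m F (y + r z))` of a function of one variable. -/
def hopf (m r : ℝ) (F : ℝ → ℝ) (y : ℝ) : ℝ :=
  m⁻¹ * Real.log (∫ z, Real.exp (m * F (y + z * r)) ∂gauss)

theorem cole_eq_hopf (m : ℝ) (F : ℝ → ℝ) (θ y : ℝ) :
    cole m Real.sin 1 (fun p : ℝ × ℝ => F p.2) (θ, y) = hopf m (Real.sin θ) F y := by
  simp [cole, hopf, gavg, shift]

/-- Derivative bounds which survive the recursion. Lowering `μ` costs an amount proportional to the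
decrease, so that the constants do not depend on the number of steps. -/
structure DerivBounds (β μ : ℝ) (F : ℝ → ℝ) : Prop where
  regular : Regular 3 F
  first : ∀ y, |dirDeriv 1 F y| ≤ |β|
  quad : ∀ y, |quad μ 1 F y| ≤ |β| ^ 2 * (2 - μ)
  cubic : ∀ y, |cubic μ 1 F y| ≤ |β| ^ 3 * (9 - 8 * μ)

theorem DerivBounds.second {β μ : ℝ} {F : ℝ → ℝ} (h : DerivBounds β μ F) (h0 : 0 ≤ μ) (y : ℝ) :
    |dirDeriv 1 (dirDeriv 1 F) y| ≤ 2 * |β| ^ 2 := by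
  have h1 := h.quad y
  have h2 : |μ * dirDeriv 1 F y ^ 2| ≤ μ * |β| ^ 2 := by
    rw [abs_mul, abs_of_nonneg h0, abs_pow]
    exact mul_le_mul_of_nonneg_left (pow_le_pow_left₀ (abs_nonneg _) (h.first y) 2) h0
  have h3 : dirDeriv 1 (dirDeriv 1 F) y = SpinGlass.quad μ 1 F y - μ * dirDeriv 1 F y ^ 2 := by
    rw [SpinGlass.quad]; ring
  rw [h3]
  exact (abs_sub _ _).trans (by linarith)

theorem abs_mul_le_mul {a b A B : ℝ} (ha : |a| ≤ A) (hb : |b| ≤ B) : |a * b| ≤ A * B := by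
  rw [abs_mul]
  exact mul_le_mul ha hb (abs_nonneg _) ((abs_nonneg _).trans ha)

theorem DerivBounds.third {β μ : ℝ} {F : ℝ → ℝ} (h : DerivBounds β μ F) (h0 : 0 ≤ μ) (h1 : μ ≤ 1)
    (y : ℝ) : |dirDeriv 1 (dirDeriv 1 (dirDeriv 1 F)) y| ≤ 9 * |β| ^ 3 := by
  have b1 := h.first y
  have b2 := h.second h0 y
  have b3 := h.cubic y
  have e : dirDeriv 1 (dirDeriv 1 (dirDeriv 1 F)) y = SpinGlass.cubic μ 1 F y
      - (3 * μ * (dirDeriv 1 F y * dirDeriv 1 (dirDeriv 1 F) y) + μ ^ 2 * dirDeriv 1 F y ^ 3) := by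
    rw [SpinGlass.cubic]; ring
  have b4 : |3 * μ * (dirDeriv 1 F y * dirDeriv 1 (dirDeriv 1 F) y)|
      ≤ 3 * μ * (|β| * (2 * |β| ^ 2)) :=
    abs_mul_le_mul (abs_of_nonneg (by positivity)).le (abs_mul_le_mul b1 b2)
  have b5 : |μ ^ 2 * dirDeriv 1 F y ^ 3| ≤ μ ^ 2 * |β| ^ 3 := by
    refine abs_mul_le_mul (abs_of_nonneg (by positivity)).le ?_
    rw [abs_pow]; gcongr
  rw [e]
  refine (abs_sub _ _).trans ?_
  have b6 := abs_add_le (3 * μ * (dirDeriv 1 F y * dirDeriv 1 (dirDeriv 1 F) y))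
    (μ ^ 2 * dirDeriv 1 F y ^ 3)
  have b7 : 0 ≤ |β| ^ 3 := by positivity
  have b8 : μ ^ 2 ≤ μ := by nlinarith
  nlinarith [mul_nonneg b7 h0, mul_le_mul_of_nonneg_right b8 b7]

/-- Lowering `μ` changes `quad` and `cubic` by multiples of `μ - μ'`, as much as the bounds grow. -/
theorem DerivBounds.lower {β μ μ' : ℝ} {F : ℝ → ℝ} (h : DerivBounds β μ F) (h0 : 0 ≤ μ')
    (hle : μ' ≤ μ) (h1 : μ ≤ 1) : DerivBounds β μ' F where
  regular := h.regular
  first := h.first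
  quad y := by
    have e : SpinGlass.quad μ' 1 F y = SpinGlass.quad μ 1 F y - (μ - μ') * dirDeriv 1 F y ^ 2 := by
      rw [SpinGlass.quad, SpinGlass.quad]; ring
    have b : |(μ - μ') * dirDeriv 1 F y ^ 2| ≤ (μ - μ') * |β| ^ 2 := by
      refine abs_mul_le_mul (abs_of_nonneg (by linarith)).le ?_
      rw [abs_pow]; exact pow_le_pow_left₀ (abs_nonneg _) (h.first y) 2
    rw [e]
    exact (abs_sub _ _).trans (by linarith [h.quad y])
  cubic y := by
    have b1 := h.first y
    have b2 := h.second (h0.trans hle) y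
    have e : SpinGlass.cubic μ' 1 F y = SpinGlass.cubic μ 1 F y
        - ((3 * (μ - μ')) * (dirDeriv 1 F y * dirDeriv 1 (dirDeriv 1 F) y)
          + ((μ - μ') * (μ + μ')) * dirDeriv 1 F y ^ 3) := by
      rw [SpinGlass.cubic, SpinGlass.cubic]; ring
    have hd : 0 ≤ μ - μ' := by linarith
    have b4 : |(3 * (μ - μ')) * (dirDeriv 1 F y * dirDeriv 1 (dirDeriv 1 F) y)|
        ≤ (3 * (μ - μ')) * (|β| * (2 * |β| ^ 2)) :=
      abs_mul_le_mul (abs_of_nonneg (by positivity)).le (abs_mul_le_mul b1 b2)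
    have b5 : |((μ - μ') * (μ + μ')) * dirDeriv 1 F y ^ 3| ≤ ((μ - μ') * 2) * |β| ^ 3 := by
      refine abs_mul_le_mul ?_ ?_
      · rw [abs_of_nonneg (mul_nonneg hd (by linarith))]
        gcongr; linarith
      · rw [abs_pow]; gcongr
    rw [e]
    refine (abs_sub _ _).trans ?_
    have b6 := abs_add_le ((3 * (μ - μ')) * (dirDeriv 1 F y * dirDeriv 1 (dirDeriv 1 F) y))
      (((μ - μ') * (μ + μ')) * dirDeriv 1 F y ^ 3)
    have b7 := h.cubic y
    nlinarith

/-- The bounds are preserved by a Hopf–Cole step, on which `quad` and `cubic` act as averages. -/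
theorem DerivBounds.cole {β m : ℝ} (hm : 0 < m) {F : ℝ → ℝ} (h : DerivBounds β m F) (θ : ℝ) :
    DerivBounds β m (fun y => cole m Real.sin 1 (fun p : ℝ × ℝ => F p.2) (θ, y)) := by
  have hφ := h.regular.comp_snd
  have hψ := hφ.cole hm (amplitude_sin_one 3) 1
  refine ⟨hψ.slice θ, fun y => ?_, fun y => ?_, fun y => ?_⟩
  · rw [dirDeriv_slice hψ.1.differentiable]
    refine abs_dirDeriv_cole_le hm (amplitude_sin_one 1) 1 1 hφ.pred.pred (fun g => ?_) y
    rw [dirDeriv_comp_snd h.regular.1.differentiable]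
    exact h.first g
  · rw [quad_slice hψ.pred]
    refine abs_quad_cole_le hm (amplitude_sin_one 2) 1 1 hφ.pred (fun g => ?_) y
    rw [quad_comp_snd h.regular.pred]
    exact h.quad g
  · rw [cubic_slice hψ]
    refine abs_cubic_cole_le hm (amplitude_sin_one 3) 1 1 hφ (fun g => ?_) y
    rw [cubic_comp_snd h.regular]
    exact h.cubic g

theorem hasDerivAt_cosh_mul (β y : ℝ) :
    HasDerivAt (fun y => Real.cosh (β * y)) (β * Real.sinh (β * y)) y := by
  have := ((hasDerivAt_id y).const_mul β).cosh
  exact this.congr_deriv (by simp; ring)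

theorem hasDerivAt_sinh_mul (β y : ℝ) :
    HasDerivAt (fun y => Real.sinh (β * y)) (β * Real.cosh (β * y)) y := by
  have := ((hasDerivAt_id y).const_mul β).sinh
  exact this.congr_deriv (by simp; ring)

theorem dirDeriv_eq_of_hasDerivAt {u u' : ℝ → ℝ} (h : ∀ y, HasDerivAt u (u' y) y) :
    dirDeriv 1 u = u' := by
  funext y
  rw [dirDeriv, fderiv_apply_one_eq_deriv, (h y).deriv]

theorem log_cosh_le (t : ℝ) : Real.log (Real.cosh t) ≤ |t| := by
  rw [Real.log_le_iff_le_exp (Real.cosh_pos t), ← Real.cosh_abs, Real.cosh_eq]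
  have : Real.exp (-|t|) ≤ Real.exp |t| := Real.exp_le_exp.2 (by linarith [abs_nonneg t])
  linarith

theorem regular_log_cosh (n : ℕ) (β : ℝ) : Regular n (fun y => Real.log (Real.cosh (β * y))) := by
  have hl : LinBdd (fun y => Real.log (Real.cosh (β * y))) := by
    refine ⟨|β|, abs_nonneg _, fun y => ?_⟩
    rw [Real.norm_of_nonneg (Real.log_nonneg (Real.one_le_cosh _))]
    refine (log_cosh_le _).trans ?_
    rw [abs_mul, Real.norm_eq_abs]
    gcongr
    linarith
  refine ⟨ExpSmooth.log ?_ one_pos le_rfl (fun p => ?_) hl, hl⟩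
  · have h1 : ∀ c : ℝ, ExpSmooth n (fun y : ℝ => Real.exp (c * y)) := fun c =>
      ExpSmooth.exp (expSmooth_clm n (c • ContinuousLinearMap.id ℝ ℝ))
        (linBdd_clm (c • ContinuousLinearMap.id ℝ ℝ))
    have : (fun y => Real.cosh (β * y))
        = fun y => (1 / 2) * (Real.exp (β * y) + Real.exp (-β * y)) := by
      funext y; rw [Real.cosh_eq]; ring_nf
    rw [this]
    exact ((h1 β).add (h1 (-β))).const_mul _
  · simp

/-- For `μ = 1` the quantities are the derivatives of `cosh (β y)` divided by `cosh (β y)`. -/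
theorem derivBounds_log_cosh (β : ℝ) :
    DerivBounds β 1 (fun y => Real.log (Real.cosh (β * y))) := by
  have hr := regular_log_cosh 3 β
  have hexp : (fun y => Real.exp (1 * Real.log (Real.cosh (β * y))))
      = fun y => Real.cosh (β * y) := by
    funext y; rw [one_mul, Real.exp_log (Real.cosh_pos _)]
  have d1 : dirDeriv 1 (fun y => Real.cosh (β * y)) = fun y => β * Real.sinh (β * y) :=
    dirDeriv_eq_of_hasDerivAt (hasDerivAt_cosh_mul β)
  have d2 : dirDeriv 1 (fun y => β * Real.sinh (β * y)) = fun y => β * (β * Real.cosh (β * y)) :=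
    dirDeriv_eq_of_hasDerivAt fun y => (hasDerivAt_sinh_mul β y).const_mul β
  have d3 : dirDeriv 1 (fun y => β * (β * Real.cosh (β * y)))
      = fun y => β * (β * (β * Real.sinh (β * y))) :=
    dirDeriv_eq_of_hasDerivAt fun y => ((hasDerivAt_cosh_mul β y).const_mul β).const_mul β
  have hs : ∀ t, |Real.sinh t| ≤ Real.cosh t := fun t => by
    rw [Real.sinh_eq, Real.cosh_eq, abs_le]
    constructor <;> linarith [Real.exp_pos t, Real.exp_pos (-t)]
  have main : ∀ {c X P t : ℝ}, 0 < c → t = 1 * c * X → |t| ≤ P * c → |X| ≤ P := by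
    intro c X P t hc h1 h2
    rw [h1, one_mul, abs_mul, abs_of_pos hc] at h2
    exact le_of_mul_le_mul_left (by linarith) hc
  refine ⟨hr, fun y => ?_, fun y => ?_, fun y => ?_⟩
  · have := dirDeriv_exp hr.1.pred.pred 1 1 y
    rw [hexp, d1, one_mul (Real.log _), Real.exp_log (Real.cosh_pos _)] at this
    refine main (Real.cosh_pos _) this ?_
    rw [abs_mul]; gcongr; exact hs _
  · have := dirDeriv₂_exp hr.pred 1 1 y
    rw [hexp, d1, d2, one_mul (Real.log _), Real.exp_log (Real.cosh_pos _)] at this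
    refine main (Real.cosh_pos _) this ?_
    rw [abs_mul, abs_mul, abs_of_pos (Real.cosh_pos _)]
    exact le_of_eq (by ring)
  · have := dirDeriv₃_exp hr 1 1 y
    rw [hexp, d1, d2, d3, one_mul (Real.log _), Real.exp_log (Real.cosh_pos _)] at this
    refine main (Real.cosh_pos _) this ?_
    rw [abs_mul, abs_mul, abs_mul]
    calc |β| * (|β| * (|β| * |Real.sinh (β * y)|))
        ≤ |β| * (|β| * (|β| * Real.cosh (β * y))) := by gcongr; exact hs _
      _ = _ := by ring

/-- Uniform bounds on the space derivatives of a solution on `[a, 1]`, the third one being replaced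
by a Lipschitz condition on the second one. -/
structure UniformBounds (β a : ℝ) (f₁ f₂ : ℝ → ℝ → ℝ) : Prop where
  first : ∀ q ∈ Icc a 1, ∀ y, |f₁ q y| ≤ |β|
  second : ∀ q ∈ Icc a 1, ∀ y, |f₂ q y| ≤ 2 * |β| ^ 2
  third : ∀ q ∈ Icc a 1, ∀ y y', |f₂ q y - f₂ q y'| ≤ 9 * |β| ^ 3 * |y - y'|

theorem DerivBounds.lipschitz {β μ : ℝ} {F : ℝ → ℝ} (h : DerivBounds β μ F) (h0 : 0 ≤ μ)
    (h1 : μ ≤ 1) (y y' : ℝ) :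
    |dirDeriv 1 (dirDeriv 1 F) y - dirDeriv 1 (dirDeriv 1 F) y'| ≤ 9 * |β| ^ 3 * |y - y'| :=
  Convex.norm_image_sub_le_of_norm_hasDerivWithin_le (s := univ)
    (fun z _ => (((h.regular.1.dirDeriv 1).dirDeriv 1).hasDerivAt_dirDeriv z).hasDerivWithinAt)
    (fun z _ => h.third h0 h1 z) convex_univ (mem_univ y') (mem_univ y)

theorem hasDerivAt_arcsin_sqrt {b s : ℝ} (h0 : s < b) (h1 : b - s < 1) :
    HasDerivAt (fun s => Real.arcsin √(b - s))
      (-(1 / (2 * (√(b - s) * √(1 - (b - s)))))) s := by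
  have hpos : 0 < b - s := by linarith
  have hlt : √(b - s) < 1 := by rw [Real.sqrt_lt' one_pos]; simpa using h1
  have hgt : 0 < √(b - s) := Real.sqrt_pos.2 hpos
  have d1 : HasDerivAt (fun s => √(b - s)) (-1 / (2 * √(b - s))) s :=
    ((hasDerivAt_id s).const_sub b).sqrt hpos.ne'
  have d2 := (Real.hasDerivAt_arcsin (x := √(b - s)) (by linarith) hlt.ne).comp s d1
  refine d2.congr_deriv ?_
  rw [Real.sq_sqrt hpos.le]
  have : 0 < √(1 - (b - s)) := Real.sqrt_pos.2 (by linarith)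
  field_simp

/-- A solution on `[b, 1]` is continued to `[a, 1]` by the Hopf–Cole formula, if the order parameter
is constant on `[a, b)`. -/
theorem MildSolution.extend {β : ℝ} {x : ℝ → ℝ} (hx : Monotone x) {a b m : ℝ} (ha : 0 ≤ a)
    (hab : a < b) (hb : b ≤ 1) (hm : 0 < m) (hm1 : m ≤ 1) (hxm : ∀ q ∈ Ico a b, x q = m)
    {f f₁ f₂ : ℝ → ℝ → ℝ} (hf : MildSolution β x b f f₁ f₂) (hF : DerivBounds β m (f b))
    (hu : UniformBounds β b f₁ f₂) :
    ∃ g g₁ g₂, MildSolution β x a g g₁ g₂ ∧ UniformBounds β a g₁ g₂ ∧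
      DerivBounds β m (g a) ∧ g a = hopf m √(b - a) (f b) := by
  set ψ : ℝ × ℝ → ℝ := cole m Real.sin 1 (fun p : ℝ × ℝ => f b p.2) with hψdef
  have hψ : Regular 3 ψ := hF.regular.comp_snd.cole hm (amplitude_sin_one 3) 1
  set ψ₁ := dirDeriv (0, 1) ψ with hψ₁
  set ψ₂ := dirDeriv (0, 1) ψ₁ with hψ₂
  have hs1 : ExpSmooth 2 ψ₁ := hψ.1.dirDeriv _
  have hs2 : ExpSmooth 1 ψ₂ := hs1.dirDeriv _
  -- the amplitude `√(b - q)` is not smooth at `q = b`; it is written as `sin θ` to use the regularity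
  -- of the Hopf–Cole step in `θ` up to `θ = 0`
  set θ : ℝ → ℝ := fun q => Real.arcsin √(b - q) with hθ
  have hθc : Continuous θ := by fun_prop
  have hsin : ∀ q ∈ Icc a b, Real.sin (θ q) = √(b - q) := by
    intro q hq
    refine Real.sin_arcsin (by linarith [Real.sqrt_nonneg (b - q)]) ?_
    rw [Real.sqrt_le_one]
    linarith [hq.1]
  have hdb : ∀ q, DerivBounds β m (fun y => ψ (θ q, y)) := fun q => hF.cole hm (θ q)
  have sl1 : ∀ q, dirDeriv 1 (fun y => ψ (θ q, y)) = fun y => ψ₁ (θ q, y) := fun q =>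
    dirDeriv_slice hψ.1.differentiable 1 (θ q)
  have sl2 : ∀ q, dirDeriv 1 (fun y => ψ₁ (θ q, y)) = fun y => ψ₂ (θ q, y) := fun q =>
    dirDeriv_slice hs1.differentiable 1 (θ q)
  have dψ : ∀ q y, HasDerivAt (fun y => ψ (θ q, y)) (ψ₁ (θ q, y)) y := by
    intro q y
    have := (hψ.slice (θ q)).1.hasDerivAt_dirDeriv y
    rwa [sl1] at this
  have dψ₁ : ∀ q y, HasDerivAt (fun y => ψ₁ (θ q, y)) (ψ₂ (θ q, y)) y := by
    intro q y
    have := ((hψ.slice (θ q)).1.dirDeriv 1).hasDerivAt_dirDeriv y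
    rw [sl1] at this
    have e := sl2 q
    rwa [e] at this
  have hb' : b ∈ Icc b 1 := ⟨le_rfl, hb⟩
  -- at `q = b` the formula returns `f b` and its derivatives
  have hψb : ∀ y, ψ (θ b, y) = f b y := by
    intro y
    simp only [hθ, sub_self, Real.sqrt_zero, Real.arcsin_zero, hψdef]
    rw [cole_eq_hopf, hopf]
    simp [hm.ne']
  have hψb1 : ∀ y, ψ₁ (θ b, y) = f₁ b y := fun y => by
    have h1 := dψ b y
    simp only [hψb] at h1
    exact h1.unique (hf.hasDerivAt b hb' y)
  have hψb2 : ∀ y, ψ₂ (θ b, y) = f₂ b y := fun y => by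
    have h1 := dψ₁ b y
    simp only [hψb1] at h1
    exact h1.unique (hf.hasDerivAt₁ b hb' y)
  have glue : ∀ {k : ℝ → ℝ → ℝ} {κ : ℝ × ℝ → ℝ}, Continuous κ → (∀ y, κ (θ b, y) = k b y) →
      ContinuousOn (fun p : ℝ × ℝ => k p.1 p.2) (Icc b 1 ×ˢ univ) →
      ContinuousOn (fun p : ℝ × ℝ => if p.1 < b then κ (θ p.1, p.2) else k p.1 p.2)
        (Icc a 1 ×ˢ univ) := by
    intro k κ hκ hκb hk
    have e : Icc a 1 ×ˢ (univ : Set ℝ) = Icc a b ×ˢ univ ∪ Icc b 1 ×ˢ univ := by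
      rw [← union_prod, Icc_union_Icc_eq_Icc hab.le hb]
    rw [e]
    refine ContinuousOn.union_of_isClosed ?_ ?_ (isClosed_Icc.prod isClosed_univ)
      (isClosed_Icc.prod isClosed_univ)
    · refine ContinuousOn.congr (f := fun p : ℝ × ℝ => κ (θ p.1, p.2))
        (Continuous.continuousOn (by fun_prop)) fun p hp => ?_
      by_cases h : p.1 < b
      · simp [h]
      · have : p.1 = b := le_antisymm hp.1.2 (not_lt.1 h)
        simp [this, hκb]
    · refine hk.congr fun p hp => ?_
      simp [not_lt.2 hp.1.1]
  have hcos : ∀ s ∈ Ioo a b, HasDerivAt (fun s => θ s)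
      (-(1 / (2 * (Real.sin (θ s) * Real.cos (θ s))))) s ∧
      0 < Real.sin (θ s) * Real.cos (θ s) := by
    intro s hs
    have h1 := hasDerivAt_arcsin_sqrt hs.2 (by linarith [hs.1])
    have h2 : Real.cos (θ s) = √(1 - (b - s)) := by
      rw [hθ, Real.cos_arcsin, Real.sq_sqrt (by linarith [hs.2])]
    rw [hsin s (Ioo_subset_Icc_self hs), h2]
    exact ⟨h1, mul_pos (Real.sqrt_pos.2 (by linarith [hs.2])) (Real.sqrt_pos.2 (by linarith [hs.1]))⟩
  have hdt : ∀ s ∈ Ioo a b, ∀ y, HasDerivAt (fun s => ψ (θ s, y))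
      (-(1 / 2 * (ψ₂ (θ s, y) + m * ψ₁ (θ s, y) ^ 2))) s := by
    intro s hs y
    obtain ⟨h1, h2⟩ := hcos s hs
    have h3 : HasDerivAt (fun s => (θ s, y)) (-(1 / (2 * (Real.sin (θ s) * Real.cos (θ s)))), 0) s :=
      h1.prodMk (hasDerivAt_const s y)
    have h4 := (hψ.1.hasFDerivAt (θ s, y)).comp_hasDerivAt s h3
    have h5 := dirDeriv_param_cole hm (amplitude_sin_one 2) 1 hF.regular.comp_snd.pred
      (by rw [dirDeriv_comp_snd hF.regular.1.differentiable]; simp [dirDeriv]) (θ s, y)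
    refine h4.congr_deriv ?_
    rw [show ((-(1 / (2 * (Real.sin (θ s) * Real.cos (θ s))))), (0 : ℝ))
      = (-(1 / (2 * (Real.sin (θ s) * Real.cos (θ s))))) • ((1 : ℝ), (0 : ℝ)) by simp, map_smul]
    rw [← hψdef] at h5
    change _ • dirDeriv (1, 0) ψ (θ s, y) = _
    have hsn := left_ne_zero_of_mul h2.ne'
    have hcn := right_ne_zero_of_mul h2.ne'
    rw [h5, Real.deriv_sin, quad, smul_eq_mul, hψ₂, hψ₁]
    field_simp
  refine ⟨fun q y => if q < b then ψ (θ q, y) else f q y,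
    fun q y => if q < b then ψ₁ (θ q, y) else f₁ q y,
    fun q y => if q < b then ψ₂ (θ q, y) else f₂ q y, ?_, ?_, ?_, ?_⟩
  · have hc1 := glue hs1.continuous hψb1 hf.cont₁
    have hc2 := glue hs2.continuous hψb2 hf.cont₂
    have hfirst : ∀ q ∈ Icc a 1, ∀ y, |if q < b then ψ₁ (θ q, y) else f₁ q y| ≤ |β| := by
      intro q hq y
      split_ifs with h
      · have := (hdb q).first y
        rwa [sl1] at this
      · exact hu.first q ⟨not_lt.1 h, hq.2⟩ y
    refine ⟨fun q hq y => ?_, fun q hq y => ?_, glue hψ.1.continuous hψb hf.cont, hc1, hc2,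
      ⟨|β|, hfirst⟩, fun q hq y => ?_⟩
    · by_cases h : q < b
      · simpa [h] using dψ q y
      · simpa [h] using hf.hasDerivAt q ⟨not_lt.1 h, hq.2⟩ y
    · by_cases h : q < b
      · simpa [h] using dψ₁ q y
      · simpa [h] using hf.hasDerivAt₁ q ⟨not_lt.1 h, hq.2⟩ y
    · have hright : ∀ q ∈ Icc b 1, ∫ s in q..1, ((if s < b then ψ₂ (θ s, y) else f₂ s y)
          + x s * (if s < b then ψ₁ (θ s, y) else f₁ s y) ^ 2)
          = ∫ s in q..1, (f₂ s y + x s * f₁ s y ^ 2) := by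
        intro q hq
        refine intervalIntegral.integral_congr fun s hs => ?_
        rw [uIcc_of_le hq.2] at hs
        simp [not_lt.2 (hq.1.trans hs.1)]
      by_cases h : q < b
      · have hqb : q ∈ Icc a b := ⟨hq.1, h.le⟩
        have hib {p q : ℝ} := intervalIntegrable_rhs (p := p) (q := q)
          (f₁ := fun q y => if q < b then ψ₁ (θ q, y) else f₁ q y)
          (f₂ := fun q y => if q < b then ψ₂ (θ q, y) else f₂ q y) hx hc1 hc2 y
        have i1 := hib hq (⟨hab.le, hb⟩ : b ∈ Icc a 1)
        have i2 := hib (⟨hab.le, hb⟩ : b ∈ Icc a 1) (⟨hab.le.trans hb, le_rfl⟩ : (1 : ℝ) ∈ Icc a 1)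
        have hftc := integral_eq_of_hasDerivAt_off_countable_of_le (fun s => ψ (θ s, y))
          (fun s => -(1 / 2 * ((if s < b then ψ₂ (θ s, y) else f₂ s y)
            + x s * (if s < b then ψ₁ (θ s, y) else f₁ s y) ^ 2))) h.le countable_empty
          (Continuous.continuousOn (hψ.1.continuous.comp (by fun_prop)))
          (fun s hs => by
            have hs' : s ∈ Ioo a b := ⟨hq.1.trans_lt hs.1.1, hs.1.2⟩
            simp only [hs'.2, if_true, hxm s ⟨hs'.1.le, hs'.2⟩]
            exact hdt s hs' y) (i1.const_mul (1 / 2)).neg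
        rw [intervalIntegral.integral_neg, intervalIntegral.integral_const_mul, hψb,
          hf.eq b hb' y, ← hright b hb'] at hftc
        rw [← intervalIntegral.integral_add_adjacent_intervals i1 i2, if_pos h]
        linarith
      · rw [if_neg h, hright q ⟨not_lt.1 h, hq.2⟩]
        exact hf.eq q ⟨not_lt.1 h, hq.2⟩ y
  · refine ⟨fun q hq y => ?_, fun q hq y => ?_, fun q hq y y' => ?_⟩
    · split_ifs with h
      · have := (hdb q).first y
        rwa [sl1] at this
      · exact hu.first q ⟨not_lt.1 h, hq.2⟩ y
    · split_ifs with h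
      · have := (hdb q).second hm.le y
        rwa [sl1, sl2] at this
      · exact hu.second q ⟨not_lt.1 h, hq.2⟩ y
    · split_ifs with h
      · have := (hdb q).lipschitz hm.le hm1 y y'
        rwa [sl1, sl2] at this
      · exact hu.third q ⟨not_lt.1 h, hq.2⟩ y y'
  · simp only [hab, if_true]
    exact hdb a
  · funext y
    simp only [hab, if_true]
    rw [hψdef, cole_eq_hopf, hsin a ⟨le_rfl, hab.le⟩]

/-! ### Existence and uniqueness of the solution -/

/-- The grid approximation of `x` from below with mesh `1 / n`, kept away from `0`. -/
def stepFn (x : ℝ → ℝ) (n : ℕ) (q : ℝ) : ℝ := max (x (⌊n * q⌋ / n)) (1 / n)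

/-- The value of `stepFn x n` on the `j`-th interval of the grid, counted from the right. -/
def level (x : ℝ → ℝ) (n j : ℕ) : ℝ := max (x (1 - j / n)) (1 / n)

/-- The solution for `stepFn x n` at the `j`-th point of the grid, counted from the right. -/
def levelFun (β : ℝ) (x : ℝ → ℝ) (n : ℕ) : ℕ → ℝ → ℝ
  | 0 => fun y => Real.log (Real.cosh (β * y))
  | j + 1 => hopf (level x n (j + 1)) √(1 / n) (levelFun β x n j)

theorem unitMonotone_stepFn {x : ℝ → ℝ} (hx : UnitMonotone x) {n : ℕ} (hn : 0 < n) :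
    UnitMonotone (stepFn x n) where
  mono p q hpq := by
    unfold stepFn
    refine max_le_max (hx.mono ?_) le_rfl
    gcongr
  mem q := ⟨(hx.mem _).1.trans (le_max_left _ _), max_le (hx.mem _).2 (by
    rw [div_le_one (by positivity)]; exact_mod_cast hn)⟩

theorem level_pos (x : ℝ → ℝ) {n : ℕ} (hn : 0 < n) (j : ℕ) : 0 < level x n j :=
  lt_of_lt_of_le (by positivity) (le_max_right _ _)

theorem level_le_one {x : ℝ → ℝ} (hx : UnitMonotone x) {n : ℕ} (hn : 0 < n) (j : ℕ) :
    level x n j ≤ 1 := max_le (hx.mem _).2 (by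
    rw [div_le_one (by positivity)]; exact_mod_cast hn)

theorem level_succ_le {x : ℝ → ℝ} (hx : UnitMonotone x) (n j : ℕ) :
    level x n (j + 1) ≤ level x n j := by
  refine max_le_max (hx.mono ?_) le_rfl
  push_cast
  gcongr
  linarith

theorem level_zero {x : ℝ → ℝ} (hx1 : x 1 = 1) {n : ℕ} (hn : 0 < n) : level x n 0 = 1 := by
  have : (1 : ℝ) / n ≤ 1 := by rw [div_le_one (by positivity)]; exact_mod_cast hn
  simp only [level, Nat.cast_zero, zero_div, sub_zero, hx1]
  exact max_eq_left this

theorem stepFn_eq_level {x : ℝ → ℝ} {n : ℕ} (hn : 0 < n) (j : ℕ) {q : ℝ}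
    (hq : q ∈ Ico (1 - ((j + 1 : ℕ) : ℝ) / n) (1 - (j : ℝ) / n)) :
    stepFn x n q = level x n (j + 1) := by
  have hn' : (0 : ℝ) < n := by positivity
  have h1 : (1 - ((j + 1 : ℕ) : ℝ) / n) * n = n - (j + 1) := by push_cast; field_simp
  have h2 : (1 - (j : ℝ) / n) * n = n - j := by field_simp
  have e : ⌊n * q⌋ = (n : ℤ) - (j + 1) := by
    rw [Int.floor_eq_iff]
    push_cast
    constructor
    · have := mul_le_mul_of_nonneg_right hq.1 hn'.le
      linarith
    · have := mul_lt_mul_of_pos_right hq.2 hn'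
      linarith
  rw [stepFn, level, e]
  congr 2
  push_cast
  field_simp

/-- Backward construction of the solution for `stepFn x n`, interval after interval. -/
theorem exists_step_solution (β : ℝ) {x : ℝ → ℝ} (hx : UnitMonotone x) (hx1 : x 1 = 1) {n : ℕ}
    (hn : 0 < n) : ∀ j ≤ n, ∃ f f₁ f₂, MildSolution β (stepFn x n) (1 - (j : ℝ) / n) f f₁ f₂ ∧
      UniformBounds β (1 - (j : ℝ) / n) f₁ f₂ ∧ DerivBounds β (level x n j) (f (1 - (j : ℝ) / n)) ∧
      f (1 - (j : ℝ) / n) = levelFun β x n j := by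
  have hn' : (0 : ℝ) < n := by positivity
  intro j
  induction j with
  | zero =>
    intro _
    set F : ℝ → ℝ := fun y => Real.log (Real.cosh (β * y)) with hF
    have hb := derivBounds_log_cosh β
    have hD := hb.regular.1.dirDeriv 1
    refine ⟨fun _ => F, fun _ => dirDeriv 1 F, fun _ => dirDeriv 1 (dirDeriv 1 F),
      ⟨fun q _ y => hb.regular.1.hasDerivAt_dirDeriv y, fun q _ y => hD.hasDerivAt_dirDeriv y,
        ?_, ?_, ?_, ⟨|β|, fun q _ y => hb.first y⟩, fun q hq y => ?_⟩,
      ⟨fun q _ y => hb.first y, fun q _ y => hb.second zero_le_one y,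
        fun q _ y y' => hb.lipschitz zero_le_one le_rfl y y'⟩, ?_, rfl⟩
    · exact (hb.regular.1.continuous.comp continuous_snd).continuousOn
    · exact (hD.continuous.comp continuous_snd).continuousOn
    · exact ((hD.dirDeriv 1).continuous.comp continuous_snd).continuousOn
    · simp only [Nat.cast_zero, zero_div, sub_zero, Icc_self, mem_singleton_iff] at hq
      simp [hq, hF]
    · rw [level_zero hx1 hn]; exact hb
  | succ j ih =>
    intro hj
    obtain ⟨f, f₁, f₂, h1, h2, h3, h4⟩ := ih (by omega)
    have hab : (1 : ℝ) - ((j + 1 : ℕ) : ℝ) / n < 1 - (j : ℝ) / n := by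
      push_cast
      gcongr
      linarith
    have ha : (0 : ℝ) ≤ 1 - ((j + 1 : ℕ) : ℝ) / n := by
      rw [sub_nonneg, div_le_one hn']
      exact_mod_cast hj
    obtain ⟨g, g₁, g₂, k1, k2, k3, k4⟩ := h1.extend (unitMonotone_stepFn hx hn).mono ha hab
      (by rw [sub_le_self_iff]; positivity) (level_pos x hn (j + 1)) (level_le_one hx hn _)
      (fun q hq => stepFn_eq_level hn j hq)
      (h3.lower (level_pos x hn _).le (level_succ_le hx n j) (level_le_one hx hn _)) h2
    refine ⟨g, g₁, g₂, k1, k2, k3, ?_⟩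
    rw [k4, h4, levelFun]
    congr 2
    push_cast
    ring

theorem tendsto_stepFn {x : ℝ → ℝ} (hx : UnitMonotone x) {q : ℝ} (hq : ContinuousAt x q) :
    Tendsto (fun n : ℕ => stepFn x n q) atTop (𝓝 (x q)) := by
  have h1 : Tendsto (fun n : ℕ => (⌊(n : ℝ) * q⌋ : ℝ) / n) atTop (𝓝 q) := by
    have h0 := tendsto_one_div_atTop_nhds_zero_nat (𝕜 := ℝ)
    have hl : Tendsto (fun n : ℕ => q - 1 / (n : ℝ)) atTop (𝓝 q) := by
      simpa using h0.const_sub q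
    refine tendsto_of_tendsto_of_tendsto_of_le_of_le' hl tendsto_const_nhds ?_ ?_
    · filter_upwards [eventually_gt_atTop 0] with n hn
      have hn' : (0 : ℝ) < n := by positivity
      rw [le_div_iff₀ hn', sub_mul, one_div_mul_cancel hn'.ne']
      linarith [(Int.sub_one_lt_floor ((n : ℝ) * q)).le]
    · filter_upwards [eventually_gt_atTop 0] with n hn
      have hn' : (0 : ℝ) < n := by positivity
      rw [div_le_iff₀ hn']
      linarith [Int.floor_le ((n : ℝ) * q)]
  have h2 := (hq.tendsto.comp h1).max (tendsto_one_div_atTop_nhds_zero_nat (𝕜 := ℝ))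
  rw [max_eq_left (hx.mem q).1] at h2
  exact h2

theorem ae_tendsto_stepFn {x : ℝ → ℝ} (hx : UnitMonotone x) :
    ∀ᵐ q, Tendsto (fun n : ℕ => stepFn x n q) atTop (𝓝 (x q)) := by
  have := hx.mono.countable_not_continuousAt.ae_notMem volume
  filter_upwards [this] with q hq
  exact tendsto_stepFn hx (not_not.1 hq)

theorem tendsto_integral_abs_sub {x : ℝ → ℝ} (hx : UnitMonotone x) {X : ℕ → ℝ → ℝ}
    (hX : ∀ n, UnitMonotone (X n))
    (h : ∀ᵐ q, Tendsto (fun n : ℕ => X n q) atTop (𝓝 (x q))) :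
    Tendsto (fun n => ∫ s in (0 : ℝ)..1, |X n s - x s|) atTop (𝓝 0) := by
  have := intervalIntegral.tendsto_integral_filter_of_dominated_convergence
    (μ := volume) (a := (0 : ℝ)) (b := 1) (l := atTop) (F := fun n s => |X n s - x s|)
    (f := fun _ => 0) (fun _ => 1)
    (.of_forall fun n => ((hX n).mono.measurable.sub hx.mono.measurable).abs.aestronglyMeasurable)
    (.of_forall fun n => .of_forall fun s _ => ?_) (by simp) ?_
  · simpa using this
  · rw [Real.norm_of_nonneg (abs_nonneg _), abs_le]
    constructor <;> linarith [((hX n).mem s).1, ((hX n).mem s).2, (hx.mem s).1, (hx.mem s).2]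
  · filter_upwards [h] with s hs _
    simpa using (hs.sub_const (x s)).abs

/-- Interpolation between the size of a function and the Lipschitz constant of its derivative. -/
theorem abs_deriv_le_of_lipschitz {w w' : ℝ → ℝ} {η L : ℝ} (hη : 0 < η)
    (hd : ∀ y, HasDerivAt w (w' y) y) (hw : ∀ y, |w y| ≤ η)
    (hL : ∀ y y', |w' y - w' y'| ≤ L * |y - y'|) (y : ℝ) : |w' y| ≤ (2 + L) * √η := by
  have ht : 0 < √η := Real.sqrt_pos.2 hη
  obtain ⟨ξ, hξ, he⟩ := exists_hasDerivAt_eq_slope w w' (by linarith : y < y + √η)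
    (fun z _ => (hd z).continuousAt.continuousWithinAt) fun z _ => hd z
  have h0 : 0 ≤ L := by
    have := (abs_nonneg _).trans (hL 1 0)
    simpa using this
  have h1 : |w' ξ| ≤ 2 * √η := by
    rw [he, abs_div, add_sub_cancel_left, abs_of_pos ht, div_le_iff₀ ht, mul_assoc,
      Real.mul_self_sqrt hη.le]
    exact (abs_sub _ _).trans (by linarith [hw (y + √η), hw y])
  have h2 : |w' y - w' ξ| ≤ L * √η := by
    refine (hL y ξ).trans ?_
    gcongr
    rw [abs_sub_comm, abs_of_pos (by linarith [hξ.1])]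
    linarith [hξ.2]
  have h3 := abs_add_le (w' y - w' ξ) (w' ξ)
  rw [sub_add_cancel] at h3
  linarith

/-- A sequence with `|F n - F m| ≤ d n + d m`, `d → 0`, converges uniformly. -/
theorem exists_tendstoUniformlyOn {F : ℕ → ℝ × ℝ → ℝ} {S : Set (ℝ × ℝ)} {d : ℕ → ℝ}
    (hd : Tendsto d atTop (𝓝 0)) (h : ∀ n m, ∀ p ∈ S, |F n p - F m p| ≤ d n + d m) :
    ∃ G, TendstoUniformlyOn F G atTop S := by
  have hu : UniformCauchySeqOn F atTop S := by
    rw [Metric.uniformCauchySeqOn_iff]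
    intro ε hε
    obtain ⟨N, hN⟩ := eventually_atTop.1 (hd.eventually (gt_mem_nhds (half_pos hε)))
    refine ⟨N, fun m hm n hn p hp => ?_⟩
    rw [Real.dist_eq]
    linarith [h m n p hp, hN m hm, hN n hn]
  have hlim : ∀ p, ∃ g, p ∈ S → Tendsto (fun n => F n p) atTop (𝓝 g) := by
    intro p
    by_cases hp : p ∈ S
    · obtain ⟨g, hg⟩ := cauchySeq_tendsto_of_complete (hu.cauchySeq hp)
      exact ⟨g, fun _ => hg⟩
    · exact ⟨0, fun h => absurd h hp⟩
  choose G hG using hlim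
  exact ⟨G, hu.tendstoUniformlyOn_of_tendsto fun p hp => hG p hp⟩

/-- The limit of solutions with uniform derivative bounds is a solution. -/
theorem exists_limit_solution {β : ℝ} {x : ℝ → ℝ} (hx : UnitMonotone x) {X : ℕ → ℝ → ℝ}
    (hX : ∀ n, UnitMonotone (X n)) (hlim : ∀ᵐ q, Tendsto (fun n : ℕ => X n q) atTop (𝓝 (x q)))
    {f f₁ f₂ : ℕ → ℝ → ℝ → ℝ} (hf : ∀ n, MildSolution β (X n) 0 (f n) (f₁ n) (f₂ n))
    (hb : ∀ n, UniformBounds β 0 (f₁ n) (f₂ n)) :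
    ∃ g g₁ g₂, MildSolution β x 0 g g₁ g₂ ∧ UniformBounds β 0 g₁ g₂ := by
  set S : Set (ℝ × ℝ) := Icc 0 1 ×ˢ univ with hS
  set δ : ℕ → ℝ := fun n => ∫ s in (0 : ℝ)..1, |X n s - x s| with hδ
  have hδ0 : Tendsto δ atTop (𝓝 0) := tendsto_integral_abs_sub hx hX hlim
  have hδn : ∀ n, 0 ≤ δ n := fun n =>
    intervalIntegral.integral_nonneg zero_le_one fun s _ => abs_nonneg _
  -- the additional `1 / (n + 1)` keeps the bounds positive for the interpolation
  set d : ℕ → ℝ := fun n => |β| ^ 2 / 2 * δ n + 1 / ((n : ℝ) + 1) with hd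
  have hd0 : Tendsto d atTop (𝓝 0) := by
    have := (hδ0.const_mul (|β| ^ 2 / 2)).add (tendsto_one_div_add_atTop_nhds_zero_nat (𝕜 := ℝ))
    rwa [mul_zero, add_zero] at this
  have hdpos : ∀ n, 0 < d n := fun n => by
    have := hδn n
    positivity
  have half : ∀ n m, ∀ p ∈ S, f n p.1 p.2 - f m p.1 p.2 ≤ d n + d m := by
    intro n m p hp
    have h1 := (hf n).sub_le (hX n) (hX m) (hf m) (abs_nonneg β) (hb n).first (hb m).first hp.1 p.2
    have h2 : ∫ s in p.1..1, |X n s - X m s| ≤ δ n + δ m := by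
      have i1 := intervalIntegrable_abs_sub (hX n).mono (hX m).mono
      calc ∫ s in p.1..1, |X n s - X m s| ≤ ∫ s in (0 : ℝ)..1, |X n s - X m s| :=
            intervalIntegral.integral_mono_interval hp.1.1 hp.1.2 le_rfl
              (.of_forall fun s => abs_nonneg _) (i1 0 1)
        _ ≤ ∫ s in (0 : ℝ)..1, (|X n s - x s| + |X m s - x s|) := by
            refine intervalIntegral.integral_mono_on zero_le_one (i1 0 1)
              ((intervalIntegrable_abs_sub (hX n).mono hx.mono 0 1).add
                (intervalIntegrable_abs_sub (hX m).mono hx.mono 0 1)) fun s _ => ?_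
            rw [abs_sub_comm (X m s)]
            exact abs_sub_le _ _ _
        _ = _ := intervalIntegral.integral_add
              (intervalIntegrable_abs_sub (hX n).mono hx.mono 0 1)
              (intervalIntegrable_abs_sub (hX m).mono hx.mono 0 1)
    have h3 := mul_le_mul_of_nonneg_left h2 (by positivity : 0 ≤ |β| ^ 2 / 2)
    have h4 : (0 : ℝ) < 1 / ((n : ℝ) + 1) := by positivity
    have h5 : (0 : ℝ) < 1 / ((m : ℝ) + 1) := by positivity
    simp only [hd]
    linarith
  have c0 : ∀ n m, ∀ p ∈ S, |f n p.1 p.2 - f m p.1 p.2| ≤ d n + d m := fun n m p hp =>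
    abs_sub_le_iff.2 ⟨half n m p hp, (half m n p hp).trans (by linarith)⟩
  have interp : ∀ {u u' : ℕ → ℝ → ℝ → ℝ} {e : ℕ → ℝ} {L : ℝ}, (∀ n, 0 < e n) →
      (∀ n, ∀ q ∈ Icc (0 : ℝ) 1, ∀ y, HasDerivAt (u n q) (u' n q y) y) →
      (∀ n, ∀ q ∈ Icc (0 : ℝ) 1, ∀ y y', |u' n q y - u' n q y'| ≤ L * |y - y'|) →
      (∀ n m, ∀ p ∈ S, |u n p.1 p.2 - u m p.1 p.2| ≤ e n + e m) → ∀ n m, ∀ p ∈ S,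
      |u' n p.1 p.2 - u' m p.1 p.2| ≤ (2 + 2 * L) * √(e n) + (2 + 2 * L) * √(e m) := by
    intro u u' e L he hu hL hc n m p hp
    have hL0 : 0 ≤ L := by simpa using (abs_nonneg _).trans (hL 0 0 ⟨le_rfl, zero_le_one⟩ 1 0)
    have h1 := abs_deriv_le_of_lipschitz (w := fun y => u n p.1 y - u m p.1 y)
      (w' := fun y => u' n p.1 y - u' m p.1 y) (η := e n + e m) (L := 2 * L)
      (add_pos (he n) (he m)) (fun y => (hu n p.1 hp.1 y).sub (hu m p.1 hp.1 y))
      (fun y => hc n m (p.1, y) ⟨hp.1, mem_univ _⟩) (fun y y' => by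
        have e : u' n p.1 y - u' m p.1 y - (u' n p.1 y' - u' m p.1 y')
          = (u' n p.1 y - u' n p.1 y') - (u' m p.1 y - u' m p.1 y') := by ring
        rw [e]
        exact (abs_sub _ _).trans (by linarith [hL n p.1 hp.1 y y', hL m p.1 hp.1 y y'])) p.2
    refine h1.trans ?_
    rw [← mul_add]
    gcongr
    rw [Real.sqrt_le_left (by positivity), add_sq, Real.sq_sqrt (he n).le, Real.sq_sqrt (he m).le]
    have : 0 ≤ 2 * √(e n) * √(e m) := by positivity
    linarith
  have hlip : ∀ n, ∀ q ∈ Icc (0 : ℝ) 1, ∀ y y',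
      |f₁ n q y - f₁ n q y'| ≤ 2 * |β| ^ 2 * |y - y'| := fun n q hq y y' =>
    Convex.norm_image_sub_le_of_norm_hasDerivWithin_le (s := univ)
      (fun z _ => ((hf n).hasDerivAt₁ q hq z).hasDerivWithinAt)
      (fun z _ => (hb n).second q hq z) convex_univ (mem_univ y') (mem_univ y)
  -- convergence of `f` and a bound on `f₂` give convergence of `f₁`; the Lipschitz bound on `f₂`
  -- then gives convergence of `f₂`
  have c1 := interp hdpos (fun n => (hf n).hasDerivAt) hlip c0
  have hβ : 0 < 2 + 2 * (2 * |β| ^ 2) := by positivity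
  have c2 := interp (e := fun n => (2 + 2 * (2 * |β| ^ 2)) * √(d n))
    (fun n => mul_pos hβ (Real.sqrt_pos.2 (hdpos n))) (fun n => (hf n).hasDerivAt₁)
    (fun n => (hb n).third) c1
  have sq0 : ∀ {e : ℕ → ℝ} (c : ℝ), Tendsto e atTop (𝓝 0) →
      Tendsto (fun n => c * √(e n)) atTop (𝓝 0) := fun c he => by
    simpa using (he.sqrt).const_mul c
  obtain ⟨G, hG⟩ := exists_tendstoUniformlyOn (F := fun n p => f n p.1 p.2) hd0 c0
  obtain ⟨G₁, hG₁⟩ := exists_tendstoUniformlyOn (F := fun n p => f₁ n p.1 p.2) (sq0 _ hd0) c1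
  obtain ⟨G₂, hG₂⟩ := exists_tendstoUniformlyOn (F := fun n p => f₂ n p.1 p.2)
    (sq0 _ (sq0 _ hd0)) c2
  have slice : ∀ {u : ℕ → ℝ → ℝ → ℝ} {U : ℝ × ℝ → ℝ},
      TendstoUniformlyOn (fun n (p : ℝ × ℝ) => u n p.1 p.2) U atTop S → ∀ q ∈ Icc (0 : ℝ) 1,
      TendstoUniformly (fun n => u n q) (fun y => U (q, y)) atTop := by
    intro u U hU q hq
    rw [← tendstoUniformlyOn_univ]
    exact (hU.comp (fun y => (q, y))).mono fun y _ => ⟨hq, mem_univ _⟩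
  have b1 : ∀ q ∈ Icc (0 : ℝ) 1, ∀ y, |G₁ (q, y)| ≤ |β| := fun q hq y =>
    le_of_tendsto ((slice hG₁ q hq).tendsto_at y).abs (.of_forall fun n => (hb n).first q hq y)
  refine ⟨fun q y => G (q, y), fun q y => G₁ (q, y), fun q y => G₂ (q, y),
    ⟨fun q hq y => ?_, fun q hq y => ?_, ?_, ?_, ?_, ⟨|β|, b1⟩, fun q hq y => ?_⟩,
    ⟨b1, fun q hq y => ?_, fun q hq y y' => ?_⟩⟩
  · exact hasDerivAt_of_tendstoUniformly (slice hG₁ q hq)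
      (.of_forall fun n z => (hf n).hasDerivAt q hq z) (fun z => (slice hG q hq).tendsto_at z) y
  · exact hasDerivAt_of_tendstoUniformly (slice hG₂ q hq)
      (.of_forall fun n z => (hf n).hasDerivAt₁ q hq z) (fun z => (slice hG₁ q hq).tendsto_at z) y
  · exact hG.continuousOn (.of_forall fun n => (hf n).cont)
  · exact hG₁.continuousOn (.of_forall fun n => (hf n).cont₁)
  · exact hG₂.continuousOn (.of_forall fun n => (hf n).cont₂)
  · refine tendsto_nhds_unique ((slice hG q hq).tendsto_at y) ?_
    have h1 : (fun n => f n q y) = fun n => Real.log (Real.cosh (β * y))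
        + 1 / 2 * ∫ s in q..1, (f₂ n s y + X n s * f₁ n s y ^ 2) :=
      funext fun n => (hf n).eq q hq y
    rw [h1]
    refine Tendsto.const_add _ (Tendsto.const_mul _ ?_)
    have hsub : ∀ s ∈ uIoc q 1, s ∈ Icc (0 : ℝ) 1 := fun s hs => by
      rw [uIoc_of_le hq.2] at hs
      exact ⟨hq.1.trans hs.1.le, hs.2⟩
    refine intervalIntegral.tendsto_integral_filter_of_dominated_convergence
      (fun _ => 2 * |β| ^ 2 + |β| ^ 2) (.of_forall fun n => ?_)
      (.of_forall fun n => .of_forall fun s hs => ?_) (by simp) ?_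
    · have := intervalIntegrable_rhs (hX n).mono (hf n).cont₁ (hf n).cont₂ y hq ⟨zero_le_one, le_rfl⟩
      rw [uIoc_of_le hq.2]
      exact this.1.aestronglyMeasurable
    · have h2 := (hb n).second s (hsub s hs) y
      have h3 := (hb n).first s (hsub s hs) y
      have h4 : |X n s * f₁ n s y ^ 2| ≤ 1 * |β| ^ 2 := by
        refine abs_mul_le_mul ?_ ?_
        · rw [abs_of_nonneg ((hX n).mem s).1]; exact ((hX n).mem s).2
        · rw [abs_pow]; exact pow_le_pow_left₀ (abs_nonneg _) h3 2
      exact (abs_add_le _ _).trans (by linarith)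
    · filter_upwards [hlim] with s hs hsm
      have hs' := hsub s hsm
      exact ((slice hG₂ s hs').tendsto_at y).add (hs.mul (((slice hG₁ s hs').tendsto_at y).pow 2))
  · exact le_of_tendsto ((slice hG₂ q hq).tendsto_at y).abs
      (.of_forall fun n => (hb n).second q hq y)
  · exact le_of_tendsto (((slice hG₂ q hq).tendsto_at y).sub ((slice hG₂ q hq).tendsto_at y')).abs
      (.of_forall fun n => (hb n).third q hq y y')

theorem exists_stepFn_solution (β : ℝ) {x : ℝ → ℝ} (hx : UnitMonotone x) (hx1 : x 1 = 1) {n : ℕ}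
    (hn : 0 < n) : ∃ f f₁ f₂, MildSolution β (stepFn x n) 0 f f₁ f₂ ∧ UniformBounds β 0 f₁ f₂ ∧
      f 0 = levelFun β x n n := by
  have hn' : (n : ℝ) ≠ 0 := by positivity
  obtain ⟨f, f₁, f₂, h1, h2, -, h4⟩ := exists_step_solution β hx hx1 hn n le_rfl
  rw [div_self hn', sub_self] at h1 h2 h4
  exact ⟨f, f₁, f₂, h1, h2, h4⟩

/-- The solution for a general order parameter exists and at `q = 0` it is the limit of the
Hopf–Cole recursions for the grid approximations. -/
theorem exists_mildSolution (β : ℝ) {x : ℝ → ℝ} (hx : UnitMonotone x) (hx1 : x 1 = 1) :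
    ∃ f f₁ f₂, MildSolution β x 0 f f₁ f₂ ∧
      ∀ y, Tendsto (fun n => levelFun β x (n + 1) (n + 1) y) atTop (𝓝 (f 0 y)) := by
  choose f f₁ f₂ h1 h2 h3 using fun n : ℕ => exists_stepFn_solution β hx hx1 (Nat.succ_pos n)
  have hX : ∀ n, UnitMonotone (stepFn x (n + 1)) := fun n => unitMonotone_stepFn hx n.succ_pos
  have hlim : ∀ᵐ q, Tendsto (fun n : ℕ => stepFn x (n + 1) q) atTop (𝓝 (x q)) := by
    filter_upwards [ae_tendsto_stepFn hx] with q hq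
    exact hq.comp (tendsto_add_atTop_nat 1)
  obtain ⟨g, g₁, g₂, hg, hb⟩ := exists_limit_solution hx hX hlim h1 h2
  refine ⟨g, g₁, g₂, hg, fun y => ?_⟩
  have hδ := (tendsto_integral_abs_sub hx hX hlim).const_mul (|β| ^ 2 / 2)
  rw [mul_zero] at hδ
  have h0 : (0 : ℝ) ∈ Icc (0 : ℝ) 1 := ⟨le_rfl, zero_le_one⟩
  rw [tendsto_iff_norm_sub_tendsto_zero]
  refine squeeze_zero (fun _ => norm_nonneg _) (fun n => ?_) hδ
  rw [← h3 n, Real.norm_eq_abs, abs_sub_le_iff]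
  refine ⟨(h1 n).sub_le (hX n) hx hg (abs_nonneg β) (h2 n).first hb.first h0 y, ?_⟩
  refine (hg.sub_le hx (hX n) (h1 n) (abs_nonneg β) hb.first (h2 n).first h0 y).trans (le_of_eq ?_)
  simp only [abs_sub_comm]

theorem MildSolution.eq_of {β : ℝ} {x : ℝ → ℝ} (hx : UnitMonotone x) {f f₁ f₂ g g₁ g₂ : ℝ → ℝ → ℝ}
    (hf : MildSolution β x 0 f f₁ f₂) (hg : MildSolution β x 0 g g₁ g₂) {q : ℝ}
    (hq : q ∈ Icc (0 : ℝ) 1) (y : ℝ) : f q y = g q y := by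
  obtain ⟨C, hC⟩ := hf.bounded
  obtain ⟨C', hC'⟩ := hg.bounded
  have h1 : ∀ q ∈ Icc (0 : ℝ) 1, ∀ y, |f₁ q y| ≤ max C C' := fun q hq y =>
    (hC q hq y).trans (le_max_left _ _)
  have h2 : ∀ q ∈ Icc (0 : ℝ) 1, ∀ y, |g₁ q y| ≤ max C C' := fun q hq y =>
    (hC' q hq y).trans (le_max_right _ _)
  have h0 : 0 ≤ max C C' := (abs_nonneg _).trans (h1 q hq y)
  have e1 := hf.sub_le hx hx hg h0 h1 h2 hq y
  have e2 := hg.sub_le hx hx hf h0 h2 h1 hq y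
  simp at e1 e2
  linarith

theorem eventuallyEq_of_eqOn {x x' : ℝ → ℝ} (he : ∀ q ∈ Ioo (0 : ℝ) 1, x q = x' q) {q : ℝ}
    (hq : q ∈ Ioo (0 : ℝ) 1) : x =ᶠ[𝓝 q] x' := by
  filter_upwards [Ioo_mem_nhds hq.1 hq.2] with s hs using he s hs

/-- At a continuity point of the order parameter the integrated equation can be differentiated. -/
theorem MildSolution.isParisiSolution {β : ℝ} {x x' : ℝ → ℝ} (hx' : UnitMonotone x')
    (he : ∀ q ∈ Ioo (0 : ℝ) 1, x q = x' q) {f f₁ f₂ : ℝ → ℝ → ℝ}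
    (hf : MildSolution β x' 0 f f₁ f₂) : IsParisiSolution β x f := by
  have d1 : ∀ q ∈ Icc (0 : ℝ) 1, deriv (f q) = f₁ q := fun q hq =>
    funext fun y => (hf.hasDerivAt q hq y).deriv
  have d2 : ∀ q ∈ Icc (0 : ℝ) 1, deriv (deriv (f q)) = f₂ q := fun q hq => by
    rw [d1 q hq]
    exact funext fun y => (hf.hasDerivAt₁ q hq y).deriv
  have ht : ∀ q ∈ Ioo (0 : ℝ) 1, ContinuousAt x q → ∀ y, HasDerivAt (fun s => f s y)
      (-(1 / 2 * (f₂ q y + x q * f₁ q y ^ 2))) q := by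
    intro q hq hc y
    have hq' : q ∈ Icc (0 : ℝ) 1 := Ioo_subset_Icc_self hq
    have hc' : ContinuousAt x' q := hc.congr (eventuallyEq_of_eqOn he hq)
    have hn : Icc (0 : ℝ) 1 ∈ 𝓝 q := Icc_mem_nhds hq.1 hq.2
    have i0 := intervalIntegrable_rhs hx'.mono hf.cont₁ hf.cont₂ y
      (p := 0) (q := 1) ⟨le_rfl, zero_le_one⟩ ⟨zero_le_one, le_rfl⟩
    have i1 := intervalIntegrable_rhs hx'.mono hf.cont₁ hf.cont₂ y (q := 1) hq' ⟨zero_le_one, le_rfl⟩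
    have hd := intervalIntegral.integral_hasDerivAt_left i1
      ⟨Ioc 0 1, Ioc_mem_nhds hq.1 hq.2, i0.1.aestronglyMeasurable⟩
      (((continuousOn_slice hf.cont₂ y).continuousAt hn).add
        (hc'.mul (((continuousOn_slice hf.cont₁ y).continuousAt hn).pow 2)))
    have hd2 := (hd.const_mul (1 / 2)).const_add (Real.log (Real.cosh (β * y)))
    refine (hd2.congr_of_eventuallyEq ?_).congr_deriv ?_
    · filter_upwards [hn] with s hs using hf.eq s hs y
    · rw [he q hq]; ring
  refine ⟨fun q hq => ?_, hf.cont, ?_, ?_, ?_, fun q hq hc y => (ht q hq hc y).differentiableAt,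
    fun q hq hc y => ?_, fun y => ?_⟩
  · have hc2 : Continuous (f₂ q) := by
      have := hf.cont₂.comp (f := fun y : ℝ => (q, y)) (s := univ) (by fun_prop)
        fun y _ => ⟨hq, mem_univ _⟩
      exact continuousOn_univ.1 this
    rw [show (2 : WithTop ℕ∞) = 1 + 1 from by norm_num, contDiff_succ_iff_deriv]
    refine ⟨fun y => (hf.hasDerivAt q hq y).differentiableAt, by simp, ?_⟩
    rw [contDiff_one_iff_deriv, d2 q hq, d1 q hq]
    exact ⟨fun y => (hf.hasDerivAt₁ q hq y).differentiableAt, hc2⟩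
  · exact hf.cont₁.congr fun p hp => by rw [d1 p.1 hp.1]
  · exact hf.cont₂.congr fun p hp => by simp only [d2 p.1 hp.1]
  · obtain ⟨C, hC⟩ := hf.bounded
    exact ⟨C, fun q hq y => by rw [d1 q hq]; exact hC q hq y⟩
  · have hq' := Ioo_subset_Icc_self hq
    rw [(ht q hq hc y).deriv, d2 q hq', d1 q hq']
    ring
  · have := hf.eq 1 ⟨zero_le_one, le_rfl⟩ y
    simpa using this

/-- The discontinuities of the order parameter are countable, so the differential equation can be
integrated across them. -/
theorem IsParisiSolution.mildSolution {β : ℝ} {x x' : ℝ → ℝ} (hx' : UnitMonotone x')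
    (he : ∀ q ∈ Ioo (0 : ℝ) 1, x q = x' q) {f : ℝ → ℝ → ℝ} (hf : IsParisiSolution β x f) :
    MildSolution β x' 0 f (fun q => deriv (f q)) (fun q => deriv (deriv (f q))) := by
  refine ⟨fun q hq y => ?_, fun q hq y => ?_, hf.continuousOn, hf.continuousOn_deriv,
    hf.continuousOn_deriv_deriv, hf.bounded_deriv, fun q hq y => ?_⟩
  · exact ((hf.contDiff q hq).differentiable (by norm_num) y).hasDerivAt
  · have := hf.contDiff q hq
    rw [show (2 : WithTop ℕ∞) = 1 + 1 from by norm_num, contDiff_succ_iff_deriv] at this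
    exact (this.2.2.differentiable (by norm_num) y).hasDerivAt
  · have h1 : (1 : ℝ) ∈ Icc (0 : ℝ) 1 := ⟨zero_le_one, le_rfl⟩
    have i1 := intervalIntegrable_rhs (f₁ := fun q => deriv (f q))
      (f₂ := fun q => deriv (deriv (f q))) hx'.mono hf.continuousOn_deriv
      hf.continuousOn_deriv_deriv y
      hq h1
    have hftc := integral_eq_of_hasDerivAt_off_countable_of_le (fun s => f s y)
      (fun s => -(1 / 2 * (deriv (deriv (f s)) y + x' s * deriv (f s) y ^ 2))) hq.2
      hx'.mono.countable_not_continuousAt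
      ((continuousOn_slice hf.continuousOn y).mono (Icc_subset_Icc_left hq.1))
      (fun s hs => by
        have hs' : s ∈ Ioo (0 : ℝ) 1 := ⟨hq.1.trans_lt hs.1.1, hs.1.2⟩
        have hc : ContinuousAt x s :=
          (not_not.1 hs.2 : ContinuousAt x' s).congr (eventuallyEq_of_eqOn he hs').symm
        have e1 := hf.equation s hs' hc y
        rw [he s hs'] at e1
        refine ((hf.differentiableAt s hs' hc y).hasDerivAt).congr_deriv ?_
        linarith) (i1.const_mul (1 / 2)).neg
    rw [intervalIntegral.integral_neg, intervalIntegral.integral_const_mul, hf.final] at hftc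
    linarith

/-- An order parameter as a monotone function on the whole line. The value at `1` does not matter
for the equation; `1` is the convenient one for the recursion. -/
def extendUnit (x : ℝ → ℝ) (q : ℝ) : ℝ := if 1 ≤ q then 1 else x (max 0 q)

theorem extendUnit_one (x : ℝ → ℝ) : extendUnit x 1 = 1 := by simp [extendUnit]

theorem extendUnit_eq (x : ℝ → ℝ) : ∀ q ∈ Ioo (0 : ℝ) 1, x q = extendUnit x q := fun q hq => by
  simp [extendUnit, not_le.2 hq.2, max_eq_right hq.1.le]

theorem unitMonotone_extendUnit {x : ℝ → ℝ} (hx : x ∈ OrderParameter) :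
    UnitMonotone (extendUnit x) := by
  have hm : ∀ q, ¬ 1 ≤ q → max 0 q ∈ Icc (0 : ℝ) 1 := fun q hq =>
    ⟨le_max_left _ _, max_le zero_le_one (not_le.1 hq).le⟩
  refine ⟨fun p q hpq => ?_, fun q => ?_⟩
  · unfold extendUnit
    split_ifs with h1 h2 h2
    · exact le_rfl
    · exact absurd (h1.trans hpq) h2
    · exact (hx.2 (hm p h1)).2
    · exact hx.1 (hm p h1) (hm q h2) (max_le_max le_rfl hpq)
  · unfold extendUnit
    split_ifs with h
    · exact ⟨zero_le_one, le_rfl⟩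
    · exact hx.2 (hm q h)

theorem isParisiSolution_parisiF (β : ℝ) {x : ℝ → ℝ} (hx : x ∈ OrderParameter) :
    IsParisiSolution β x (parisiF β x) := by
  have hx' := unitMonotone_extendUnit hx
  obtain ⟨f, f₁, f₂, hf, -⟩ := exists_mildSolution β hx' (extendUnit_one x)
  have hex : ∃ f, IsParisiSolution β x f := ⟨f, hf.isParisiSolution hx' (extendUnit_eq x)⟩
  rw [parisiF, dif_pos hex]
  exact hex.choose_spec

theorem parisiF_unique (β : ℝ) {x : ℝ → ℝ} (hx : x ∈ OrderParameter) {g : ℝ → ℝ → ℝ}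
    (hg : IsParisiSolution β x g) {q : ℝ} (hq : q ∈ Icc (0 : ℝ) 1) (y : ℝ) :
    g q y = parisiF β x q y :=
  have hx' := unitMonotone_extendUnit hx
  (hg.mildSolution hx' (extendUnit_eq x)).eq_of hx'
    ((isParisiSolution_parisiF β hx).mildSolution hx' (extendUnit_eq x)) hq y

theorem tendsto_levelFun (β : ℝ) {x : ℝ → ℝ} (hx : x ∈ OrderParameter) (y : ℝ) :
    Tendsto (fun n => levelFun β (extendUnit x) (n + 1) (n + 1) y) atTop (𝓝 (parisiF β x 0 y)) := by
  have hx' := unitMonotone_extendUnit hx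
  obtain ⟨f, f₁, f₂, hf, hl⟩ := exists_mildSolution β hx' (extendUnit_one x)
  rw [← parisiF_unique β hx (hf.isParisiSolution hx' (extendUnit_eq x)) ⟨le_rfl, zero_le_one⟩ y]
  exact hl y

/-! ### Iterated Hopf–Cole steps -/

section Iterate

variable {E κ ι : Type} [NormedAddCommGroup E] [NormedSpace ℝ E]

/-- Hopf–Cole steps with the same `m` and amplitude along the directions `v k`, `k` in a list. -/
def coleList (m : ℝ) (a : ℝ → ℝ) (v : κ → E) (l : List κ) (φ : ℝ × E → ℝ) : ℝ × E → ℝ :=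
  l.foldr (fun k φ => cole m a (v k) φ) φ

theorem coleList_cons (m : ℝ) (a : ℝ → ℝ) (v : κ → E) (k : κ) (l : List κ) (φ : ℝ × E → ℝ) :
    coleList m a v (k :: l) φ = cole m a (v k) (coleList m a v l φ) := rfl

theorem Regular.coleList {n : ℕ} {m : ℝ} (hm : 0 < m) {a : ℝ → ℝ} (ha : Amplitude n a)
    (v : κ → E) (l : List κ) {φ : ℝ × E → ℝ} (hφ : Regular n φ) :
    Regular n (coleList m a v l φ) := by
  induction l with
  | nil => exact hφ
  | cons k l ih => exact ih.cole hm ha (v k)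

theorem cole_eq_self {m : ℝ} (hm : 0 < m) {a : ℝ → ℝ} (v : E) (φ : ℝ × E → ℝ) {θ : ℝ}
    (h0 : a θ = 0) (g : E) : cole m a v φ (θ, g) = φ (θ, g) := by
  simp [cole, gavg, shift, h0, hm.ne']

theorem coleList_eq_self {m : ℝ} (hm : 0 < m) {a : ℝ → ℝ} (v : κ → E) (l : List κ)
    (φ : ℝ × E → ℝ) {θ : ℝ} (h0 : a θ = 0) (g : E) : coleList m a v l φ (θ, g) = φ (θ, g) := by
  induction l with
  | nil => rfl
  | cons k l ih => rw [coleList_cons, cole_eq_self hm _ _ h0, ih]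

/-- A round of Hopf–Cole steps transfers an upper bound for `gen`, see `gen_cole_le`. -/
theorem gen_coleList_le [Fintype ι] [DecidableEq ι] {m : ℝ} (hm : 0 < m) {a : ℝ → ℝ}
    (ha : Amplitude 2 a) (v : ι → E) (e : κ → ι) (l : List κ) {φ : ℝ × E → ℝ}
    (hφ : Regular 2 φ) {θ K : ℝ} : ∀ (c : ι → ℝ),
    (∀ g, gen m (c + (l.map fun k => Pi.single (e k) (2 * (a θ * deriv a θ))).sum) v φ (θ, g) ≤ K) →
    ∀ g, gen m c v (coleList m a (fun k => v (e k)) l φ) (θ, g) ≤ K := by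
  induction l with
  | nil =>
    intro c h g
    have := h g
    rw [List.map_nil, List.sum_nil, add_zero] at this
    exact this
  | cons k l ih =>
    intro c h
    refine gen_cole_le hm ha c v (e k) (hφ.coleList hm ha _ l) (ih _ fun g => ?_)
    have := h g
    rwa [List.map_cons, List.sum_cons, ← add_assoc] at this

/-- Lowering `m` costs the quadratic form of the gradient. -/
theorem gen_eq_sub [Fintype ι] (m m' : ℝ) (c : ι → ℝ) (v : ι → E) (φ : ℝ × E → ℝ) (p : ℝ × E) :
    gen m' c v φ p = gen m c v φ p
      - 1 / 2 * (m - m') * ∑ k, c k * dirDeriv (0, v k) φ p ^ 2 := by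
  simp only [gen, quad, mul_add, Finset.sum_add_distrib, Finset.mul_sum]
  rw [add_sub_assoc, add_sub_assoc, ← Finset.sum_sub_distrib]
  congr 2
  refine Finset.sum_congr rfl fun k _ => ?_
  ring

end Iterate

/-! ### The recursion for `N` sites -/

section Sites

variable {N : ℕ}

/-- Energies (exponents of the weights) of the configurations, as vectors. -/
abbrev Energy (N : ℕ) : Type := Config N → ℝ

/-- Monotone functions of the energies commuting with the addition of constants: their gradients
are probability vectors. -/
structure IsGibbs (φ : Energy N → ℝ) : Prop where
  mono : Monotone φ
  add_const : ∀ g (t : ℝ), φ (fun σ => g σ + t) = φ g + t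

theorem IsGibbs.cole {m : ℝ} (hm : 0 < m) {a : ℝ → ℝ} (ha : Amplitude 0 a) (v : Energy N)
    {φ : ℝ × Energy N → ℝ} (hφ : Regular 0 φ) {θ : ℝ} (h : IsGibbs fun g => φ (θ, g)) :
    IsGibbs fun g => cole m a v φ (θ, g) where
  mono g g' hg := by
    have hp := gavg_exp_pos hm ha v hφ (θ, g)
    refine mul_le_mul_of_nonneg_left (Real.log_le_log hp ?_) (inv_nonneg.2 hm.le)
    refine integral_mono (integrable_shift ha v (hφ.exp m) _) (integrable_shift ha v (hφ.exp m) _)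
      fun z => Real.exp_le_exp.2 (mul_le_mul_of_nonneg_left ?_ hm.le)
    exact h.mono (add_le_add_left hg _)
  add_const g t := by
    have e : gavg a v (fun q => Real.exp (m * φ q)) (θ, fun σ => g σ + t)
        = gavg a v (fun q => Real.exp (m * φ q)) (θ, g) * Real.exp (m * t) := by
      unfold gavg
      rw [← integral_mul_const]
      refine integral_congr_ae (.of_forall fun z => ?_)
      simp only [shift]
      rw [← Real.exp_add, ← mul_add, ← h.add_const]
      congr 4
      funext σ
      simp only [Pi.add_apply]
      ring
    have hp := gavg_exp_pos hm ha v hφ (θ, g)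
    simp only [SpinGlass.cole]
    rw [e, Real.log_mul hp.ne' (Real.exp_pos _).ne', Real.log_exp]
    field_simp

theorem IsGibbs.coleList {κ : Type} {m : ℝ} (hm : 0 < m) {a : ℝ → ℝ} (ha : Amplitude 0 a)
    (v : κ → Energy N) (l : List κ) {φ : ℝ × Energy N → ℝ} (hφ : Regular 0 φ) {θ : ℝ}
    (h : IsGibbs fun g => φ (θ, g)) : IsGibbs fun g => coleList m a v l φ (θ, g) := by
  induction l with
  | nil => exact h
  | cons k l ih => exact ih.cole hm ha (v k) (hφ.coleList hm ha v l)

/-- The gradient is nonnegative by monotonicity and has total mass `1` by `IsGibbs.add_const`. -/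
theorem IsGibbs.exists_prob {φ : ℝ × Energy N → ℝ} (hφ : Regular 1 φ) {θ : ℝ}
    (h : IsGibbs fun g => φ (θ, g)) (g : Energy N) : ∃ p : Config N → ℝ, (∀ σ, 0 ≤ p σ) ∧
      ∑ σ, p σ = 1 ∧ ∀ w, dirDeriv (0, w) φ (θ, g) = ∑ σ, p σ * w σ := by
  classical
  have hsl := (hφ.slice θ).1
  have hlin : ∀ w, dirDeriv (0, w) φ (θ, g) = fderiv ℝ (fun g => φ (θ, g)) g w := fun w => by
    have := congrFun (dirDeriv_slice hφ.1.differentiable w θ) g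
    exact this.symm
  have hline : ∀ w, HasDerivAt (fun t : ℝ => φ (θ, g + t • w)) (dirDeriv (0, w) φ (θ, g)) 0 := by
    intro w
    have h1 : HasDerivAt (fun t : ℝ => g + t • w) w 0 := by
      simpa using ((hasDerivAt_id (0 : ℝ)).smul_const w).const_add g
    have h2 := hsl.hasFDerivAt (g + (0 : ℝ) • w)
    rw [zero_smul, add_zero] at h2
    rw [hlin]
    exact HasFDerivAt.comp_hasDerivAt_of_eq (0 : ℝ) h2 h1 (by simp)
  have hsum : ∀ w : Energy N, dirDeriv (0, w) φ (θ, g)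
      = ∑ σ, dirDeriv (0, (Pi.single σ 1 : Energy N)) φ (θ, g) * w σ := by
    intro w
    simp only [hlin]
    conv_lhs => rw [pi_eq_sum_univ' w, map_sum]
    refine Finset.sum_congr rfl fun σ _ => ?_
    rw [map_smul, smul_eq_mul, mul_comm]
  refine ⟨fun σ => dirDeriv (0, (Pi.single σ 1 : Energy N)) φ (θ, g), fun σ => ?_, ?_, hsum⟩
  · have hm : Monotone (fun t : ℝ => φ (θ, g + t • (Pi.single σ 1 : Energy N))) := fun s t hst =>
      h.mono (add_le_add_right (smul_le_smul_of_nonneg_right hst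
        (Pi.single_nonneg.2 zero_le_one)) g)
    show 0 ≤ dirDeriv (0, (Pi.single σ 1 : Energy N)) φ (θ, g)
    rw [← (hline (Pi.single σ 1)).deriv]
    exact hm.deriv_nonneg
  · have h1 := hsum (fun _ => 1)
    simp only [mul_one] at h1
    rw [← h1]
    have h2 : (fun t : ℝ => φ (θ, g + t • (fun _ => 1))) = fun t => φ (θ, g) + t := by
      funext t
      rw [← h.add_const]
      congr 2
      funext σ
      simp
    have h3 := hline (fun _ => 1)
    rw [h2] at h3
    exact h3.unique ((hasDerivAt_id (0 : ℝ)).const_add _)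

/-- The logarithm of the sum of the exponentials of the energies. -/
def logSumExp (g : Energy N) : ℝ := Real.log (∑ σ, Real.exp (g σ))

theorem sum_exp_pos (g : Energy N) : 0 < ∑ σ, Real.exp (g σ) :=
  Finset.sum_pos (fun _ _ => Real.exp_pos _) Finset.univ_nonempty

theorem isGibbs_logSumExp : IsGibbs (logSumExp (N := N)) where
  mono g g' hg := Real.log_le_log (sum_exp_pos g)
    (Finset.sum_le_sum fun σ _ => Real.exp_le_exp.2 (hg σ))
  add_const g t := by
    simp only [logSumExp, Real.exp_add, ← Finset.sum_mul]
    rw [Real.log_mul (sum_exp_pos g).ne' (Real.exp_pos _).ne', Real.log_exp]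

theorem IsGibbs.abs_sub_le {φ : Energy N → ℝ} (h : IsGibbs φ) (g g' : Energy N) :
    |φ g - φ g'| ≤ ‖g - g'‖ := by
  have key : ∀ g g' : Energy N, φ g ≤ φ g' + ‖g - g'‖ := by
    intro g g'
    rw [← h.add_const]
    refine h.mono fun σ => ?_
    have := (le_abs_self _).trans (norm_le_pi_norm (g - g') σ)
    simp only [Pi.sub_apply] at this
    linarith
  rw [abs_sub_le_iff]
  have h1 := key g g'
  have h2 := key g' g
  rw [norm_sub_rev] at h2
  constructor <;> linarith

theorem regular_logSumExp (n : ℕ) : Regular n (logSumExp (N := N)) := by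
  have hl : LinBdd (logSumExp (N := N)) := by
    refine ⟨|logSumExp (0 : Energy N)| + 1, by positivity, fun g => ?_⟩
    have h1 := isGibbs_logSumExp.abs_sub_le g 0
    have h2 := abs_sub_abs_le_abs_sub (logSumExp g) (logSumExp (0 : Energy N))
    rw [sub_zero] at h1
    rw [Real.norm_eq_abs]
    nlinarith [norm_nonneg g, abs_nonneg (logSumExp (0 : Energy N))]
  refine ⟨ExpSmooth.log (A := 1) (B := 1) ?_ one_pos zero_le_one (fun g => ?_) hl, hl⟩
  · refine expSmooth_sum n _ fun σ => ?_
    exact ExpSmooth.exp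
      (expSmooth_clm n (ContinuousLinearMap.proj (R := ℝ) (φ := fun _ : Config N => ℝ) σ))
      (linBdd_clm (ContinuousLinearMap.proj (R := ℝ) (φ := fun _ : Config N => ℝ) σ))
  · have h1 : Real.exp (-‖g‖) ≤ Real.exp (g 1) := by
      have := (neg_abs_le _).trans' (neg_le_neg (norm_le_pi_norm g 1))
      exact Real.exp_le_exp.2 this
    have h2 := Finset.single_le_sum (f := fun σ => Real.exp (g σ))
      (fun σ _ => (Real.exp_pos _).le) (Finset.mem_univ (1 : Config N))
    rw [one_mul, one_mul]
    exact h1.trans h2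

theorem dirDeriv_sum_exp (w b : Energy N) : dirDeriv w (fun g : Energy N => ∑ σ, b σ * Real.exp (g σ))
    = fun g => ∑ σ, b σ * w σ * Real.exp (g σ) := by
  funext g
  have h : HasFDerivAt (fun g : Energy N => ∑ σ, b σ * Real.exp (g σ))
      (∑ σ, b σ • (Real.exp (g σ) • (ContinuousLinearMap.proj (R := ℝ) (φ := fun _ : Config N => ℝ) σ)))
      g := HasFDerivAt.fun_sum fun σ _ =>
    (((ContinuousLinearMap.proj (R := ℝ) (φ := fun _ : Config N => ℝ) σ).hasFDerivAt).exp).const_mul _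
  rw [dirDeriv, h.fderiv, sum_apply]
  refine Finset.sum_congr rfl fun σ _ => ?_
  simp
  ring

/-- For `m = 1` the quantity `quad` is the second derivative of the partition function divided by it,
that is the average of `w²`. -/
theorem quad_logSumExp {w : Energy N} {κ : ℝ} (hw : ∀ σ, w σ ^ 2 = κ) (g : Energy N) :
    quad 1 w logSumExp g = κ := by
  have h := dirDeriv₂_exp (regular_logSumExp (N := N) 2) 1 w g
  have e : (fun g : Energy N => Real.exp (1 * logSumExp g))
      = fun g => ∑ σ, (1 : Energy N) σ * Real.exp (g σ) := by
    funext g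
    simp [logSumExp, Real.exp_log (sum_exp_pos g)]
  rw [e, dirDeriv_sum_exp] at h
  have e2 := congrFun (dirDeriv_sum_exp w (fun σ => (1 : Energy N) σ * w σ)) g
  rw [e2, one_mul, one_mul, logSumExp, Real.exp_log (sum_exp_pos g)] at h
  have e3 : ∑ σ, (1 : Energy N) σ * w σ * w σ * Real.exp (g σ) = κ * ∑ σ, Real.exp (g σ) := by
    rw [Finset.mul_sum]
    refine Finset.sum_congr rfl fun σ _ => ?_
    rw [← hw σ]
    simp
    ring
  rw [e3, mul_comm] at h
  exact (mul_left_cancel₀ (sum_exp_pos g).ne' h).symm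

theorem spin_sq (σ : Config N) (i : Fin N) : spin σ i * spin σ i = 1 := by
  unfold spin
  rcases Int.units_eq_one_or (σ i) with h | h <;> simp [h]

/-- The direction of the external field at a site. -/
def siteDir (β : ℝ) (i : Fin N) : Energy N := fun σ => β * spin σ i

/-- The direction of the coupling of a couple of sites. -/
def coupleDir (β : ℝ) (p : Couple N) : Energy N :=
  fun σ => β / √(N : ℝ) * (spin σ p.1.1 * spin σ p.1.2)

/-- All directions of the Gaussian displacements. -/
def dirs (β : ℝ) : Fin N ⊕ Couple N → Energy N := Sum.elim (siteDir β) (coupleDir β)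

/-- Symmetric double sums in terms of sums over couples. -/
theorem sum_sum_eq_couple (b : Fin N → Fin N → ℝ) (hb : ∀ i j, b i j = b j i) :
    ∑ i, ∑ j, b i j = ∑ i, b i i + 2 * ∑ p : Couple N, b p.1.1 p.1.2 := by
  have h1 : ∑ p : Couple N, b p.1.1 p.1.2 = ∑ i, ∑ j, if i < j then b i j else 0 := by
    rw [← Finset.sum_product', Finset.univ_product_univ, ← Finset.sum_filter,
      ← Finset.sum_subtype_eq_sum_filter]
    refine (Finset.sum_congr ?_ fun _ _ => rfl)
    ext; simp
  have h2 : ∑ i, ∑ j, (if j < i then b i j else 0) = ∑ i, ∑ j, if i < j then b i j else 0 := by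
    rw [Finset.sum_comm]
    refine Finset.sum_congr rfl fun i _ => Finset.sum_congr rfl fun j _ => ?_
    rw [hb]
  have h3 : ∀ i, b i i = ∑ j, if i = j then b i j else 0 := fun i => by simp
  rw [h1, two_mul]
  nth_rewrite 2 [← h2]
  simp_rw [h3 (_ : Fin N)]
  rw [← Finset.sum_add_distrib, ← Finset.sum_add_distrib]
  refine Finset.sum_congr rfl fun i _ => ?_
  rw [← Finset.sum_add_distrib, ← Finset.sum_add_distrib]
  refine Finset.sum_congr rfl fun j _ => ?_
  rcases lt_trichotomy i j with h | h | h
  · simp [h, h.ne, not_lt.2 h.le]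
  · simp [h]
  · simp [h, h.ne', not_lt.2 h.le]

theorem two_mul_card_couple : 2 * (Fintype.card (Couple N) : ℝ) = N ^ 2 - N := by
  have := sum_sum_eq_couple (N := N) (fun _ _ => 1) fun _ _ => rfl
  simp at this
  rw [pow_two]
  linarith

/-- The operator `gen` at the start of the recursion: a constant, because the spins have square `1`. -/
theorem gen_logSumExp (β q τ : ℝ) (hN : 0 < N) (p : ℝ × Energy N) :
    gen 1 (Sum.elim (fun _ => -(τ * q)) fun _ => τ) (dirs β)
      (fun p : ℝ × Energy N => logSumExp p.2) p
      = τ * β ^ 2 / 4 * ((N - 1) - 2 * N * q) := by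
  have hN' : (0 : ℝ) < N := by positivity
  have hr := regular_logSumExp (N := N) 2
  have h1 : ∀ i : Fin N, quad 1 (siteDir β i) logSumExp p.2 = β ^ 2 := fun i =>
    quad_logSumExp (fun σ => by rw [siteDir, mul_pow, pow_two (spin σ i), spin_sq, mul_one]) _
  have h2 : ∀ i : Couple N, quad 1 (coupleDir β i) logSumExp p.2 = β ^ 2 / N := fun i =>
    quad_logSumExp (fun σ => by
      rw [coupleDir, mul_pow, pow_two (spin σ _ * _), mul_mul_mul_comm, spin_sq, spin_sq, div_pow,
        Real.sq_sqrt hN'.le, mul_one, mul_one]) _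
  have h3 : dirDeriv (1, 0) (fun p : ℝ × Energy N => logSumExp p.2) p = 0 := by
    rw [dirDeriv_comp_snd hr.1.differentiable]
    simp [dirDeriv]
  have hc := two_mul_card_couple (N := N)
  rw [gen, h3, Fintype.sum_sum_type]
  simp only [quad_comp_snd hr, dirs, Sum.elim_inl, Sum.elim_inr, h1, h2, Finset.sum_const,
    Finset.card_univ, Fintype.card_fin, nsmul_eq_mul]
  have hc' : (Fintype.card (Couple N) : ℝ) = (N ^ 2 - N) / 2 := by linarith
  rw [hc']
  field_simp
  ring

/-- The completion of the square which produces the order parameter: for a probability vector `p` on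
the configurations, the couplings and the fields at level `q` combine into
`(R - q)² - q²` with `R` the overlap. -/
theorem neg_le_sum_dirs (β q : ℝ) (hN : 0 < N) {p : Config N → ℝ} (hp : ∀ σ, 0 ≤ p σ)
    (hp1 : ∑ σ, p σ = 1) :
    -(β ^ 2 / 2 * (1 + N * q ^ 2)) ≤ ∑ k, (Sum.elim (fun _ => -q) fun _ => 1 : _ → ℝ) k *
      (∑ σ, p σ * dirs (N := N) β k σ) ^ 2 := by
  have hN' : (0 : ℝ) < N := by positivity
  set R : Config N → Config N → ℝ := fun σ τ => ∑ i, spin σ i * spin τ i with hR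
  have e1 : ∑ i, (∑ σ, p σ * spin σ i) ^ 2 = ∑ σ, ∑ τ, p σ * p τ * R σ τ := by
    have : ∀ i, (∑ σ, p σ * spin σ i) ^ 2 = ∑ σ, ∑ τ, p σ * p τ * (spin σ i * spin τ i) := by
      intro i
      rw [pow_two, Finset.sum_mul_sum]
      exact Finset.sum_congr rfl fun σ _ => Finset.sum_congr rfl fun τ _ => by ring
    simp only [this, hR, Finset.mul_sum]
    rw [Finset.sum_comm]
    refine Finset.sum_congr rfl fun σ _ => ?_
    rw [Finset.sum_comm]
  have e2 : ∑ i, ∑ j, (∑ σ, p σ * (spin σ i * spin σ j)) ^ 2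
      = ∑ σ, ∑ τ, p σ * p τ * R σ τ ^ 2 := by
    have : ∀ i j, (∑ σ, p σ * (spin σ i * spin σ j)) ^ 2
        = ∑ σ, ∑ τ, p σ * p τ * ((spin σ i * spin τ i) * (spin σ j * spin τ j)) := by
      intro i j
      rw [pow_two, Finset.sum_mul_sum]
      refine Finset.sum_congr rfl fun σ _ => Finset.sum_congr rfl fun τ _ => ?_
      ring
    simp only [this]
    have sw : ∀ (A : Fin N → Fin N → Config N → Config N → ℝ),
        ∑ i, ∑ j, ∑ σ, ∑ τ, A i j σ τ = ∑ σ, ∑ τ, ∑ i, ∑ j, A i j σ τ := by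
      intro A
      calc ∑ i, ∑ j, ∑ σ, ∑ τ, A i j σ τ = ∑ i, ∑ σ, ∑ τ, ∑ j, A i j σ τ := by
            refine Finset.sum_congr rfl fun i _ => ?_
            rw [Finset.sum_comm]
            refine Finset.sum_congr rfl fun σ _ => ?_
            rw [Finset.sum_comm]
        _ = _ := by
            rw [Finset.sum_comm]
            refine Finset.sum_congr rfl fun σ _ => ?_
            rw [Finset.sum_comm]
    rw [sw]
    refine Finset.sum_congr rfl fun σ _ => Finset.sum_congr rfl fun τ _ => ?_
    rw [hR, pow_two, Finset.sum_mul_sum, Finset.mul_sum]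
    refine Finset.sum_congr rfl fun i _ => ?_
    rw [Finset.mul_sum]
  have e3 : ∑ i, ∑ j, (∑ σ, p σ * (spin σ i * spin σ j)) ^ 2
      = N + 2 * ∑ c : Couple N, (∑ σ, p σ * (spin σ c.1.1 * spin σ c.1.2)) ^ 2 := by
    rw [sum_sum_eq_couple]
    · simp [spin_sq, hp1]
    · intro i j
      simp only [mul_comm (spin _ i)]
  have e4 : ∑ σ, ∑ τ, p σ * p τ = 1 := by rw [← Finset.sum_mul_sum, hp1, one_mul]
  -- the square with the good sign
  have e5 : 0 ≤ ∑ σ, ∑ τ, p σ * p τ * (R σ τ - N * q) ^ 2 :=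
    Finset.sum_nonneg fun σ _ => Finset.sum_nonneg fun τ _ =>
      mul_nonneg (mul_nonneg (hp σ) (hp τ)) (sq_nonneg _)
  have e6 : ∑ σ, ∑ τ, p σ * p τ * (R σ τ - N * q) ^ 2
      = ∑ σ, ∑ τ, p σ * p τ * R σ τ ^ 2 - 2 * N * q * ∑ σ, ∑ τ, p σ * p τ * R σ τ
        + (N * q) ^ 2 * ∑ σ, ∑ τ, p σ * p τ := by
    simp only [Finset.mul_sum, ← Finset.sum_sub_distrib, ← Finset.sum_add_distrib]
    refine Finset.sum_congr rfl fun σ _ => Finset.sum_congr rfl fun τ _ => ?_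
    ring
  rw [e6, e4, ← e1, ← e2, e3] at e5
  have f1 : ∀ i : Fin N, ∑ σ, p σ * (β * spin σ i) = β * ∑ σ, p σ * spin σ i := fun i => by
    rw [Finset.mul_sum]
    exact Finset.sum_congr rfl fun σ _ => by ring
  have f2 : ∀ c : Couple N, ∑ σ, p σ * (β / √(N : ℝ) * (spin σ c.1.1 * spin σ c.1.2))
      = β / √(N : ℝ) * ∑ σ, p σ * (spin σ c.1.1 * spin σ c.1.2) := fun c => by
    rw [Finset.mul_sum]
    exact Finset.sum_congr rfl fun σ _ => by ring
  rw [Fintype.sum_sum_type]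
  simp only [dirs, Sum.elim_inl, Sum.elim_inr, siteDir, coupleDir, f1, f2, mul_pow, div_pow,
    Real.sq_sqrt hN'.le, one_mul, ← Finset.mul_sum]
  set A := ∑ i, (∑ σ, p σ * spin σ i) ^ 2
  set B := ∑ c : Couple N, (∑ σ, p σ * (spin σ c.1.1 * spin σ c.1.2)) ^ 2
  have f3 : -q * (β ^ 2 * A) + β ^ 2 / N * B + β ^ 2 / 2 * (1 + N * q ^ 2)
      = β ^ 2 / (2 * N) * (N + 2 * B - 2 * N * q * A + (N * q) ^ 2 * 1) := by
    field_simp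
    ring
  have f4 : 0 ≤ β ^ 2 / (2 * N) * (N + 2 * B - 2 * N * q * A + (N * q) ^ 2 * 1) :=
    mul_nonneg (by positivity) e5
  linarith

/-- The recursion for `N` sites. At the parameter `θ` the external fields carry the weight `cos θ`;
in the last round the couplings are averaged with the weight `sin θ`. -/
def siteFun (β : ℝ) (x : ℝ → ℝ) (n : ℕ) : ℕ → ℝ × Energy N → ℝ
  | 0 => fun p => logSumExp p.2
  | j + 1 => coleList (level x n (j + 1)) (fun θ => √(1 / n) * Real.cos θ) (siteDir β)
      Finset.univ.toList (siteFun β x n j)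

/-- The interpolating function, see `siteFun`. -/
def interp (β : ℝ) (x : ℝ → ℝ) (n : ℕ) : ℝ × Energy N → ℝ :=
  coleList (level x n n) Real.sin (coupleDir β) Finset.univ.toList (siteFun β x n n)

/-- Twice the integral of `q * stepFn x n q` over the last `j` intervals of the grid. -/
def levelSum (x : ℝ → ℝ) (n j : ℕ) : ℝ :=
  ∑ i ∈ Finset.range j, level x n (i + 1) * ((1 - (i : ℝ) / n) ^ 2 - (1 - ((i + 1 : ℕ) : ℝ) / n) ^ 2)

theorem regular_siteFun (β : ℝ) (x : ℝ → ℝ) {n : ℕ} (hn : 0 < n) (j : ℕ) :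
    Regular 2 (siteFun (N := N) β x n j) := by
  induction j with
  | zero => exact (regular_logSumExp 2).comp_snd
  | succ j ih => exact ih.coleList (level_pos x hn _) (amplitude_cos 2 _) _ _

theorem regular_interp (β : ℝ) (x : ℝ → ℝ) {n : ℕ} (hn : 0 < n) :
    Regular 2 (interp (N := N) β x n) :=
  (regular_siteFun β x hn n).coleList (level_pos x hn _) (amplitude_sin_one 2) _ _

theorem isGibbs_siteFun (β : ℝ) (x : ℝ → ℝ) {n : ℕ} (hn : 0 < n) (j : ℕ) (θ : ℝ) :
    IsGibbs fun g => siteFun (N := N) β x n j (θ, g) := by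
  induction j with
  | zero => exact isGibbs_logSumExp
  | succ j ih =>
    exact ih.coleList (level_pos x hn _) (amplitude_cos 0 _) _ _ (regular_siteFun β x hn j).pred.pred

theorem sum_single_inl (s : ℝ) : ((Finset.univ : Finset (Fin N)).toList.map fun k =>
    (Pi.single (Sum.inl k) s : Fin N ⊕ Couple N → ℝ)).sum = Sum.elim (fun _ => s) fun _ => 0 := by
  rw [Finset.sum_map_toList]
  funext k
  rw [Finset.sum_apply]
  cases k with
  | inl k => simp [Pi.single_apply]
  | inr k => simp

theorem sum_single_inr (s : ℝ) : ((Finset.univ : Finset (Couple N)).toList.map fun k =>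
    (Pi.single (Sum.inr k) s : Fin N ⊕ Couple N → ℝ)).sum = Sum.elim (fun _ => 0) fun _ => s := by
  rw [Finset.sum_map_toList]
  funext k
  rw [Finset.sum_apply]
  cases k with
  | inl k => simp
  | inr k => simp [Pi.single_apply]

/-- The bound carried through the levels. The coefficients are the derivatives in `θ` of the
variances still to come at the level `q = 1 - j / n`, with `τ = d/dθ sin² θ`. -/
theorem gen_siteFun_le (β : ℝ) {x : ℝ → ℝ} (hx : UnitMonotone x) (hx1 : x 1 = 1) {n : ℕ}
    (hn : 0 < n) (hN : 0 < N) {θ τ : ℝ} (hτ : τ = 2 * (Real.sin θ * Real.cos θ)) (hτ0 : 0 ≤ τ)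
    (j : ℕ) : ∀ g, gen (level x n j) (Sum.elim (fun _ => -(τ * (1 - (j : ℝ) / n))) fun _ => τ)
      (dirs β) (siteFun (N := N) β x n j) (θ, g)
      ≤ -(τ * β ^ 2 / 4 * (level x n j * (1 + N * (1 - (j : ℝ) / n) ^ 2) + N * levelSum x n j)) := by
  induction j with
  | zero =>
    intro g
    rw [level_zero hx1 hn, siteFun, gen_logSumExp β _ τ hN, levelSum]
    simp
    linarith
  | succ j ih =>
    intro g
    have ha : ∀ θ, deriv (fun θ => √(1 / n : ℝ) * Real.cos θ) θ = -(√(1 / n : ℝ) * Real.sin θ) :=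
      fun θ => by simp
    refine gen_coleList_le (level_pos x hn _) (amplitude_cos 2 _) (dirs β) Sum.inl _
      (regular_siteFun β x hn j) _ (fun g => ?_) g
    have hs : 2 * (√(1 / n : ℝ) * Real.cos θ * deriv (fun θ => √(1 / n : ℝ) * Real.cos θ) θ)
        = -(τ / n) := by
      have : √(1 / n : ℝ) * √(1 / n : ℝ) = 1 / n := Real.mul_self_sqrt (by positivity)
      rw [ha, hτ]
      calc 2 * (√(1 / n : ℝ) * Real.cos θ * -(√(1 / n : ℝ) * Real.sin θ))
          = -(2 * (Real.sin θ * Real.cos θ) * (√(1 / n : ℝ) * √(1 / n : ℝ))) := by ring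
        _ = _ := by rw [this]; ring
    have hc : (Sum.elim (fun _ => -(τ * (1 - ((j + 1 : ℕ) : ℝ) / n))) (fun _ => τ)
        + Sum.elim (fun _ => -(τ / n)) fun _ => 0 : Fin N ⊕ Couple N → ℝ)
        = Sum.elim (fun _ => -(τ * (1 - (j : ℝ) / n))) fun _ => τ := by
      funext k
      cases k with
      | inl k => simp; ring
      | inr k => simp
    rw [hs, sum_single_inl, hc, gen_eq_sub (level x n j)]
    obtain ⟨p, hp, hp1, hpD⟩ :=
      (isGibbs_siteFun (N := N) β x hn j θ).exists_prob (regular_siteFun β x hn j).pred g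
    have h1 := ih g
    have h2 := neg_le_sum_dirs β (1 - (j : ℝ) / n) hN hp hp1
    have h3 : ∑ k, (Sum.elim (fun _ => -(τ * (1 - (j : ℝ) / n))) (fun _ => τ) :
        Fin N ⊕ Couple N → ℝ) k * dirDeriv (0, dirs β k) (siteFun (N := N) β x n j) (θ, g) ^ 2
        = τ * ∑ k, (Sum.elim (fun _ => -(1 - (j : ℝ) / n)) fun _ => 1 : _ → ℝ) k *
      (∑ σ, p σ * dirs (N := N) β k σ) ^ 2 := by
      rw [Finset.mul_sum]
      refine Finset.sum_congr rfl fun k _ => ?_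
      rw [hpD]
      cases k with
      | inl k => simp; ring
      | inr k => simp
    rw [h3]
    -- monotonicity of the order parameter
    have h4 : 0 ≤ level x n j - level x n (j + 1) := sub_nonneg.2 (level_succ_le hx n j)
    have h5 := mul_le_mul_of_nonneg_left h2 (mul_nonneg h4 hτ0)
    have h6 : levelSum x n (j + 1) = levelSum x n j + level x n (j + 1) *
        ((1 - (j : ℝ) / n) ^ 2 - (1 - ((j + 1 : ℕ) : ℝ) / n) ^ 2) := Finset.sum_range_succ _ _
    rw [h6]
    linarith

/-- At the last level `q = 0` the fields have no variance left, and the remaining step along the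
couplings uses up their coefficients as well: `gen` is reduced to `∂_θ`. -/
theorem dirDeriv_interp_le (β : ℝ) {x : ℝ → ℝ} (hx : UnitMonotone x) (hx1 : x 1 = 1) {n : ℕ}
    (hn : 0 < n) (hN : 0 < N) {θ : ℝ} (hθ : θ ∈ Icc 0 (Real.pi / 2)) (g : Energy N) :
    dirDeriv (1, 0) (interp (N := N) β x n) (θ, g)
      ≤ -(N * β ^ 2 / 4 * levelSum x n n) * (2 * (Real.sin θ * Real.cos θ)) := by
  set τ := 2 * (Real.sin θ * Real.cos θ) with hτ
  have hτ0 : 0 ≤ τ := by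
    have h1 := Real.sin_nonneg_of_nonneg_of_le_pi hθ.1 (by linarith [hθ.2, Real.pi_pos])
    have h2 := Real.cos_nonneg_of_neg_pi_div_two_le_of_le
      (by linarith [hθ.1, Real.pi_pos] : -(Real.pi / 2) ≤ θ) hθ.2
    positivity
  have hn' : (n : ℝ) ≠ 0 := by positivity
  have h := gen_coleList_le (level_pos x hn n) (amplitude_sin_one 2) (dirs β) Sum.inr
    Finset.univ.toList (regular_siteFun (N := N) β x hn n) (θ := θ)
    (K := -(τ * β ^ 2 / 4 * (N * levelSum x n n))) 0 (fun g => ?_) g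
  · rw [gen] at h
    simp only [Pi.zero_apply, zero_mul, Finset.sum_const_zero, mul_zero, add_zero] at h
    refine le_trans h (le_of_eq ?_)
    ring
  · have h1 := gen_siteFun_le β hx hx1 hn hN hτ hτ0 n g
    rw [div_self hn', sub_self, mul_zero, neg_zero] at h1
    rw [zero_add, Real.deriv_sin, ← hτ, sum_single_inr]
    refine h1.trans ?_
    have h2 := level_pos x hn n
    have : 0 ≤ τ * β ^ 2 / 4 * (level x n n * (1 + N * 0 ^ 2)) := by positivity
    linarith

/-- The interpolation inequality: integrated over `[0, π / 2]`, the bound of `dirDeriv_interp_le`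
gives `sin² (π / 2) = 1` times its constant. -/
theorem interp_pi_div_two_le (β : ℝ) {x : ℝ → ℝ} (hx : UnitMonotone x) (hx1 : x 1 = 1) {n : ℕ}
    (hn : 0 < n) (hN : 0 < N) (g : Energy N) :
    interp (N := N) β x n (Real.pi / 2, g)
      ≤ interp β x n (0, g) - N * β ^ 2 / 4 * levelSum x n n := by
  set K := N * β ^ 2 / 4 * levelSum x n n with hK
  have hd : ∀ θ, HasDerivAt (fun θ => interp (N := N) β x n (θ, g) + K * Real.sin θ ^ 2)
      (dirDeriv (1, 0) (interp (N := N) β x n) (θ, g) + K * (2 * (Real.sin θ * Real.cos θ))) θ := by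
    intro θ
    have h1 : HasDerivAt (fun θ : ℝ => (θ, g)) (1, 0) θ :=
      (hasDerivAt_id θ).prodMk (hasDerivAt_const θ g)
    have h2 := ((regular_interp (N := N) β x hn).1.hasFDerivAt (θ, g)).comp_hasDerivAt θ h1
    have h3 := (((Real.hasDerivAt_sin θ).pow 2).const_mul K)
    refine (h2.add h3).congr_deriv ?_
    simp only [dirDeriv]
    norm_num
    left
    ring
  have hanti : AntitoneOn (fun θ => interp (N := N) β x n (θ, g) + K * Real.sin θ ^ 2)
      (Icc 0 (Real.pi / 2)) := by
    refine antitoneOn_of_deriv_nonpos (convex_Icc _ _)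
      (fun θ _ => (hd θ).continuousAt.continuousWithinAt)
      (fun θ _ => (hd θ).differentiableAt.differentiableWithinAt) fun θ hθ => ?_
    rw [(hd θ).deriv]
    have := dirDeriv_interp_le β hx hx1 hn hN (interior_subset hθ) g
    rw [← hK] at this
    linarith
  have := hanti ⟨le_rfl, by positivity⟩ ⟨by positivity, le_rfl⟩
    (by positivity : (0 : ℝ) ≤ Real.pi / 2)
  simp at this
  linarith

end Sites

/-! ### The end points of the interpolation -/

section EndPoints

variable {N : ℕ}

/-- On sums of functions of the coordinates `y i` of `∑ i, y i • v i`, a Hopf–Cole step along `v k`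
acts on the `k`-th function only. -/
theorem cole_sum {E ι : Type} [NormedAddCommGroup E] [NormedSpace ℝ E] [Fintype ι] [DecidableEq ι]
    {m : ℝ} (hm : 0 < m) {a : ℝ → ℝ} (ha : Amplitude 0 a) {φ : ℝ × E → ℝ} (hφ : Regular 0 φ)
    (v : ι → E) {θ c : ℝ} {G : ι → ℝ → ℝ}
    (h : ∀ y : ι → ℝ, φ (θ, ∑ i, y i • v i) = c + ∑ i, G i (y i)) (k : ι) (y : ι → ℝ) :
    cole m a (v k) φ (θ, ∑ i, y i • v i)
      = c + ∑ i, Function.update G k (hopf m (a θ) (G k)) i (y i) := by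
  set C := c + ∑ i ∈ Finset.univ.erase k, G i (y i) with hC
  have e : ∀ z, φ (shift a (v k) ((θ, ∑ i, y i • v i), z)) = C + G k (y k + z * a θ) := by
    intro z
    have h1 := h (Function.update y k (y k + z * a θ))
    rw [← Finset.add_sum_erase _ _ (Finset.mem_univ k),
      ← Finset.add_sum_erase _ _ (Finset.mem_univ k)] at h1
    have h2 : ∀ i ∈ Finset.univ.erase k, Function.update y k (y k + z * a θ) i = y i := fun i hi =>
      Function.update_of_ne (Finset.ne_of_mem_erase hi) _ _
    rw [Finset.sum_congr rfl fun i hi => by rw [h2 i hi],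
      Finset.sum_congr (g := fun i => G i (y i)) rfl fun i hi => by rw [h2 i hi],
      Function.update_self] at h1
    have h3 : shift a (v k) ((θ, ∑ i, y i • v i), z)
        = (θ, (y k + z * a θ) • v k + ∑ i ∈ Finset.univ.erase k, y i • v i) := by
      simp only [shift]
      rw [← Finset.add_sum_erase _ _ (Finset.mem_univ k), add_smul]
      congr 1
      abel
    rw [h3, h1, hC]
    ring
  have e2 : gavg a (v k) (fun q => Real.exp (m * φ q)) (θ, ∑ i, y i • v i)
      = Real.exp (m * C) * ∫ z, Real.exp (m * G k (y k + z * a θ)) ∂gauss := by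
    rw [gavg, ← integral_const_mul]
    refine integral_congr_ae (.of_forall fun z => ?_)
    simp only [e]
    rw [mul_add, Real.exp_add]
  have hp := gavg_exp_pos hm ha (v k) hφ (θ, ∑ i, y i • v i)
  rw [e2] at hp
  have hp' := pos_of_mul_pos_right hp (Real.exp_pos _).le
  rw [cole, e2, Real.log_mul (Real.exp_pos _).ne' hp'.ne', Real.log_exp, mul_add,
    inv_mul_cancel_left₀ hm.ne', ← Finset.add_sum_erase _ _ (Finset.mem_univ k),
    Function.update_self, hC, add_comm (hopf m (a θ) (G k) (y k)), ← add_assoc]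
  congr 2
  refine Finset.sum_congr rfl fun i hi => ?_
  rw [Function.update_of_ne (Finset.ne_of_mem_erase hi)]

theorem coleList_sum {E ι : Type} [NormedAddCommGroup E] [NormedSpace ℝ E] [Fintype ι]
    [DecidableEq ι] {m : ℝ} (hm : 0 < m) {a : ℝ → ℝ} (ha : Amplitude 0 a) {φ : ℝ × E → ℝ}
    (hφ : Regular 0 φ) (v : ι → E) {θ c : ℝ} {F : ℝ → ℝ}
    (h : ∀ y : ι → ℝ, φ (θ, ∑ i, y i • v i) = c + ∑ i, F (y i)) {l : List ι} (hl : l.Nodup) :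
    ∀ y : ι → ℝ, coleList m a v l φ (θ, ∑ i, y i • v i)
      = c + ∑ i, (if i ∈ l then hopf m (a θ) F else F) (y i) := by
  induction l with
  | nil => simpa [coleList] using h
  | cons k l ih =>
    intro y
    rw [List.nodup_cons] at hl
    rw [coleList_cons, cole_sum hm ha (hφ.coleList hm ha v l) v (ih hl.2)]
    congr 1
    refine Finset.sum_congr rfl fun i _ => congrFun ?_ (y i)
    rw [Function.update_apply, if_neg hl.1]
    simp only [List.mem_cons]
    split_ifs <;> tauto

theorem logSumExp_sum_siteDir (β : ℝ) (y : Fin N → ℝ) :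
    logSumExp (∑ i, y i • siteDir β i) = N * Real.log 2 + ∑ i, Real.log (Real.cosh (β * y i)) := by
  have h1 : ∑ σ : Config N, Real.exp ((∑ i, y i • siteDir β i : Energy N) σ)
      = ∏ i, (2 * Real.cosh (β * y i)) := by
    -- the sum over the configurations factorizes
    have h2 : ∀ i, 2 * Real.cosh (β * y i)
        = ∑ s : ℤˣ, Real.exp (y i * (β * ((s : ℤ) : ℝ))) := fun i => by
      rw [UnitsInt.univ, Finset.sum_pair (by decide), Real.cosh_eq]
      simp
      ring_nf
    simp only [h2]
    rw [Finset.prod_univ_sum, Fintype.piFinset_univ]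
    refine Finset.sum_congr rfl fun σ _ => ?_
    rw [← Real.exp_sum, Finset.sum_apply]
    rfl
  rw [logSumExp, h1, Real.log_prod fun i _ => by positivity]
  simp only [Real.log_mul two_ne_zero (Real.cosh_pos _).ne', Finset.sum_add_distrib]
  simp

/-- Without couplings the sites decouple, and each of them undergoes the recursion for one site. -/
theorem siteFun_zero (β : ℝ) (x : ℝ → ℝ) {n : ℕ} (hn : 0 < n) (j : ℕ) : ∀ y : Fin N → ℝ,
    siteFun β x n j (0, ∑ i, y i • siteDir β i)
      = N * Real.log 2 + ∑ i, levelFun β x n j (y i) := by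
  induction j with
  | zero => exact fun y => logSumExp_sum_siteDir β y
  | succ j ih =>
    intro y
    rw [siteFun, coleList_sum (level_pos x hn _) (amplitude_cos 0 _)
      (regular_siteFun β x hn j).pred.pred _ ih (Finset.nodup_toList _)]
    simp [levelFun]

theorem interp_zero (β h : ℝ) (x : ℝ → ℝ) {n : ℕ} (hn : 0 < n) :
    interp (N := N) β x n (0, ∑ i, h • siteDir β i)
      = N * (Real.log 2 + levelFun β x n n h) := by
  rw [interp, coleList_eq_self (level_pos x hn _) _ _ _ Real.sin_zero,
    siteFun_zero β x hn n fun _ => h]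
  simp
  ring

/-- Jensen's inequality: a Hopf–Cole step is at least the plain average. -/
theorem gavg_le_cole {E : Type} [NormedAddCommGroup E] [NormedSpace ℝ E] {m : ℝ} (hm : 0 < m)
    {a : ℝ → ℝ} (ha : Amplitude 0 a) (v : E) {φ : ℝ × E → ℝ} (hφ : Regular 0 φ) (p : ℝ × E) :
    gavg a v φ p ≤ cole m a v φ p := by
  have h := convexOn_exp.map_integral_le Real.continuous_exp.continuousOn isClosed_univ
    (.of_forall fun _ => mem_univ _) ((integrable_shift ha v hφ.1 p).const_mul m)
    (integrable_shift ha v (hφ.exp m) p)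
  rw [integral_const_mul] at h
  have h2 := Real.log_le_log (Real.exp_pos _) h
  rw [Real.log_exp] at h2
  rw [cole, le_inv_mul_iff₀ hm]
  exact h2

theorem Regular.integrable_comp {E : Type} [NormedAddCommGroup E] [NormedSpace ℝ E] {φ : E → ℝ}
    (hφ : Regular 0 φ) {Ω : Type*} [MeasurableSpace Ω] {P : Measure Ω} [IsProbabilityMeasure P]
    {X : Ω → E} (hX : Integrable X P) : Integrable (fun ω => φ (X ω)) P := by
  obtain ⟨A, hA, h⟩ := hφ.2
  exact ((hX.norm.add (integrable_const 1)).const_mul A).mono'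
    (hφ.1.continuous.comp_aestronglyMeasurable hX.aestronglyMeasurable) (.of_forall fun ω => by
      simpa [add_comm] using h (X ω))

section Couplings

variable {Ω : Type*} [MeasurableSpace Ω] {P : Measure Ω} [IsProbabilityMeasure P]

theorem integrable_of_hasLaw {X : Ω → ℝ} (hX : HasLaw X (gaussianReal 0 1) P) : Integrable X P := by
  have h : Integrable (fun z : ℝ => z) (P.map X) := by
    rw [hX.map_eq]
    exact (memLp_id_gaussianReal 1).integrable le_rfl
  exact h.comp_aemeasurable hX.aemeasurable

/-- The Hopf–Cole steps dominate the expectation over the corresponding independent Gaussian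
displacements. -/
theorem integral_le_coleList {κ : Type} [DecidableEq κ] {J : κ → Ω → ℝ}
    (hJ : ∀ k, HasLaw (J k) (gaussianReal 0 1) P) (hi : iIndepFun J P) {m : ℝ} (hm : 0 < m)
    {a : ℝ → ℝ} (ha : Amplitude 0 a) {θ : ℝ} (h1 : a θ = 1) (v : κ → Energy N)
    {φ : ℝ × Energy N → ℝ} (hφ : Regular 0 φ) {l : List κ} (hl : l.Nodup) : ∀ g : Energy N,
    ∫ ω, φ (θ, g + ∑ k ∈ l.toFinset, J k ω • v k) ∂P ≤ coleList m a v l φ (θ, g) := by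
  have hY : ∀ k, Integrable (fun ω => J k ω • v k) P := fun k =>
    (integrable_of_hasLaw (hJ k)).smul_const _
  have hS : ∀ l : List κ, Integrable (fun ω => ∑ k ∈ l.toFinset, J k ω • v k) P := fun l =>
    integrable_finsetSum _ fun k _ => hY k
  induction l with
  | nil => simp [coleList]
  | cons k l ih =>
    intro g
    rw [List.nodup_cons] at hl
    have hk : k ∉ l.toFinset := fun h => hl.1 (List.mem_toFinset.1 h)
    set Y : Ω → Energy N := fun ω => J k ω • v k
    set S : Ω → Energy N := fun ω => ∑ k ∈ l.toFinset, J k ω • v k with hSd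
    have hYm : AEMeasurable Y P := (hY k).aestronglyMeasurable.aemeasurable
    have hSm : AEMeasurable S P := (hS l).aestronglyMeasurable.aemeasurable
    have hind : IndepFun Y S P := by
      have h2 : iIndepFun (fun k ω => J k ω • v k) P :=
        hi.comp (fun k (t : ℝ) => t • v k) fun k => by fun_prop
      have h3 := h2.indepFun_finsetSum_of_notMem₀
        (fun k => (hY k).aestronglyMeasurable.aemeasurable) hk
      have h4 : ∑ k ∈ l.toFinset, (fun ω => J k ω • v k) = S := by
        funext ω
        simp [hSd]
      rw [h4] at h3
      exact h3.symm
    have hprod := (indepFun_iff_map_prod_eq_prod_map_map hYm hSm).1 hind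
    have hr := (hφ.slice θ)
    have hYS : AEMeasurable (fun ω => (Y ω, S ω)) P := hYm.prodMk hSm
    have hc : Continuous fun p : Energy N × Energy N => φ (θ, g + (p.1 + p.2)) :=
      hr.1.continuous.comp (by fun_prop)
    have hint : Integrable (fun p : Energy N × Energy N => φ (θ, g + (p.1 + p.2)))
        ((P.map Y).prod (P.map S)) := by
      rw [← hprod, integrable_map_measure hc.aestronglyMeasurable hYS]
      exact hr.integrable_comp ((integrable_const g).add ((hY k).add (hS l)))
    have hYl : P.map Y = gauss.map fun z => z • v k := by
      have : Y = (fun z : ℝ => z • v k) ∘ J k := rfl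
      rw [this, ← AEMeasurable.map_map_of_aemeasurable (by fun_prop) (hJ k).aemeasurable,
        (hJ k).map_eq]
    have hψ := hφ.coleList hm ha v l
    have hzm : AEMeasurable (fun z : ℝ => z • v k) gauss := by fun_prop
    calc ∫ ω, φ (θ, g + ∑ k ∈ (k :: l).toFinset, J k ω • v k) ∂P
        = ∫ ω, φ (θ, g + (Y ω + S ω)) ∂P := by
          simp only [List.toFinset_cons, Finset.sum_insert hk, Y, S]
      _ = ∫ p, φ (θ, g + (p.1 + p.2)) ∂(P.map fun ω => (Y ω, S ω)) :=
          (integral_map hYS hc.aestronglyMeasurable).symm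
      _ = ∫ y, ∫ s, φ (θ, g + (y + s)) ∂(P.map S) ∂(P.map Y) := by
          rw [hprod, integral_prod _ hint]
      _ = ∫ z, ∫ s, φ (θ, g + (z • v k + s)) ∂(P.map S) ∂gauss := by
          have := hint.integral_prod_left.aestronglyMeasurable
          rw [hYl] at this ⊢
          rw [integral_map hzm this]
      _ ≤ ∫ z, coleList m a v l φ (shift a (v k) ((θ, g), z)) ∂gauss := by
          have h5 := hint.integral_prod_left
          rw [hYl] at h5
          refine integral_mono (h5.comp_aemeasurable hzm) (integrable_shift ha (v k) hψ.1 _)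
            fun z => ?_
          have h6 : Continuous fun s : Energy N => φ (θ, g + (z • v k + s)) :=
            hr.1.continuous.comp (by fun_prop)
          simp only [shift, h1, mul_one]
          rw [integral_map hSm h6.aestronglyMeasurable]
          simpa only [add_assoc] using ih hl.2 (g + z • v k)
      _ ≤ coleList m a v (k :: l) φ (θ, g) := gavg_le_cole hm ha (v k) hψ _

theorem log_partitionFunction (β h : ℝ) (J : Couple N → ℝ) : Real.log (partitionFunction β h J)
    = logSumExp (∑ i, h • siteDir β i + ∑ p, J p • coupleDir β p) := by
  unfold partitionFunction logSumExp
  congr 1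
  refine Finset.sum_congr rfl fun σ _ => ?_
  congr 1
  simp only [hamiltonian, Pi.add_apply, Finset.sum_apply, Pi.smul_apply, smul_eq_mul, siteDir,
    coupleDir, mul_sub, Finset.mul_sum]
  rw [sub_eq_add_neg, add_comm, ← Finset.sum_neg_distrib]
  congr 1
  · exact Finset.sum_congr rfl fun i _ => by ring
  · exact Finset.sum_congr rfl fun p _ => by ring

theorem integrable_log_partitionFunction (β h : ℝ) {J : Couple N → Ω → ℝ}
    (hJ : ∀ p, HasLaw (J p) (gaussianReal 0 1) P) :
    Integrable (fun ω => Real.log (partitionFunction β h fun p => J p ω)) P := by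
  simp only [log_partitionFunction]
  exact (regular_logSumExp 0).integrable_comp ((integrable_const _).add
    (integrable_finsetSum _ fun p _ => (integrable_of_hasLaw (hJ p)).smul_const _))

/-- The upper bound for one grid approximation of the order parameter. -/
theorem integral_log_partitionFunction_le (β h : ℝ) {x : ℝ → ℝ} (hx : UnitMonotone x)
    (hx1 : x 1 = 1) {n : ℕ} (hn : 0 < n) (hN : 0 < N) {J : Couple N → Ω → ℝ}
    (hJ : ∀ p, HasLaw (J p) (gaussianReal 0 1) P) (hi : iIndepFun J P) :
    ∫ ω, Real.log (partitionFunction β h fun p => J p ω) ∂P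
      ≤ N * (Real.log 2 + levelFun β x n n h) - N * β ^ 2 / 4 * levelSum x n n := by
  have h1 := integral_le_coleList hJ hi (level_pos x hn n) (amplitude_sin_one 0)
    Real.sin_pi_div_two (coupleDir β) (regular_siteFun β x hn n).pred.pred
    (Finset.nodup_toList Finset.univ) (∑ i, h • siteDir β i)
  have h2 := interp_pi_div_two_le β hx hx1 hn hN (∑ i, h • siteDir β i)
  rw [interp_zero β h x hn] at h2
  -- at `θ = π / 2` the local fields have amplitude `0`
  have h3 : ∀ j g, siteFun (N := N) β x n j (Real.pi / 2, g) = logSumExp g := by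
    intro j
    induction j with
    | zero => exact fun g => rfl
    | succ j ih =>
      intro g
      rw [siteFun, coleList_eq_self (level_pos x hn _) _ _ _ (by simp), ih]
  simp only [h3, Finset.toList_toFinset] at h1
  simp only [log_partitionFunction]
  exact h1.trans h2

end Couplings

end EndPoints

/-! ### Refinement of the grid -/

theorem intervalIntegrable_mul_unitMonotone {x : ℝ → ℝ} (hx : UnitMonotone x) (a b : ℝ) :
    IntervalIntegrable (fun q => q * x q) volume a b :=
  hx.mono.intervalIntegrable.continuousOn_mul continuousOn_id

theorem integral_stepFn {x : ℝ → ℝ} (hx : UnitMonotone x) {n : ℕ} (hn : 0 < n) (j : ℕ) :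
    ∫ q in (1 - (j : ℝ) / n)..1, q * stepFn x n q = levelSum x n j / 2 := by
  induction j with
  | zero => simp [levelSum]
  | succ j ih =>
    have hI := intervalIntegrable_mul_unitMonotone (unitMonotone_stepFn hx hn)
    have hle : 1 - ((j + 1 : ℕ) : ℝ) / n ≤ 1 - (j : ℝ) / n := by
      gcongr
      simp
    have h1 : ∫ q in (1 - ((j + 1 : ℕ) : ℝ) / n)..(1 - (j : ℝ) / n), q * stepFn x n q
        = ∫ q in (1 - ((j + 1 : ℕ) : ℝ) / n)..(1 - (j : ℝ) / n), q * level x n (j + 1) := by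
      rw [intervalIntegral.integral_of_le hle, intervalIntegral.integral_of_le hle,
        integral_Ioc_eq_integral_Ioo, integral_Ioc_eq_integral_Ioo]
      refine setIntegral_congr_fun measurableSet_Ioo fun q hq => ?_
      simp only [stepFn_eq_level hn j ⟨hq.1.le, hq.2⟩]
    rw [← intervalIntegral.integral_add_adjacent_intervals (hI _ _) (hI _ _), ih, h1,
      intervalIntegral.integral_mul_const, integral_id]
    simp only [levelSum]
    rw [Finset.sum_range_succ]
    ring

theorem levelSum_eq {x : ℝ → ℝ} (hx : UnitMonotone x) {n : ℕ} (hn : 0 < n) :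
    levelSum x n n = 2 * ∫ q in (0 : ℝ)..1, q * stepFn x n q := by
  have h := integral_stepFn hx hn n
  rw [div_self (by positivity), sub_self] at h
  linarith

theorem tendsto_levelSum {x : ℝ → ℝ} (hx : UnitMonotone x) :
    Tendsto (fun n => levelSum x (n + 1) (n + 1)) atTop (𝓝 (2 * ∫ q in (0 : ℝ)..1, q * x q)) := by
  simp only [levelSum_eq hx (Nat.succ_pos _)]
  refine Tendsto.const_mul 2 ?_
  refine intervalIntegral.tendsto_integral_filter_of_dominated_convergence (fun _ => 1)
    (.of_forall fun n => (intervalIntegrable_mul_unitMonotone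
      (unitMonotone_stepFn hx n.succ_pos) 0 1).def'.aestronglyMeasurable)
    (.of_forall fun n => .of_forall fun q hq => ?_) intervalIntegrable_const ?_
  · rw [uIoc_of_le zero_le_one] at hq
    have h1 := (unitMonotone_stepFn hx n.succ_pos).mem q
    rw [Real.norm_eq_abs, abs_of_nonneg (mul_nonneg hq.1.le h1.1)]
    exact mul_le_one₀ hq.2 h1.1 h1.2
  · filter_upwards [ae_tendsto_stepFn hx] with q hq _
    exact (hq.comp (tendsto_add_atTop_nat 1)).const_mul q

/-- The upper bound for one order parameter. -/
theorem integral_log_partitionFunction_le_trial (β h : ℝ) {x : ℝ → ℝ} (hx : x ∈ OrderParameter)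
    {N : ℕ} (hN : 0 < N) {Ω : Type*} [MeasurableSpace Ω] {P : Measure Ω} [IsProbabilityMeasure P]
    {J : Couple N → Ω → ℝ} (hJ : ∀ p, HasLaw (J p) (gaussianReal 0 1) P) (hi : iIndepFun J P) :
    (N : ℝ)⁻¹ * ∫ ω, Real.log (partitionFunction β h fun p => J p ω) ∂P ≤ trial β h x := by
  have hx' := unitMonotone_extendUnit hx
  have hN' : (0 : ℝ) < N := by positivity
  have e : ∫ q in (0 : ℝ)..1, q * x q = ∫ q in (0 : ℝ)..1, q * extendUnit x q := by
    rw [intervalIntegral.integral_of_le zero_le_one, intervalIntegral.integral_of_le zero_le_one,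
      integral_Ioc_eq_integral_Ioo, integral_Ioc_eq_integral_Ioo]
    refine setIntegral_congr_fun measurableSet_Ioo fun q hq => ?_
    simp only [extendUnit_eq x q hq]
  rw [inv_mul_le_iff₀ hN']
  have hlim := (((tendsto_levelFun β hx h).const_add (Real.log 2)).const_mul (N : ℝ)).sub
    ((tendsto_levelSum hx').const_mul (N * β ^ 2 / 4))
  refine (ge_of_tendsto' hlim fun n =>
    integral_log_partitionFunction_le β h hx' (extendUnit_one x) n.succ_pos hN hJ hi).trans
    (le_of_eq ?_)
  rw [trial, e]
  ring

end SpinGlass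

end

theorem theorem2 (β h : ℝ) :
    -- for every order parameter the antiparabolic equation has one and only one solution,
    -- so that `parisiF` is that solution and the trial function is well defined
    (∀ x ∈ SpinGlass.OrderParameter,
      SpinGlass.IsParisiSolution β x (SpinGlass.parisiF β x) ∧
      ∀ g, SpinGlass.IsParisiSolution β x g →
        ∀ q ∈ Set.Icc (0 : ℝ) 1, ∀ y : ℝ, g q y = SpinGlass.parisiF β x q y) ∧
    -- the bounds, for every number `N` of sites and i.i.d. centered unit Gaussian couplings
    ∀ (N : ℕ) (_ : 0 < N) {Ω : Type*} [MeasurableSpace Ω] (P : MeasureTheory.Measure Ω)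
      [MeasureTheory.IsProbabilityMeasure P] (J : SpinGlass.Couple N → Ω → ℝ)
      (_ : ∀ p, ProbabilityTheory.HasLaw (J p) (ProbabilityTheory.gaussianReal 0 1) P)
      (_ : ProbabilityTheory.iIndepFun J P),
      MeasureTheory.Integrable
        (fun ω => Real.log (SpinGlass.partitionFunction β h (fun p => J p ω))) P ∧
      (∀ x ∈ SpinGlass.OrderParameter,
        (N : ℝ)⁻¹ * ∫ ω, Real.log (SpinGlass.partitionFunction β h (fun p => J p ω)) ∂P
          ≤ SpinGlass.trial β h x) ∧
      (N : ℝ)⁻¹ * ∫ ω, Real.log (SpinGlass.partitionFunction β h (fun p => J p ω)) ∂P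
        ≤ ⨅ x : SpinGlass.OrderParameter, SpinGlass.trial β h x := by
  refine ⟨fun x hx => ⟨SpinGlass.isParisiSolution_parisiF β hx,
    fun g hg q hq y => SpinGlass.parisiF_unique β hx hg hq y⟩, ?_⟩
  intro N hN Ω _ P _ J hJ hi
  have hb : ∀ x ∈ SpinGlass.OrderParameter, _ := fun x hx =>
    SpinGlass.integral_log_partitionFunction_le_trial β h hx hN hJ hi
  have : Nonempty SpinGlass.OrderParameter :=
    ⟨⟨fun _ => 0, fun _ _ _ _ _ => le_rfl, fun _ _ => ⟨le_rfl, zero_le_one⟩⟩⟩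
  exact ⟨SpinGlass.integrable_log_partitionFunction β h hJ, hb, le_ciInf fun x => hb x x.2⟩
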